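/- A walk on $\mathbb Z^2$ starts at $(0,0)$ and takes unit steps north, east, south, west. It is \emph{prudent} if it is self-avoiding and never takes a step in a direction in which an already visited node lies ahead. A prudent walk is \emph{3-sided} if each of its initial parts ends on the north, east or west side of its bounding box and if, whenever the box has non-zero width, a south step is not followed by a west (resp. east) step from the east (resp. west) side of the box. A \emph{3-sided prudent polygon} is a 3-sided prudent walk of more than one step that ends at a neighbour of its starting point; its area is the area enclosed once the walk is closed by one more step. Let $PA_n$ be the (finite) number of 3-sided prudent polygons of area $n$ and $PA(q)=\sum_n PA_nq^n$, which converges for $|q|<1/2$. With $(x;q)_n=\prod_{i=0}^{n-1}(1-xq^i)$, $(x;q)_\infty=\prod_{i\ge0}(1-xq^i)$ and principal logarithms, put \[ v=\frac{1-q+q^2}{1-q},\quad a=\frac{q^2}{1-q+q^2},\quad \gamma=\frac{\log v}{\log(1/q)},\quad t=1-2q, \] \[ A(q)=\frac{2q(1-q)^2}{(1-2q)^2},\quad C(q)=\frac{2q(3-10q+9q^2-q^3)}{(1-q)(1-2q)^2},\quad D(q)=C(q)-\frac{q^2}{(1-q)^2}A(q)\frac{(v;q)_\infty}{(av;q)_\infty},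 \] \[ T(q)=\sum_{j\ge0}\frac{(aq^{-j};q)_j}{(q^{-j};q)_j}\sum_{\nu\ge1}\frac{v^\nu q^{(j+1)\nu}}{1-2q+q^{\nu+2}}, \] \[ \Pi(u)=\sum_{k\in\mathbb Z}p_ke^{-2ik\pi u},\qquad p_k=\frac{\pi}{\sin\bigl(\pi\gamma+2ik\pi^2/\log(1/q)\bigr)}, \] \[ U(q)=\frac{vq^{3\gamma-2}}{\log(1/q)}\,\frac{(-q^{-1}t;q)_\infty}{(-aq^{-2}t;q)_\infty}, \] \[ V(q)=-\frac{(q;q)_\infty}{(a;q)_\infty}\frac{q^{-2}}{1+q^{-2}t}+q^{-2}\frac{(q;q)_\infty(av;q)_\infty}{(a;q)_\infty(v;q)_\infty}\sum_{r\ge0}\frac{(a^{-1}v^{-1}q;q)_r}{(v^{-1}q;q)_r}(-aq^{-2}t)^r. \] Then $U$ and $V$ are analytic at $q=1/2$, and the following hold. (i) There is $\epsilon>0$ such that for all real $q\in(1/2-\epsilon,1/2)$ \[ PA(q)=D(q)-q^2A(q)\frac{(a;q)_\infty(v;q)_\infty}{(q;q)_\infty(av;q)_\infty}\,T(q), \qquad(1)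 \] \[ T(q)=(1-2q)^{-\gamma}\,\Pi\!\left(\frac{\log(1-2q)}{\log(1/q)}\right)U(q)+V(q). \qquad(2) \] (ii) There are $\theta_0\in(0,\pi/2)$ and $r_0>0$ such that $PA$ has an analytic continuation from the disc $|q|<1/2$ to its union with the sector $\{1/2+re^{i\theta}:0<r<r_0,\ \theta_0<\theta<2\pi-\theta_0\}$, and (1), (2) hold for this continuation at every $q$ in the sector. In both cases, at each such $q$, no denominator $1-2q+q^{\nu+2}$ ($\nu\ge1$) vanishes, the double sum $T(q)$ and the series in $V(q)$ converge absolutely, and the terms of the Fourier series $\Pi$ at $u=\log(1-2q)/\log(1/q)$ are bounded by $K\rho^{|k|}$ for some $K$ and some $\rho<1$. -/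

import Mathlib

noncomputable section

namespace PrudentPolygon

/-! ### Walks on the square lattice -/

/-- A unit step of a walk on the square lattice. -/
inductive Step where
  | north
  | east
  | south
  | west

/-- The displacement of a step. -/
def Step.vec : Step → ℤ × ℤ
  | .north => (0, 1)
  | .east => (1, 0)
  | .south => (0, -1)
  | .west => (-1, 0)

/-- A walk is the word of its steps; it starts at the origin. This is its last node. -/
def endpoint (w : List Step) : ℤ × ℤ := (w.map Step.vec).sum

/-- The nodes occupied by a walk, its two ends included. -/
def visited (w : List Step) : Set (ℤ × ℤ) := {x | ∃ p, p <+: w ∧ endpoint p = x}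

/-- A walk is self-avoiding if it visits no node twice. -/
def IsSelfAvoiding (w : List Step) : Prop :=
  ∀ p r, p <+: w → r <+: w → endpoint p = endpoint r → p = r

/-- A prudent walk is a self-avoiding walk that never takes a step towards an already occupied
node: no node on the half-line ahead of a step has been visited before the step. -/
def IsPrudent (w : List Step) : Prop :=
  IsSelfAvoiding w ∧
    ∀ p s, p ++ [s] <+: w → ∀ k : ℕ, 0 < k → endpoint p + k • s.vec ∉ visited p

/-- The walk ends on the north side of its bounding box. -/
def EndsNorth (w : List Step) : Prop := ∀ x ∈ visited w, x.2 ≤ (endpoint w).2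

/-- The walk ends on the east side of its bounding box. -/
def EndsEast (w : List Step) : Prop := ∀ x ∈ visited w, x.1 ≤ (endpoint w).1

/-- The walk ends on the west side of its bounding box. -/
def EndsWest (w : List Step) : Prop := ∀ x ∈ visited w, (endpoint w).1 ≤ x.1

/-- The bounding box of the walk has non-zero width. -/
def HasWidth (w : List Step) : Prop := ∃ x ∈ visited w, ∃ y ∈ visited w, x.1 ≠ y.1

/-- A prudent walk is 3-sided if each initial part of it ends on the north, east or west side of
its bounding box and if, when the box has non-zero width, a south step is never followed by a west
(east) step from the east (west) side of the box. The last condition says that the walk, run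
continuously, does not travel along the south side of a box of width one. -/
def IsThreeSided (w : List Step) : Prop :=
  (∀ p, p <+: w → EndsNorth p ∨ EndsEast p ∨ EndsWest p) ∧
  (∀ p, p ++ [.south, .west] <+: w →
    ¬ (HasWidth (p ++ [.south]) ∧ EndsEast (p ++ [.south]))) ∧
  (∀ p, p ++ [.south, .east] <+: w →
    ¬ (HasWidth (p ++ [.south]) ∧ EndsWest (p ++ [.south])))

/-- A walk of more than one step is the walk of a polygon if it ends at a neighbour of its
starting point; one more step then closes the polygon. -/
def Closes (w : List Step) : Prop := 2 ≤ w.length ∧ ∃ s : Step, endpoint w + s.vec = 0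

/-- The area enclosed by the closed polygon of `w`, as the absolute value of the contour integral
`∮ x dy`: the edges of the walk and then the closing edge from the last node to the origin. -/
def area (w : List Step) : ℕ :=
  (∑ i ∈ Finset.range w.length,
      (endpoint (w.take i)).1 * ((endpoint (w.take (i + 1))).2 - (endpoint (w.take i)).2)
    + (endpoint w).1 * (0 - (endpoint w).2)).natAbs

/-- The 3-sided prudent polygons of area `n` (given by their underlying walks). -/
def threeSidedPolygons (n : ℕ) : Set (List Step) :=
  {w | IsPrudent w ∧ IsThreeSided w ∧ Closes w ∧ area w = n}

/-- The number of 3-sided prudent polygons of area `n`. -/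
def PAcoeff (n : ℕ) : ℕ := (threeSidedPolygons n).ncard

/-! ### The functions of `q` in the representation -/

/-- The finite `q`-Pochhammer symbol `(x; q)_n`. -/
def qPoch (x q : ℂ) (n : ℕ) : ℂ := ∏ i ∈ Finset.range n, (1 - x * q ^ i)

/-- The infinite `q`-Pochhammer symbol `(x; q)_∞`. -/
def qPochInf (x q : ℂ) : ℂ := ∏' i : ℕ, (1 - x * q ^ i)

/-- The infinite product `(x; q)_∞` converges in the unit disc. -/
theorem multipliable_qPochInf (x : ℂ) {q : ℂ} (hq : ‖q‖ < 1) :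
    Multipliable fun i : ℕ => 1 - x * q ^ i := by
  have h : Summable fun i : ℕ => ‖-(x * q ^ i)‖ := by
    simpa [norm_mul, norm_pow] using
      (summable_geometric_of_lt_one (norm_nonneg q) hq).mul_left ‖x‖
  simpa [sub_eq_add_neg] using multipliable_one_add_of_summable h

/-- `v = (1 - q + q²) / (1 - q)` -/
def vq (q : ℂ) : ℂ := (1 - q + q ^ 2) / (1 - q)

/-- `a = q² / (1 - q + q²)` -/
def aq (q : ℂ) : ℂ := q ^ 2 / (1 - q + q ^ 2)

/-- `A(q) = 2q(1 - q)² / (1 - 2q)²` -/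
def Aq (q : ℂ) : ℂ := 2 * q * (1 - q) ^ 2 / (1 - 2 * q) ^ 2

/-- `C(q) = 2q(3 - 10q + 9q² - q³) / ((1 - q)(1 - 2q)²)` -/
def Cq (q : ℂ) : ℂ :=
  2 * q * (3 - 10 * q + 9 * q ^ 2 - q ^ 3) / ((1 - q) * (1 - 2 * q) ^ 2)

/-- `D(q) = C(q) - q²/(1 - q)² · A(q) · (v; q)_∞ / (av; q)_∞` -/
def Dq (q : ℂ) : ℂ :=
  Cq q - q ^ 2 / (1 - q) ^ 2 * Aq q * (qPochInf (vq q) q / qPochInf (aq q * vq q) q)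

/-- The `(j, ν)` term of the double sum `T(q)`. -/
def Tterm (q : ℂ) (j ν : ℕ) : ℂ :=
  qPoch (aq q * q ^ (-(j : ℤ))) q j / qPoch (q ^ (-(j : ℤ))) q j *
    (vq q ^ ν * q ^ ((j + 1) * ν) / (1 - 2 * q + q ^ (ν + 2)))

/-- The double sum `T(q)` over `j ≥ 0` and `ν ≥ 1`. -/
def T (q : ℂ) : ℂ := ∑' j : ℕ, ∑' n : ℕ, Tterm q j (n + 1)

/-- `γ = log v / log (1/q)`, with principal logarithms. -/
def gam (q : ℂ) : ℂ := Complex.log (vq q) / Complex.log (1 / q)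

/-- The Fourier coefficient `p_k = π / sin (πγ + 2ikπ² / log (1/q))`. -/
def pcoeff (q : ℂ) (k : ℤ) : ℂ :=
  Real.pi / Complex.sin
    (Real.pi * gam q + 2 * Complex.I * k * Real.pi ^ 2 / Complex.log (1 / q))

/-- The term `p_k e^{-2ikπu}` of the Fourier series `Π(u)`. -/
def fourierTerm (q u : ℂ) (k : ℤ) : ℂ :=
  pcoeff q k * Complex.exp (-2 * Complex.I * k * Real.pi * u)

/-- The Fourier series `Π(u)`; its coefficients depend on `q`. -/
def PiSeries (q u : ℂ) : ℂ := ∑' k : ℤ, fourierTerm q u k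

/-- The singular series
`U(q) = v q^{3γ-2} / log (1/q) · (-q⁻¹t; q)_∞ / (-aq⁻²t; q)_∞`, where `t = 1 - 2q`. -/
def U (q : ℂ) : ℂ :=
  vq q * q ^ (3 * gam q - 2) / Complex.log (1 / q) *
    (qPochInf (-q⁻¹ * (1 - 2 * q)) q / qPochInf (-aq q * (q ^ 2)⁻¹ * (1 - 2 * q)) q)

/-- The term `(a⁻¹v⁻¹q; q)_r / (v⁻¹q; q)_r · (-aq⁻²t)^r` of the series in `V(q)`. -/
def Vterm (q : ℂ) (r : ℕ) : ℂ :=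
  qPoch ((aq q)⁻¹ * (vq q)⁻¹ * q) q r / qPoch ((vq q)⁻¹ * q) q r *
    (-aq q * (q ^ 2)⁻¹ * (1 - 2 * q)) ^ r

/-- The regular series `V(q)`. -/
def V (q : ℂ) : ℂ :=
  -(qPochInf q q / qPochInf (aq q) q * ((q ^ 2)⁻¹ / (1 + (q ^ 2)⁻¹ * (1 - 2 * q)))) +
    (q ^ 2)⁻¹ *
      (qPochInf q q * qPochInf (aq q * vq q) q / (qPochInf (aq q) q * qPochInf (vq q) q)) *
      ∑' r : ℕ, Vterm q r

/-- The sector anchored at `1/2` of angle `θ₀` and radius `r₀`. -/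
def sector (θ₀ r₀ : ℝ) : Set ℂ :=
  {z | ∃ r θ : ℝ, 0 < r ∧ r < r₀ ∧ θ₀ < θ ∧ θ < 2 * Real.pi - θ₀ ∧
    z = 1 / 2 + r * Complex.exp (θ * Complex.I)}

/-- All series of the representation converge at `q`: the double sum `T(q)` has no vanishing
denominator and converges absolutely, the Fourier series `Π(log (1 - 2q) / log (1/q))` is dominated
by a geometric series, and the series in `V(q)` converges absolutely. -/
def SeriesConverge (q : ℂ) : Prop :=
  (∀ ν : ℕ, 1 ≤ ν → 1 - 2 * q + q ^ (ν + 2) ≠ 0) ∧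
  Summable (fun x : ℕ × ℕ => Tterm q x.1 (x.2 + 1)) ∧
  (∃ K ρ : ℝ, 0 ≤ ρ ∧ ρ < 1 ∧ ∀ k : ℤ,
    ‖fourierTerm q (Complex.log (1 - 2 * q) / Complex.log (1 / q)) k‖ ≤ K * ρ ^ k.natAbs) ∧
  Summable (Vterm q)

/-- The exact representation, at the point `q`, of a value `P` (the value of the generating
function there), the series involved being convergent. -/
def ExactRepresentation (q P : ℂ) : Prop :=
  SeriesConverge q ∧
  P = Dq q - q ^ 2 * Aq q *
      (qPochInf (aq q) q * qPochInf (vq q) q / (qPochInf q q * qPochInf (aq q * vq q) q)) * T q ∧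
  T q = (1 - 2 * q) ^ (-gam q) *
      PiSeries q (Complex.log (1 - 2 * q) / Complex.log (1 / q)) * U q + V q

end PrudentPolygon

end

namespace PrudentPolygon

/-! ### Appending a step to a walk -/

/-! Counting. Up to reflection in the vertical axis, every 3-sided prudent polygon comes from a walk
that stays in x ≤ 0 until it possibly leaves the axis once and descends straight to (1, 0)
(`exists_isLeftPolygon`; the hard exclusion is `LeftWalk.eq_descend`). No polygon and its reflection
are both of this form (`IsLeftPolygon.not_mirror`), hence a factor 2. Walks in x ≤ 0 move between
two families of states, the west side and the top row of the box, which gives the transfer equations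
`rowGF_succ` and `colGF_succ`. Summed over the height y with weight q^y they become a first-order
recurrence in the width m with a product solution. With t = 1 - 2q, w = 1 - q + q², z = q/(1 - q),
and R_m the product `ratioProd`, this yields PA(q) = 2(q/(1 - q) + q/(1 - 2q) + (1 - q)q ∑ z^m R_m).

Formula (1). The partial fraction coefficients of R_m in t are products of two q-binomial
coefficients, so the sum over m is a Cauchy product, and the q-binomial theorem leaves a single
series over the poles t = -q^{ν+2} (`hasSum_ratioProd`). Summing T over j by the same theorem gives
a multiple of that series without its term ν = 0, and D accounts for the missing term.

Formula (2). Put x = -t/q² and h(y) = (qy; q)_∞/(ay; q)_∞. The series is ∑_{ν≥0} h(q^ν)(vq)^ν/(q^ν -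
x). It differs from h(x) times the same sum over all ν ∈ ℤ without the factor h(q^ν) by a series
regular at x = 0 (`unilateral_eq`): the defect satisfies a homogeneous q-difference equation and is
bounded along x, qx, q²x, …, so it vanishes. For real q the bilateral sum is a sum of translates on
a logarithmic scale. Poisson summation and the Beta integral turn it into the Fourier series Π.

Continuation. In a sector |arg t| < 3π/4 near t = 0 one has |t + q^n| ≥ (3/10)|t|
(`exists_pole_bound`) and the Fourier terms decay geometrically (`norm_fourierTerm_le`). All
functions involved are therefore analytic there. The identity theorem carries (2) from a real
segment to the sector, and (1) to the lens where disc and sector meet. The right-hand side of (1) is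
then the continuation. -/

@[simp] theorem endpoint_nil : endpoint [] = 0 := rfl

theorem endpoint_snoc (p : List Step) (s : Step) : endpoint (p ++ [s]) = endpoint p + s.vec := by
  simp [endpoint]

theorem endpoint_mem_visited (p : List Step) : endpoint p ∈ visited p :=
  ⟨p, List.prefix_rfl, rfl⟩

theorem visited_mono {p w : List Step} (h : p <+: w) : visited p ⊆ visited w :=
  fun _ ⟨r, hr, e⟩ => ⟨r, hr.trans h, e⟩

theorem visited_nil : visited [] = {0} := by
  ext x
  simp [visited, eq_comm]

theorem visited_snoc (p : List Step) (s : Step) :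
    visited (p ++ [s]) = insert (endpoint p + s.vec) (visited p) := by
  ext x
  simp only [visited, List.prefix_concat_iff, Set.mem_ofPred_eq, Set.mem_insert_iff]
  constructor
  · rintro ⟨r, rfl | h, rfl⟩
    · exact Or.inl (endpoint_snoc _ _)
    · exact Or.inr ⟨r, h, rfl⟩
  · rintro (rfl | ⟨r, h, rfl⟩)
    · exact ⟨_, Or.inl rfl, endpoint_snoc _ _⟩
    · exact ⟨r, Or.inr h, rfl⟩

/-- No visited node lies ahead of the step `s` from the end of the walk `p`. -/
def FreeAhead (p : List Step) (s : Step) : Prop :=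
  ∀ k : ℕ, 0 < k → endpoint p + k • s.vec ∉ visited p

/-- The walk ends on one of the three permitted sides of its bounding box. -/
def OnSide (w : List Step) : Prop := EndsNorth w ∨ EndsEast w ∨ EndsWest w

/-- The step `s` does not turn from a south step along a side into the bounding box. -/
def TurnAllowed (p : List Step) (s : Step) : Prop :=
  (∀ r, p = r ++ [.south] → s = .west → ¬ (HasWidth p ∧ EndsEast p)) ∧
  (∀ r, p = r ++ [.south] → s = .east → ¬ (HasWidth p ∧ EndsWest p))

/-- The walk is a 3-sided prudent walk. -/
def Valid (w : List Step) : Prop := IsPrudent w ∧ IsThreeSided w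

theorem isPrudent_nil : IsPrudent [] := by
  refine ⟨?_, ?_⟩
  · intro p r hp hr _
    rw [List.prefix_nil.1 hp, List.prefix_nil.1 hr]
  · intro p s h
    simpa using List.prefix_nil.1 h

theorem isPrudent_snoc (p : List Step) (s : Step) :
    IsPrudent (p ++ [s]) ↔ IsPrudent p ∧ FreeAhead p s := by
  constructor
  · rintro ⟨h1, h2⟩
    have hp : p <+: p ++ [s] := List.prefix_append _ _
    exact ⟨⟨fun a b ha hb => h1 a b (ha.trans hp) (hb.trans hp),
      fun a b hab => h2 a b (hab.trans hp)⟩, h2 p s List.prefix_rfl⟩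
  · rintro ⟨⟨h1, h2⟩, h3⟩
    -- At distance one, the node ahead is the new endpoint: prudence of the step already gives
    -- self-avoidance.
    have h4 := h3 1 one_pos
    rw [one_smul] at h4
    refine ⟨fun a b ha hb e => ?_, fun a b hab => ?_⟩
    · rw [List.prefix_concat_iff] at ha hb
      rcases ha with rfl | ha <;> rcases hb with rfl | hb
      · rfl
      · exact absurd ⟨b, hb, by rw [← e, endpoint_snoc]⟩ h4
      · exact absurd ⟨a, ha, by rw [e, endpoint_snoc]⟩ h4
      · exact h1 a b ha hb e
    · rw [List.prefix_concat_iff] at hab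
      rcases hab with hab | hab
      · obtain ⟨rfl, hs⟩ := List.append_inj' hab rfl
        obtain rfl : b = s := by simpa using hs
        exact h3
      · exact h2 a b hab

theorem isThreeSided_nil : IsThreeSided [] := by
  refine ⟨?_, ?_, ?_⟩
  · intro p h
    rw [List.prefix_nil.1 h]
    left
    intro x hx
    rw [visited_nil] at hx
    rw [hx]; simp
  all_goals
    intro p h
    simpa using List.prefix_nil.1 h

theorem isThreeSided_snoc (p : List Step) (s : Step) :
    IsThreeSided (p ++ [s]) ↔ IsThreeSided p ∧ OnSide (p ++ [s]) ∧ TurnAllowed p s := by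
  constructor
  · rintro ⟨h1, h2, h3⟩
    have hp : p <+: p ++ [s] := List.prefix_append _ _
    refine ⟨⟨fun a ha => h1 a (ha.trans hp), fun a ha => h2 a (ha.trans hp),
      fun a ha => h3 a (ha.trans hp)⟩, h1 _ List.prefix_rfl, ?_, ?_⟩
    · rintro r rfl rfl
      exact h2 r (by simp)
    · rintro r rfl rfl
      exact h3 r (by simp)
  · rintro ⟨⟨h1, h2, h3⟩, h4, h5, h6⟩
    refine ⟨fun a ha => ?_, fun a ha => ?_, fun a ha => ?_⟩
    · rw [List.prefix_concat_iff] at ha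
      rcases ha with rfl | ha
      · exact h4
      · exact h1 a ha
    · rw [List.prefix_concat_iff] at ha
      rcases ha with ha | ha
      · rw [show a ++ [Step.south, Step.west] = (a ++ [.south]) ++ [.west] by simp] at ha
        obtain ⟨h, hs⟩ := List.append_inj' ha rfl
        rw [h]
        exact h5 a h.symm (by simpa using hs.symm)
      · exact h2 a ha
    · rw [List.prefix_concat_iff] at ha
      rcases ha with ha | ha
      · rw [show a ++ [Step.south, Step.east] = (a ++ [.south]) ++ [.east] by simp] at ha
        obtain ⟨h, hs⟩ := List.append_inj' ha rfl
        rw [h]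
        exact h6 a h.symm (by simpa using hs.symm)
      · exact h3 a ha

theorem valid_nil : Valid [] := ⟨isPrudent_nil, isThreeSided_nil⟩

/-- All conditions concern the last step and the walk before it, so walks can be classified by
appending one step at a time. -/
theorem valid_snoc (p : List Step) (s : Step) :
    Valid (p ++ [s]) ↔ Valid p ∧ FreeAhead p s ∧ OnSide (p ++ [s]) ∧ TurnAllowed p s := by
  unfold Valid
  rw [isPrudent_snoc, isThreeSided_snoc]
  tauto

theorem Valid.of_append {p r : List Step} (h : Valid (p ++ r)) : Valid p := by
  induction r using List.reverseRecOn with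
  | nil => simpa using h
  | append_singleton r s ih =>
    rw [← List.append_assoc] at h
    exact ih ((valid_snoc _ _).1 h).1

/-! ### Walks in the left half-plane -/

/-- The states of a 3-sided prudent walk in the half-plane `x ≤ 0` whose bounding box has width `m`
and top `y`: `col m h₀ h y` on the west side at depth `h` below the top, the side having been
reached at depth `h₀`; `row m d₀ d y` on the top row at distance `d` from the axis, the row having
been reached at distance `d₀`. -/
inductive State where
  | col (m h₀ h y : ℕ)
  | row (m d₀ d y : ℕ)

open State in
/-- `LeftWalk p σ n`: the walk `p` stays in the left half-plane and is in the state `σ`, and `n` is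
the area between the walk (raised straight to the top if it is on the west side) and the axis. -/
inductive LeftWalk : List Step → State → ℕ → Prop where
  | nil : LeftWalk [] (col 0 0 0 0) 0
  | col_south {p m h₀ h y n} : LeftWalk p (col m h₀ h y) n → h₀ ≤ h →
      LeftWalk (p ++ [.south]) (col m h₀ (h + 1) y) n
  | col_north {p m h₀ h y n} : LeftWalk p (col m h₀ (h + 1) y) n → h + 1 ≤ h₀ →
      LeftWalk (p ++ [.north]) (col m h₀ h y) n
  | col_up {p m h₀ y n} : LeftWalk p (col m h₀ 0 y) n →
      LeftWalk (p ++ [.north]) (row m m m (y + 1)) (n + m)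
  | col_west {p m h₀ h y n} : LeftWalk p (col m h₀ h y) n →
      LeftWalk (p ++ [.west]) (col (m + 1) h h y) (n + h)
  | row_east {p m d₀ d y n} : LeftWalk p (row m d₀ (d + 1) y) n → d + 1 ≤ d₀ →
      LeftWalk (p ++ [.east]) (row m d₀ d y) n
  | row_west {p m d₀ d y n} : LeftWalk p (row m d₀ d y) n → d₀ ≤ d → d < m →
      LeftWalk (p ++ [.west]) (row m d₀ (d + 1) y) n
  | row_north {p m d₀ d y n} : LeftWalk p (row m d₀ d y) n →
      LeftWalk (p ++ [.north]) (row m d d (y + 1)) (n + d)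
  | row_out {p m d₀ y n} : LeftWalk p (row m d₀ m y) n →
      LeftWalk (p ++ [.west]) (col (m + 1) 0 0 y) n

/-- The geometric meaning of the state of a left walk. -/
def State.Inv (p : List Step) : State → Prop
  | .col m h₀ h y =>
    endpoint p = (-(m : ℤ), (y : ℤ) - h) ∧
    (∀ x z : ℤ, (x, z) ∈ visited p → -(m : ℤ) ≤ x ∧ x ≤ 0 ∧ z ≤ y) ∧
    (∀ i : ℕ, i ≤ m → ∃ z : ℤ, z ≤ y ∧ (-(i : ℤ), z) ∈ visited p) ∧
    (∀ z : ℤ, (-(m : ℤ), z) ∈ visited p → (h₀ ≤ h → (y : ℤ) - h ≤ z) ∧ (h ≤ h₀ → z ≤ (y : ℤ) - h)) ∧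
    (∀ k : ℕ, (h₀ ≤ k ∧ k ≤ h ∨ h ≤ k ∧ k ≤ h₀) → (-(m : ℤ), (y : ℤ) - k) ∈ visited p) ∧
    (0 < m → ∀ k : ℕ, k ≤ h₀ → ∃ x : ℤ, -(m : ℤ) < x ∧ (x, (y : ℤ) - k) ∈ visited p) ∧
    (m = 0 → h₀ = 0 ∧ y = 0) ∧
    (h₀ < h → ∃ r, p = r ++ [.south])
  | .row m d₀ d y =>
    endpoint p = (-(d : ℤ), (y : ℤ)) ∧ d ≤ m ∧ d₀ ≤ m ∧ 1 ≤ y ∧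
    (∀ x z : ℤ, (x, z) ∈ visited p → -(m : ℤ) ≤ x ∧ x ≤ 0 ∧ z ≤ y) ∧
    (∀ i : ℕ, i ≤ m → ∃ z : ℤ, z < y ∧ (-(i : ℤ), z) ∈ visited p) ∧
    (∀ x : ℤ, (x, (y : ℤ)) ∈ visited p → (d₀ ≤ d → -(d : ℤ) ≤ x) ∧ (d ≤ d₀ → x ≤ -(d : ℤ))) ∧
    (∀ k : ℕ, (d₀ ≤ k ∧ k ≤ d ∨ d ≤ k ∧ k ≤ d₀) → (-(k : ℤ), (y : ℤ)) ∈ visited p) ∧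
    (∀ r, p ≠ r ++ [.south])

theorem State.Inv.onSide {p : List Step} {σ : State} (h : σ.Inv p) : OnSide p := by
  cases σ with
  | col m h₀ h y =>
    obtain ⟨h1, h2, -⟩ := h
    right; right
    rintro ⟨x, z⟩ hx
    rw [h1]
    exact (h2 x z hx).1
  | row m d₀ d y =>
    obtain ⟨h1, -, -, -, h2, -⟩ := h
    left
    rintro ⟨x, z⟩ hx
    rw [h1]
    exact (h2 x z hx).2.2

theorem turnAllowed_north (p : List Step) : TurnAllowed p .north := by
  constructor <;> intro _ _ h <;> cases h

theorem turnAllowed_south (p : List Step) : TurnAllowed p .south := by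
  constructor <;> intro _ _ h <;> cases h

theorem turnAllowed_of_ne {p : List Step} (h : ∀ r, p ≠ r ++ [.south]) (s : Step) :
    TurnAllowed p s :=
  ⟨fun r e => absurd e (h r), fun r e => absurd e (h r)⟩

theorem freeAhead_north {p : List Step} {x z : ℤ} (he : endpoint p = (x, z)) :
    FreeAhead p .north ↔ ∀ z', z < z' → (x, z') ∉ visited p := by
  constructor
  · intro h z' hz hv
    refine h (z' - z).toNat (by omega) ?_
    convert hv using 1
    rw [he]; ext <;> simp [Step.vec]; omega
  · intro h k hk hv
    refine h (z + k) (by omega) ?_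
    convert hv using 1
    rw [he]; ext <;> simp [Step.vec]

theorem freeAhead_south {p : List Step} {x z : ℤ} (he : endpoint p = (x, z)) :
    FreeAhead p .south ↔ ∀ z', z' < z → (x, z') ∉ visited p := by
  constructor
  · intro h z' hz hv
    refine h (z - z').toNat (by omega) ?_
    convert hv using 1
    rw [he]; ext <;> simp [Step.vec]; omega
  · intro h k hk hv
    refine h (z - k) (by omega) ?_
    convert hv using 1
    rw [he]; ext <;> simp [Step.vec]; omega

theorem freeAhead_east {p : List Step} {x z : ℤ} (he : endpoint p = (x, z)) :
    FreeAhead p .east ↔ ∀ x', x < x' → (x', z) ∉ visited p := by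
  constructor
  · intro h z' hz hv
    refine h (z' - x).toNat (by omega) ?_
    convert hv using 1
    rw [he]; ext <;> simp [Step.vec]; omega
  · intro h k hk hv
    refine h (x + k) (by omega) ?_
    convert hv using 1
    rw [he]; ext <;> simp [Step.vec]

theorem freeAhead_west {p : List Step} {x z : ℤ} (he : endpoint p = (x, z)) :
    FreeAhead p .west ↔ ∀ x', x' < x → (x', z) ∉ visited p := by
  constructor
  · intro h z' hz hv
    refine h (x - z').toNat (by omega) ?_
    convert hv using 1
    rw [he]; ext <;> simp [Step.vec]; omega
  · intro h k hk hv
    refine h (x - k) (by omega) ?_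
    convert hv using 1
    rw [he]; ext <;> simp [Step.vec]; omega

end PrudentPolygon

/-! ### Transitions between the states of a left walk -/

namespace PrudentPolygon

open State

theorem mem_visited_snoc {p : List Step} {s : Step} {a b x z : ℤ} (he : endpoint p = (a, b)) :
    (x, z) ∈ visited (p ++ [s]) ↔ (x = a + s.vec.1 ∧ z = b + s.vec.2) ∨ (x, z) ∈ visited p := by
  rw [visited_snoc, he, Set.mem_insert_iff, Prod.ext_iff]
  simp

theorem mem_visited_self {p : List Step} {a b : ℤ} (he : endpoint p = (a, b)) :
    (a, b) ∈ visited p := he ▸ endpoint_mem_visited p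

theorem snoc_ne_snoc_south (p : List Step) {s : Step} (hs : s ≠ .south) (r : List Step) :
    p ++ [s] ≠ r ++ [.south] := by
  intro h
  have := (List.append_inj' h rfl).2
  simp_all

theorem inv_nil : (col 0 0 0 0).Inv [] := by
  simp [State.Inv, visited_nil]
  rfl

theorem inv_col_south {p : List Step} {m h₀ h y : ℕ} (hI : (col m h₀ h y).Inv p) (hh : h₀ ≤ h) :
    (col m h₀ (h + 1) y).Inv (p ++ [.south]) ∧ FreeAhead p .south ∧ TurnAllowed p .south := by
  obtain ⟨he, h1, h2, h3, h4, h5, h6, h7⟩ := hI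
  refine ⟨⟨?_, ?_, ?_, ?_, ?_, ?_, h6, fun _ => ⟨p, rfl⟩⟩, ?_, turnAllowed_south p⟩
  · rw [endpoint_snoc, he]; ext <;> simp [Step.vec]; omega
  · intro x z hx
    rw [mem_visited_snoc he] at hx
    simp only [Step.vec] at hx
    rcases hx with hx | hx
    · omega
    · exact h1 x z hx
  · intro i hi
    obtain ⟨z, hz, hv⟩ := h2 i hi
    exact ⟨z, hz, (mem_visited_snoc he).2 (Or.inr hv)⟩
  · intro z hz
    rw [mem_visited_snoc he] at hz
    simp only [Step.vec] at hz
    rcases hz with hz | hz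
    · omega
    · have := h3 z hz
      omega
  · intro k hk
    rw [mem_visited_snoc he]
    simp only [Step.vec]
    by_cases hkh : k = h + 1
    · left; omega
    · right; exact h4 k (by omega)
  · intro hm k hk
    obtain ⟨x, hx, hv⟩ := h5 hm k hk
    exact ⟨x, hx, (mem_visited_snoc he).2 (Or.inr hv)⟩
  · rw [freeAhead_south he]
    intro z hz hv
    have := h3 z hv
    omega

theorem inv_col_north {p : List Step} {m h₀ h y : ℕ} (hI : (col m h₀ (h + 1) y).Inv p)
    (hh : h + 1 ≤ h₀) :
    (col m h₀ h y).Inv (p ++ [.north]) ∧ FreeAhead p .north ∧ TurnAllowed p .north := by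
  obtain ⟨he, h1, h2, h3, h4, h5, h6, h7⟩ := hI
  refine ⟨⟨?_, ?_, ?_, ?_, ?_, ?_, h6, by omega⟩, ?_, turnAllowed_north p⟩
  · rw [endpoint_snoc, he]; ext <;> simp [Step.vec]; omega
  · intro x z hx
    rw [mem_visited_snoc he] at hx
    simp only [Step.vec] at hx
    rcases hx with hx | hx
    · omega
    · exact h1 x z hx
  · intro i hi
    obtain ⟨z, hz, hv⟩ := h2 i hi
    exact ⟨z, hz, (mem_visited_snoc he).2 (Or.inr hv)⟩
  · intro z hz
    rw [mem_visited_snoc he] at hz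
    simp only [Step.vec] at hz
    rcases hz with hz | hz
    · omega
    · have := h3 z hz
      omega
  · intro k hk
    rw [mem_visited_snoc he]
    simp only [Step.vec]
    by_cases hkh : k = h
    · left; omega
    · right; exact h4 k (by omega)
  · intro hm k hk
    obtain ⟨x, hx, hv⟩ := h5 hm k hk
    exact ⟨x, hx, (mem_visited_snoc he).2 (Or.inr hv)⟩
  · rw [freeAhead_north he]
    intro z hz hv
    have := h3 z hv
    omega

theorem inv_col_up {p : List Step} {m h₀ y : ℕ} (hI : (col m h₀ 0 y).Inv p) :
    (row m m m (y + 1)).Inv (p ++ [.north]) ∧ FreeAhead p .north ∧ TurnAllowed p .north := by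
  obtain ⟨he, h1, h2, h3, h4, h5, h6, h7⟩ := hI
  refine ⟨⟨?_, le_rfl, le_rfl, by omega, ?_, ?_, ?_, ?_, snoc_ne_snoc_south p (by simp)⟩, ?_,
    turnAllowed_north p⟩
  · rw [endpoint_snoc, he]; ext <;> simp [Step.vec]
  · intro x z hx
    rw [mem_visited_snoc he] at hx
    simp only [Step.vec] at hx
    rcases hx with hx | hx
    · omega
    · have := h1 x z hx
      omega
  · intro i hi
    obtain ⟨z, hz, hv⟩ := h2 i hi
    exact ⟨z, by omega, (mem_visited_snoc he).2 (Or.inr hv)⟩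
  · intro x hx
    rw [mem_visited_snoc he] at hx
    simp only [Step.vec] at hx
    rcases hx with hx | hx
    · omega
    · have := h1 x _ hx
      omega
  · intro k hk
    rw [mem_visited_snoc he]
    simp only [Step.vec]
    left; omega
  · rw [freeAhead_north he]
    intro z hz hv
    have := h1 _ z hv
    omega

theorem not_endsEast {p : List Step} {x z : ℤ} (he : endpoint p = (x, z)) (hx : x < 0) :
    ¬ EndsEast p := by
  intro h
  have := h 0 ⟨[], List.nil_prefix, rfl⟩
  rw [he] at this
  simp at this
  omega

theorem inv_col_west {p : List Step} {m h₀ h y : ℕ} (hI : (col m h₀ h y).Inv p) :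
    (col (m + 1) h h y).Inv (p ++ [.west]) ∧ FreeAhead p .west ∧ TurnAllowed p .west := by
  obtain ⟨he, h1, h2, h3, h4, h5, h6, h7⟩ := hI
  refine ⟨⟨?_, ?_, ?_, ?_, ?_, ?_, by omega, by omega⟩, ?_, ?_, fun _ _ h => by cases h⟩
  · rw [endpoint_snoc, he]; ext <;> simp [Step.vec]; omega
  · intro x z hx
    rw [mem_visited_snoc he] at hx
    simp only [Step.vec] at hx
    rcases hx with hx | hx
    · omega
    · have := h1 x z hx
      omega
  · intro i hi
    by_cases him : i = m + 1
    · exact ⟨(y : ℤ) - h, by omega, (mem_visited_snoc he).2 (Or.inl (by simp [Step.vec]; omega))⟩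
    · obtain ⟨z, hz, hv⟩ := h2 i (by omega)
      exact ⟨z, hz, (mem_visited_snoc he).2 (Or.inr hv)⟩
  · intro z hz
    rw [mem_visited_snoc he] at hz
    simp only [Step.vec] at hz
    rcases hz with hz | hz
    · omega
    · have := h1 _ z hz
      omega
  · intro k hk
    rw [mem_visited_snoc he]
    simp only [Step.vec]
    left; omega
  · intro _ k hk
    -- Depths from h₀ to h were traversed on the column just left; smaller depths were already
    -- occupied to the right of it. For m = 0 the second case is void, since then h₀ = 0.
    by_cases hk0 : h₀ ≤ k
    · exact ⟨-(m : ℤ), by omega, (mem_visited_snoc he).2 (Or.inr (h4 k (by omega)))⟩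
    · obtain ⟨x, hx, hv⟩ := h5 (by omega) k (by omega)
      exact ⟨x, by omega, (mem_visited_snoc he).2 (Or.inr hv)⟩
  · rw [freeAhead_west he]
    intro x hx hv
    have := h1 x _ hv
    omega
  · rintro r - - ⟨⟨x, hx, x', hx', hne⟩, hE⟩
    have a1 := h1 x.1 x.2 hx
    have a2 := h1 x'.1 x'.2 hx'
    exact not_endsEast he (by omega) hE

theorem inv_row_east {p : List Step} {m d₀ d y : ℕ} (hI : (row m d₀ (d + 1) y).Inv p)
    (hd : d + 1 ≤ d₀) :
    (row m d₀ d y).Inv (p ++ [.east]) ∧ FreeAhead p .east ∧ TurnAllowed p .east := by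
  obtain ⟨he, hdm, hd₀, hy, h1, h2, h3, h4, h5⟩ := hI
  refine ⟨⟨?_, by omega, hd₀, hy, ?_, ?_, ?_, ?_, snoc_ne_snoc_south p (by simp)⟩, ?_,
    turnAllowed_of_ne h5 _⟩
  · rw [endpoint_snoc, he]; ext <;> simp [Step.vec]
  · intro x z hx
    rw [mem_visited_snoc he] at hx
    simp only [Step.vec] at hx
    rcases hx with hx | hx
    · omega
    · exact h1 x z hx
  · intro i hi
    obtain ⟨z, hz, hv⟩ := h2 i hi
    exact ⟨z, hz, (mem_visited_snoc he).2 (Or.inr hv)⟩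
  · intro x hx
    rw [mem_visited_snoc he] at hx
    simp only [Step.vec] at hx
    rcases hx with hx | hx
    · omega
    · have := h3 x hx
      omega
  · intro k hk
    rw [mem_visited_snoc he]
    simp only [Step.vec]
    by_cases hkd : k = d
    · left; omega
    · right; exact h4 k (by omega)
  · rw [freeAhead_east he]
    intro x hx hv
    have := h3 x hv
    omega

theorem inv_row_west {p : List Step} {m d₀ d y : ℕ} (hI : (row m d₀ d y).Inv p)
    (hd : d₀ ≤ d) (hdm : d < m) :
    (row m d₀ (d + 1) y).Inv (p ++ [.west]) ∧ FreeAhead p .west ∧ TurnAllowed p .west := by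
  obtain ⟨he, -, hd₀, hy, h1, h2, h3, h4, h5⟩ := hI
  refine ⟨⟨?_, by omega, hd₀, hy, ?_, ?_, ?_, ?_, snoc_ne_snoc_south p (by simp)⟩, ?_,
    turnAllowed_of_ne h5 _⟩
  · rw [endpoint_snoc, he]; ext <;> simp [Step.vec]; omega
  · intro x z hx
    rw [mem_visited_snoc he] at hx
    simp only [Step.vec] at hx
    rcases hx with hx | hx
    · omega
    · exact h1 x z hx
  · intro i hi
    obtain ⟨z, hz, hv⟩ := h2 i hi
    exact ⟨z, hz, (mem_visited_snoc he).2 (Or.inr hv)⟩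
  · intro x hx
    rw [mem_visited_snoc he] at hx
    simp only [Step.vec] at hx
    rcases hx with hx | hx
    · omega
    · have := h3 x hx
      omega
  · intro k hk
    rw [mem_visited_snoc he]
    simp only [Step.vec]
    by_cases hkd : k = d + 1
    · left; omega
    · right; exact h4 k (by omega)
  · rw [freeAhead_west he]
    intro x hx hv
    have := h3 x hv
    omega

theorem inv_row_north {p : List Step} {m d₀ d y : ℕ} (hI : (row m d₀ d y).Inv p) :
    (row m d d (y + 1)).Inv (p ++ [.north]) ∧ FreeAhead p .north ∧ TurnAllowed p .north := by
  obtain ⟨he, hdm, hd₀, hy, h1, h2, h3, h4, h5⟩ := hI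
  refine ⟨⟨?_, hdm, hdm, by omega, ?_, ?_, ?_, ?_, snoc_ne_snoc_south p (by simp)⟩, ?_,
    turnAllowed_north p⟩
  · rw [endpoint_snoc, he]; ext <;> simp [Step.vec]
  · intro x z hx
    rw [mem_visited_snoc he] at hx
    simp only [Step.vec] at hx
    rcases hx with hx | hx
    · omega
    · have := h1 x z hx
      omega
  · intro i hi
    obtain ⟨z, hz, hv⟩ := h2 i hi
    exact ⟨z, by omega, (mem_visited_snoc he).2 (Or.inr hv)⟩
  · intro x hx
    rw [mem_visited_snoc he] at hx
    simp only [Step.vec] at hx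
    rcases hx with hx | hx
    · omega
    · have := h1 x _ hx
      omega
  · intro k hk
    rw [mem_visited_snoc he]
    simp only [Step.vec]
    left; omega
  · rw [freeAhead_north he]
    intro z hz hv
    have := h1 _ z hv
    omega

theorem inv_row_out {p : List Step} {m d₀ y : ℕ} (hI : (row m d₀ m y).Inv p) :
    (col (m + 1) 0 0 y).Inv (p ++ [.west]) ∧ FreeAhead p .west ∧ TurnAllowed p .west := by
  obtain ⟨he, hdm, hd₀, hy, h1, h2, h3, h4, h5⟩ := hI
  refine ⟨⟨?_, ?_, ?_, ?_, ?_, ?_, by omega, by omega⟩, ?_, turnAllowed_of_ne h5 _⟩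
  · rw [endpoint_snoc, he]; ext <;> simp [Step.vec]; omega
  · intro x z hx
    rw [mem_visited_snoc he] at hx
    simp only [Step.vec] at hx
    rcases hx with hx | hx
    · omega
    · have := h1 x z hx
      omega
  · intro i hi
    by_cases him : i = m + 1
    · exact ⟨y, le_rfl, (mem_visited_snoc he).2 (Or.inl (by simp [Step.vec]; omega))⟩
    · obtain ⟨z, hz, hv⟩ := h2 i (by omega)
      exact ⟨z, by omega, (mem_visited_snoc he).2 (Or.inr hv)⟩
  · intro z hz
    rw [mem_visited_snoc he] at hz
    simp only [Step.vec] at hz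
    rcases hz with hz | hz
    · omega
    · have := h1 _ z hz
      omega
  · intro k hk
    rw [mem_visited_snoc he]
    simp only [Step.vec]
    left; omega
  · intro _ k hk
    refine ⟨-(m : ℤ), by omega, (mem_visited_snoc he).2 (Or.inr ?_)⟩
    obtain rfl : k = 0 := by omega
    simpa using mem_visited_self he
  · rw [freeAhead_west he]
    intro x hx hv
    have := h1 x _ hv
    omega

theorem LeftWalk.inv_valid {p : List Step} {σ : State} {n : ℕ} (h : LeftWalk p σ n) :
    σ.Inv p ∧ Valid p := by
  induction h with
  | nil => exact ⟨inv_nil, valid_nil⟩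
  | col_south _ hh ih =>
    obtain ⟨a, b, c⟩ := inv_col_south ih.1 hh
    exact ⟨a, (valid_snoc _ _).2 ⟨ih.2, b, a.onSide, c⟩⟩
  | col_north _ hh ih =>
    obtain ⟨a, b, c⟩ := inv_col_north ih.1 hh
    exact ⟨a, (valid_snoc _ _).2 ⟨ih.2, b, a.onSide, c⟩⟩
  | col_up _ ih =>
    obtain ⟨a, b, c⟩ := inv_col_up ih.1
    exact ⟨a, (valid_snoc _ _).2 ⟨ih.2, b, a.onSide, c⟩⟩
  | col_west _ ih =>
    obtain ⟨a, b, c⟩ := inv_col_west ih.1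
    exact ⟨a, (valid_snoc _ _).2 ⟨ih.2, b, a.onSide, c⟩⟩
  | row_east _ hd ih =>
    obtain ⟨a, b, c⟩ := inv_row_east ih.1 hd
    exact ⟨a, (valid_snoc _ _).2 ⟨ih.2, b, a.onSide, c⟩⟩
  | row_west _ hd hdm ih =>
    obtain ⟨a, b, c⟩ := inv_row_west ih.1 hd hdm
    exact ⟨a, (valid_snoc _ _).2 ⟨ih.2, b, a.onSide, c⟩⟩
  | row_north _ ih =>
    obtain ⟨a, b, c⟩ := inv_row_north ih.1
    exact ⟨a, (valid_snoc _ _).2 ⟨ih.2, b, a.onSide, c⟩⟩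
  | row_out _ ih =>
    obtain ⟨a, b, c⟩ := inv_row_out ih.1
    exact ⟨a, (valid_snoc _ _).2 ⟨ih.2, b, a.onSide, c⟩⟩

/-- A valid step from a left walk yields a left walk, unless it is an east step from the axis. -/
theorem LeftWalk.step {p : List Step} {σ : State} {n : ℕ} (h : LeftWalk p σ n) {s : Step}
    (hv : Valid (p ++ [s])) :
    (∃ σ' n', LeftWalk (p ++ [s]) σ' n') ∨
      (s = .east ∧ ((∃ m d₀ y, σ = row m d₀ 0 y) ∨ ∃ h₀ h y, σ = col 0 h₀ h y)) := by
  obtain ⟨hI, -⟩ := h.inv_valid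
  obtain ⟨-, hf, -, ht⟩ := (valid_snoc _ _).1 hv
  cases σ with
  | col m h₀ h' y =>
    obtain ⟨he, h1, h2, h3, h4, h5, h6, h7⟩ := hI
    cases s with
    | north =>
      left
      by_cases hh : h' ≤ h₀
      · cases h' with
        | zero => exact ⟨_, _, h.col_up⟩
        | succ h' => exact ⟨_, _, h.col_north hh⟩
      · rw [freeAhead_north he] at hf
        exact absurd (h4 (h' - 1) (by omega)) (hf _ (by omega))
    | south =>
      left
      by_cases hh : h₀ ≤ h'
      · exact ⟨_, _, h.col_south hh⟩
      · rw [freeAhead_south he] at hf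
        exact absurd (h4 (h' + 1) (by omega)) (hf _ (by omega))
    | west => exact Or.inl ⟨_, _, h.col_west⟩
    | east =>
      right
      refine ⟨rfl, Or.inr ?_⟩
      rcases Nat.eq_zero_or_pos m with rfl | hm
      · exact ⟨_, _, _, rfl⟩
      · exfalso
        -- Down to the entry depth h₀ there is an older node at the same height to the east. Below
        -- h₀ the last step was south, and the turn rule forbids going east from the west side.
        by_cases hh : h' ≤ h₀
        · obtain ⟨x, hx, hxv⟩ := h5 hm h' hh
          rw [freeAhead_east he] at hf
          exact hf x hx hxv
        · obtain ⟨r, hr⟩ := h7 (by omega)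
          refine ht.2 r hr rfl ⟨⟨0, ⟨[], List.nil_prefix, rfl⟩, _, mem_visited_self he, ?_⟩, ?_⟩
          · simp; omega
          · rintro ⟨x, z⟩ hx
            rw [he]
            exact (h1 x z hx).1
  | row m d₀ d y =>
    obtain ⟨he, hdm, hd₀, hy, h1, h2, h3, h4, h5⟩ := hI
    cases s with
    | north => exact Or.inl ⟨_, _, h.row_north⟩
    | south =>
      exfalso
      -- Every column of the box contains a node strictly below the top row.
      rw [freeAhead_south he] at hf
      obtain ⟨z, hz, hzv⟩ := h2 d hdm
      exact hf z hz hzv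
    | west =>
      left
      by_cases hd : d₀ ≤ d
      · rcases Nat.lt_or_ge d m with hlt | hge
        · exact ⟨_, _, h.row_west hd hlt⟩
        · obtain rfl : d = m := by omega
          exact ⟨_, _, h.row_out⟩
      · rw [freeAhead_west he] at hf
        exact absurd (h4 (d + 1) (by omega)) (hf _ (by omega))
    | east =>
      by_cases hd : d ≤ d₀
      · cases d with
        | zero => exact Or.inr ⟨rfl, Or.inl ⟨_, _, _, rfl⟩⟩
        | succ d => exact Or.inl ⟨_, _, h.row_east hd⟩
      · rw [freeAhead_east he] at hf
        exact absurd (h4 (d - 1) (by omega)) (hf _ (by omega))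

/-- The total transition function underlying `LeftWalk`. -/
def State.next : State × ℕ → Step → State × ℕ
  | (col m h₀ h y, n), .south => (col m h₀ (h + 1) y, n)
  | (col m _ 0 y, n), .north => (row m m m (y + 1), n + m)
  | (col m h₀ (h + 1) y, n), .north => (col m h₀ h y, n)
  | (col m _ h y, n), .west => (col (m + 1) h h y, n + h)
  | (row m d₀ (d + 1) y, n), .east => (row m d₀ d y, n)
  | (row m d₀ d y, n), .west => if d < m then (row m d₀ (d + 1) y, n) else (col (m + 1) 0 0 y, n)
  | (row m _ d y, n), .north => (row m d d (y + 1), n + d)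
  | σ, _ => σ

/-- The inductive relation is contained in the graph of a function of the word. Hence a walk
determines its state and its area, and a sum over states counts no walk twice. -/
theorem LeftWalk.foldl_next {p : List Step} {σ : State} {n : ℕ} (h : LeftWalk p σ n) :
    p.foldl State.next (col 0 0 0 0, 0) = (σ, n) := by
  induction h with
  | nil => rfl
  | col_south _ _ ih => rw [List.foldl_append, ih]; rfl
  | col_north _ _ ih => rw [List.foldl_append, ih]; rfl
  | col_up _ ih => rw [List.foldl_append, ih]; rfl
  | col_west _ ih => rw [List.foldl_append, ih]; simp [State.next]
  | row_east _ _ ih => rw [List.foldl_append, ih]; rfl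
  | row_west _ _ hd ih => rw [List.foldl_append, ih]; simp [State.next, hd]
  | row_north _ ih => rw [List.foldl_append, ih]; simp [State.next]
  | row_out _ ih => rw [List.foldl_append, ih]; simp [State.next]

theorem LeftWalk.unique {p : List Step} {σ σ' : State} {n n' : ℕ} (h : LeftWalk p σ n)
    (h' : LeftWalk p σ' n') : σ = σ' ∧ n = n' := by
  simpa using h.foldl_next.symm.trans h'.foldl_next

end PrudentPolygon

namespace PrudentPolygon

open State

/-! ### Reflection in the vertical axis -/

/-- The reflection of a step in the vertical axis. -/
def Step.mirror : Step → Step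
  | .north => .north
  | .east => .west
  | .south => .south
  | .west => .east

/-- The reflection of a walk in the vertical axis. -/
def mirror (w : List Step) : List Step := w.map Step.mirror

/-- The reflection of a node in the vertical axis. -/
def reflect (x : ℤ × ℤ) : ℤ × ℤ := (-x.1, x.2)

@[simp] theorem Step.mirror_mirror (s : Step) : s.mirror.mirror = s := by cases s <;> rfl

@[simp] theorem mirror_mirror (w : List Step) : mirror (mirror w) = w := by
  simp [mirror, Function.comp_def]

@[simp] theorem reflect_reflect (x : ℤ × ℤ) : reflect (reflect x) = x := by simp [reflect]

theorem mirror_append (p r : List Step) : mirror (p ++ r) = mirror p ++ mirror r := by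
  simp [mirror]

theorem mirror_snoc (p : List Step) (s : Step) : mirror (p ++ [s]) = mirror p ++ [s.mirror] := by
  simp [mirror]

theorem vec_mirror (s : Step) : s.mirror.vec = reflect s.vec := by cases s <;> rfl

theorem endpoint_mirror (w : List Step) : endpoint (mirror w) = reflect (endpoint w) := by
  induction w using List.reverseRecOn with
  | nil => rfl
  | append_singleton p s ih =>
    rw [mirror_snoc, endpoint_snoc, endpoint_snoc, ih, vec_mirror]
    ext <;> simp [reflect]; ring

theorem reflect_injective : Function.Injective reflect :=
  Function.LeftInverse.injective reflect_reflect

theorem reflect_mem_visited_mirror (w : List Step) (x : ℤ × ℤ) :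
    reflect x ∈ visited (mirror w) ↔ x ∈ visited w := by
  induction w using List.reverseRecOn with
  | nil =>
    change reflect x ∈ visited [] ↔ _
    rw [visited_nil, Set.mem_singleton_iff, Set.mem_singleton_iff, Prod.ext_iff, Prod.ext_iff]
    simp [reflect]
  | append_singleton p s ih =>
    rw [mirror_snoc, visited_snoc, visited_snoc, Set.mem_insert_iff, Set.mem_insert_iff, ih,
      ← endpoint_snoc, ← endpoint_snoc, ← mirror_snoc, endpoint_mirror, reflect_injective.eq_iff]

theorem mem_visited_mirror (w : List Step) (x : ℤ × ℤ) :
    x ∈ visited (mirror w) ↔ reflect x ∈ visited w := by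
  rw [← reflect_mem_visited_mirror w (reflect x), reflect_reflect]

theorem FreeAhead.mirror {p : List Step} {s : Step} (h : FreeAhead p s) :
    FreeAhead (mirror p) s.mirror := by
  intro k hk hv
  refine h k hk ?_
  rw [mem_visited_mirror, endpoint_mirror, vec_mirror] at hv
  convert hv using 1
  ext <;> simp [reflect]; ring

theorem EndsNorth.mirror {p : List Step} (h : EndsNorth p) : EndsNorth (mirror p) := by
  intro x hx
  rw [mem_visited_mirror] at hx
  rw [endpoint_mirror]
  exact h (reflect x) hx

theorem EndsEast.mirror {p : List Step} (h : EndsEast p) : EndsWest (mirror p) := by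
  intro x hx
  rw [mem_visited_mirror] at hx
  have := h _ hx
  rw [endpoint_mirror]
  simp [reflect] at this ⊢
  omega

theorem EndsWest.mirror {p : List Step} (h : EndsWest p) : EndsEast (mirror p) := by
  intro x hx
  rw [mem_visited_mirror] at hx
  have := h _ hx
  rw [endpoint_mirror]
  simp [reflect] at this ⊢
  omega

theorem HasWidth.mirror {p : List Step} (h : HasWidth p) : HasWidth (mirror p) := by
  obtain ⟨x, hx, y, hy, hne⟩ := h
  refine ⟨_, (reflect_mem_visited_mirror _ _).2 hx, _, (reflect_mem_visited_mirror _ _).2 hy, ?_⟩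
  simpa [reflect] using hne

theorem TurnAllowed.mirror {p : List Step} {s : Step} (h : TurnAllowed p s) :
    TurnAllowed (mirror p) s.mirror := by
  constructor
  · intro r hr hs ⟨hw, he⟩
    refine h.2 (PrudentPolygon.mirror r) ?_ ?_ ⟨?_, ?_⟩
    · rw [← mirror_mirror p, hr, mirror_snoc]; rfl
    · rw [← s.mirror_mirror, hs]; rfl
    · simpa using hw.mirror
    · simpa using he.mirror
  · intro r hr hs ⟨hw, he⟩
    refine h.1 (PrudentPolygon.mirror r) ?_ ?_ ⟨?_, ?_⟩
    · rw [← mirror_mirror p, hr, mirror_snoc]; rfl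
    · rw [← s.mirror_mirror, hs]; rfl
    · simpa using hw.mirror
    · simpa using he.mirror

theorem OnSide.mirror {p : List Step} (h : OnSide p) : OnSide (mirror p) := by
  rcases h with h | h | h
  · exact Or.inl h.mirror
  · exact Or.inr (Or.inr h.mirror)
  · exact Or.inr (Or.inl h.mirror)

theorem Valid.mirror {w : List Step} (h : Valid w) : Valid (mirror w) := by
  induction w using List.reverseRecOn with
  | nil => exact valid_nil
  | append_singleton p s ih =>
    obtain ⟨h1, h2, h3, h4⟩ := (valid_snoc _ _).1 h
    rw [mirror_snoc, valid_snoc, ← mirror_snoc]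
    exact ⟨ih h1, h2.mirror, h3.mirror, h4.mirror⟩

theorem Closes.mirror {w : List Step} (h : Closes w) : Closes (mirror w) := by
  obtain ⟨h1, s, hs⟩ := h
  refine ⟨by simpa [PrudentPolygon.mirror] using h1, s.mirror, ?_⟩
  rw [endpoint_mirror, vec_mirror]
  rw [Prod.ext_iff] at hs ⊢
  simp [reflect] at hs ⊢
  omega

/-! ### The area -/

/-- The contribution of the edges of a walk to the contour integral `∮ x dy`. -/
def signedArea (w : List Step) : ℤ :=
  ∑ i ∈ Finset.range w.length,
    (endpoint (w.take i)).1 * ((endpoint (w.take (i + 1))).2 - (endpoint (w.take i)).2)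

theorem area_eq (w : List Step) :
    area w = (signedArea w + (endpoint w).1 * (0 - (endpoint w).2)).natAbs := rfl

theorem signedArea_snoc (p : List Step) (s : Step) :
    signedArea (p ++ [s]) = signedArea p + (endpoint p).1 * s.vec.2 := by
  unfold signedArea
  rw [List.length_append, List.length_singleton, Finset.sum_range_succ]
  congr 1
  · refine Finset.sum_congr rfl fun i hi => ?_
    rw [Finset.mem_range] at hi
    rw [List.take_append_of_le_length (by omega), List.take_append_of_le_length (by omega)]
  · have h : (p ++ [s]).take (p.length + 1) = p ++ [s] := List.take_of_length_le (by simp)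
    rw [List.take_append_of_le_length le_rfl, List.take_length, h, endpoint_snoc]
    simp

theorem signedArea_mirror (w : List Step) : signedArea (mirror w) = -signedArea w := by
  induction w using List.reverseRecOn with
  | nil => rfl
  | append_singleton p s ih =>
    rw [mirror_snoc, signedArea_snoc, signedArea_snoc, ih, endpoint_mirror, vec_mirror]
    simp [reflect]; ring

theorem area_mirror (w : List Step) : area (mirror w) = area w := by
  rw [area_eq, area_eq, signedArea_mirror, endpoint_mirror, ← Int.natAbs_neg]
  congr 1
  simp [reflect]; ring

/-- On the west side the area n is that of the walk raised by h along x = -m. The raise contributes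
-hm to ∮ x dy, which explains the correction. -/
theorem LeftWalk.signedArea {p : List Step} {σ : State} {n : ℕ} (h : LeftWalk p σ n) :
    PrudentPolygon.signedArea p = (match σ with | col m _ h _ => (h : ℤ) * m | row _ _ _ _ => 0) - n := by
  induction h with
  | nil => rfl
  | col_south h _ ih =>
    rw [signedArea_snoc, ih, h.inv_valid.1.1]; simp [Step.vec]; ring
  | col_north h _ ih =>
    rw [signedArea_snoc, ih, h.inv_valid.1.1]; simp [Step.vec]; ring
  | col_up h ih =>
    rw [signedArea_snoc, ih, h.inv_valid.1.1]; simp [Step.vec]; ring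
  | col_west h ih =>
    rw [signedArea_snoc, ih, h.inv_valid.1.1]; simp [Step.vec]; ring
  | row_east h _ ih =>
    rw [signedArea_snoc, ih, h.inv_valid.1.1]; simp [Step.vec]
  | row_west h _ _ ih =>
    rw [signedArea_snoc, ih, h.inv_valid.1.1]; simp [Step.vec]
  | row_north h ih =>
    rw [signedArea_snoc, ih, h.inv_valid.1.1]; simp [Step.vec]; ring
  | row_out h ih =>
    rw [signedArea_snoc, ih, h.inv_valid.1.1]; simp [Step.vec]

/-! ### Leaving the left half-plane -/

/-- A left walk on the axis, followed by an east step and `i` south steps. -/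
def descend (p : List Step) (i : ℕ) : List Step := p ++ .east :: List.replicate i .south

theorem descend_zero (p : List Step) : descend p 0 = p ++ [.east] := rfl

theorem descend_succ (p : List Step) (i : ℕ) : descend p (i + 1) = descend p i ++ [.south] := by
  simp [descend, List.replicate_succ']

theorem endpoint_descend {p : List Step} {y : ℤ} (he : endpoint p = (0, y)) (i : ℕ) :
    endpoint (descend p i) = (1, y - i) := by
  induction i with
  | zero => rw [descend_zero, endpoint_snoc, he]; ext <;> simp [Step.vec]
  | succ i ih => rw [descend_succ, endpoint_snoc, ih]; ext <;> simp [Step.vec]; omega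

theorem mem_visited_descend {p : List Step} {y : ℤ} (he : endpoint p = (0, y)) (i : ℕ) (x z : ℤ) :
    (x, z) ∈ visited (descend p i) ↔ (x, z) ∈ visited p ∨ (x = 1 ∧ y - i ≤ z ∧ z ≤ y) := by
  induction i with
  | zero =>
    rw [descend_zero, mem_visited_snoc he, or_comm]
    refine or_congr Iff.rfl ?_
    simp only [Step.vec]
    omega
  | succ i ih =>
    rw [descend_succ, mem_visited_snoc (endpoint_descend he i), ih]
    by_cases hx : (x, z) ∈ visited p
    · simp [hx]
    · simp only [hx, Step.vec, false_or]
      push_cast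
      omega

theorem signedArea_descend {p : List Step} {y : ℤ} (he : endpoint p = (0, y)) (i : ℕ) :
    signedArea (descend p i) = signedArea p - i := by
  induction i with
  | zero => rw [descend_zero, signedArea_snoc, he]; simp
  | succ i ih =>
    rw [descend_succ, signedArea_snoc, ih, endpoint_descend he]; simp [Step.vec]; ring

theorem LeftWalk.valid_descend {p : List Step} {m d₀ y n : ℕ} (h : LeftWalk p (row m d₀ 0 y) n)
    (i : ℕ) : Valid (descend p i) := by
  obtain ⟨⟨he, hdm, hd₀, hy, h1, h2, h3, h4, h5⟩, hv⟩ := h.inv_valid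
  rw [Nat.cast_zero, neg_zero] at he
  have hE : ∀ i, EndsEast (descend p i) := by
    rintro i ⟨x, z⟩ hx
    rw [mem_visited_descend he] at hx
    rw [endpoint_descend he]
    rcases hx with hx | hx
    · have := h1 x z hx
      dsimp only; omega
    · dsimp only; omega
  induction i with
  | zero =>
    have := hE 0
    rw [descend_zero] at this ⊢
    refine (valid_snoc _ _).2 ⟨hv, ?_, Or.inr (Or.inl this), turnAllowed_of_ne h5 _⟩
    rw [freeAhead_east he]
    intro x hx hxv
    have := h1 x _ hxv
    omega
  | succ i ih =>
    have := hE (i + 1)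
    rw [descend_succ] at this ⊢
    refine (valid_snoc _ _).2 ⟨ih, ?_, Or.inr (Or.inl this), turnAllowed_south _⟩
    rw [freeAhead_south (endpoint_descend he i)]
    intro z hz hzv
    rw [mem_visited_descend he] at hzv
    rcases hzv with hzv | hzv
    · have := h1 _ _ hzv
      omega
    · omega

/-- A configuration from which the walk cannot reach `(-1, 0)` without crossing `x = -1`. -/
def BlockedWest (p : List Step) : Prop :=
  (∃ y, (-1, y) ∈ visited p) ∧ (∃ x z, 1 ≤ x ∧ (x, z) ∈ visited p) ∧
  (∃ x z, 1 ≤ z ∧ (x, z) ∈ visited p) ∧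
  ((endpoint p).1 = -1 → 1 ≤ (endpoint p).2 ∧ ∃ y, y < (endpoint p).2 ∧ (-1, y) ∈ visited p)

theorem Valid.onSide {p : List Step} (h : Valid p) : OnSide p := h.2.1 p List.prefix_rfl

/-- As the walk stays in x ≥ -1, it enters x = -1 only from x = 0. There nodes lie on both sides, so
the walk must be on the north side of its box, at height at least 1. A prudent west step from there
lands strictly above the old node on x = -1, and that node blocks every later south step. -/
theorem BlockedWest.step {p : List Step} {s : Step} (h : BlockedWest p) (hv : Valid (p ++ [s]))
    (hx : ∀ x z, (x, z) ∈ visited (p ++ [s]) → -1 ≤ x) : BlockedWest (p ++ [s]) := by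
  obtain ⟨⟨y, hy⟩, ⟨a, b, hab, habv⟩, ⟨c, d, hcd, hcdv⟩, h4⟩ := h
  have hsub : visited p ⊆ visited (p ++ [s]) := visited_mono (List.prefix_append _ _)
  refine ⟨⟨y, hsub hy⟩, ⟨a, b, hab, hsub habv⟩, ⟨c, d, hcd, hsub hcdv⟩, ?_⟩
  obtain ⟨hvp, hf, -, -⟩ := (valid_snoc _ _).1 hv
  obtain ⟨u, v⟩ : ℤ × ℤ := endpoint p
  generalize he : endpoint p = e at h4
  obtain ⟨u, v⟩ := e
  rw [endpoint_snoc, he]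
  have hu := hx u v (hsub (mem_visited_self he))
  dsimp only at h4
  cases s with
  | north =>
    simp only [Step.vec, Prod.mk_add_mk]
    intro hu
    obtain ⟨h5, y', h6, h7⟩ := h4 (by omega)
    exact ⟨by omega, y', by omega, hsub h7⟩
  | south =>
    simp only [Step.vec, Prod.mk_add_mk]
    intro hu
    obtain ⟨h5, y', h6, h7⟩ := h4 (by omega)
    rw [freeAhead_south he] at hf
    obtain rfl : u = -1 := by omega
    exact absurd h7 (hf y' h6)
  | east =>
    simp only [Step.vec, Prod.mk_add_mk]
    intro hu
    omega
  | west =>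
    simp only [Step.vec, Prod.mk_add_mk]
    intro hu'
    obtain rfl : u = 0 := by omega
    have hn : EndsNorth p := by
      rcases hvp.onSide with hs | hs | hs
      · exact hs
      · have := hs _ habv
        rw [he] at this
        dsimp only at this; omega
      · have := hs _ hy
        rw [he] at this
        dsimp only at this; omega
    have e1 := hn _ hcdv
    have e2 := hn _ hy
    rw [he] at e1 e2
    dsimp only at e1 e2
    refine ⟨by omega, y, ?_, hsub hy⟩
    rcases lt_or_eq_of_le e2 with h | rfl
    · omega
    · rw [freeAhead_west he] at hf
      exact absurd hy (hf (-1) (by omega))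

theorem BlockedWest.endpoint_ne {p r : List Step} (h : BlockedWest p) (hv : Valid (p ++ r))
    (hx : ∀ x z, (x, z) ∈ visited (p ++ r) → -1 ≤ x) : endpoint (p ++ r) ≠ (-1, 0) := by
  induction r generalizing p with
  | nil =>
    intro he
    rw [List.append_nil] at he
    have := h.2.2.2 (by rw [he])
    rw [he] at this
    exact absurd this.1 (by norm_num)
  | cons s r ih =>
    rw [← List.singleton_append, ← List.append_assoc] at hv hx ⊢
    exact ih (h.step hv.of_append fun x z hz => hx x z (visited_mono (List.prefix_append _ _) hz))
      hv hx

theorem Closes.endpoint {w : List Step} (h : Closes w) :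
    endpoint w = (0, 1) ∨ endpoint w = (0, -1) ∨ endpoint w = (1, 0) ∨ endpoint w = (-1, 0) := by
  obtain ⟨-, s, hs⟩ := h
  simp only [Prod.ext_iff] at hs ⊢
  cases s <;> simp [Step.vec] at hs ⊢ <;> omega

/-- A walk that leaves the left half-plane can only close by descending straight to `(1, 0)`. -/
theorem LeftWalk.eq_descend {p : List Step} {m d₀ y n : ℕ} (h : LeftWalk p (row m d₀ 0 y) n)
    (hm : 0 < m) {r : List Step} (i : ℕ) (hv : Valid (descend p i ++ r))
    (hc : Closes (descend p i ++ r)) : descend p i ++ r = descend p y := by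
  obtain ⟨⟨he, hdm, hd₀, hy, h1, h2, h3, h4, h5⟩, -⟩ := h.inv_valid
  rw [Nat.cast_zero, neg_zero] at he
  obtain ⟨z₁, -, hz₁⟩ := h2 1 hm
  rw [Nat.cast_one] at hz₁
  induction r generalizing i with
  | nil =>
    rw [List.append_nil] at hc ⊢
    have := hc.endpoint
    rw [endpoint_descend he] at this
    simp at this
    congr 1
    omega
  | cons s r ih =>
    rw [← List.singleton_append, ← List.append_assoc] at hv hc ⊢
    have hei := endpoint_descend he i
    have hsub : visited (descend p i ++ [s]) ⊆ visited (descend p i ++ [s] ++ r) :=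
      visited_mono (List.prefix_append _ _)
    have hsub' : visited (descend p i) ⊆ visited (descend p i ++ [s]) :=
      visited_mono (List.prefix_append _ _)
    have hp : visited p ⊆ visited (descend p i) := visited_mono (List.prefix_append _ _)
    obtain ⟨-, hf, -, ht⟩ := (valid_snoc _ _).1 hv.of_append
    -- Column x = -1 has been visited because m > 0, so a closing walk that ends on the west side
    -- ends at (-1, 0), which is blocked.
    have hwest : (∃ x z, 1 ≤ x ∧ (x, z) ∈ visited (descend p i ++ [s])) →
        (endpoint (descend p i ++ [s])).1 ≠ -1 → ¬ EndsWest (descend p i ++ [s] ++ r) := by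
      intro hx1 hne hW
      have e1 := hW _ (hsub (hsub' (hp hz₁)))
      have hend : endpoint (descend p i ++ [s] ++ r) = (-1, 0) := by
        rcases hc.endpoint with h | h | h | h
        · rw [h] at e1; norm_num at e1
        · rw [h] at e1; norm_num at e1
        · rw [h] at e1; norm_num at e1
        · exact h
      refine BlockedWest.endpoint_ne (p := descend p i ++ [s]) ⟨⟨_, hsub' (hp hz₁)⟩, hx1,
        ⟨0, y, by omega, hsub' (hp (mem_visited_self he))⟩, fun h => absurd h hne⟩ hv ?_ hend
      intro x z hxz
      have := hW _ hxz
      rw [hend] at this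
      exact this
    cases s with
    | south =>
      rw [← descend_succ] at hv hc ⊢
      exact ih (i + 1) hv hc
    | west =>
      exfalso
      cases i with
      | zero =>
        rw [freeAhead_west hei] at hf
        exact hf 0 (by norm_num) (hp (by simpa using mem_visited_self he))
      -- After a south step on the east side, a west step is excluded by the turn rule.
      | succ i =>
        refine ht.1 _ (descend_succ p i) rfl ⟨⟨_, mem_visited_self hei, _,
          hp (mem_visited_self he), by simp⟩, ?_⟩
        rintro ⟨x, z⟩ hx
        rw [mem_visited_descend he] at hx
        rw [hei]
        rcases hx with hx | hx
        · have := h1 x z hx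
          dsimp only; omega
        · dsimp only; omega
    | north =>
      exfalso
      cases i with
      | succ i =>
        rw [freeAhead_north hei] at hf
        refine hf ((y : ℤ) - i) (by push_cast; omega) ?_
        rw [mem_visited_descend he]
        exact Or.inr ⟨rfl, by push_cast; omega, by omega⟩
      | zero =>
        have he' : endpoint (descend p 0 ++ [.north]) = (1, (y : ℤ) + 1) := by
          rw [endpoint_snoc, hei]; ext <;> simp [Step.vec]
        have hmem := mem_visited_self he'
        rcases hv.onSide with hs | hs | hs
        · have := hs _ (hsub hmem)
          rcases hc.endpoint with h | h | h | h <;> rw [h] at this <;> dsimp only at this <;> omega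
        · have e1 := hs _ (hsub hmem)
          have hend : endpoint (descend p 0 ++ [.north] ++ r) = (1, 0) := by
            rcases hc.endpoint with h | h | h | h
            · rw [h] at e1; norm_num at e1
            · rw [h] at e1; norm_num at e1
            · exact h
            · rw [h] at e1; norm_num at e1
          -- After reflection x = 1 takes the role of x = -1. It was entered at height y and has
          -- been climbed to y + 1, so the node below blocks the return to height 0.
          have hv' := hv.mirror
          rw [mirror_append] at hv'
          refine BlockedWest.endpoint_ne (p := mirror (descend p 0 ++ [.north]))
            ⟨⟨y, ?_⟩, ⟨1, z₁, le_rfl, ?_⟩, ⟨0, y, by omega, ?_⟩, fun _ => ⟨?_, y, ?_, ?_⟩⟩ hv' ?_ ?_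
          · rw [mem_visited_mirror]
            exact hsub' (by simpa [reflect] using mem_visited_self hei)
          · rw [mem_visited_mirror]
            exact hsub' (hp hz₁)
          · rw [mem_visited_mirror]
            exact hsub' (hp (mem_visited_self he))
          · rw [endpoint_mirror, he']; simp [reflect]
          · rw [endpoint_mirror, he']; simp [reflect]
          · rw [mem_visited_mirror]
            exact hsub' (by simpa [reflect] using mem_visited_self hei)
          · intro x z hxz
            rw [← mirror_append, mem_visited_mirror] at hxz
            have := hs _ hxz
            rw [hend] at this
            simp [reflect] at this
            omega
          · rw [← mirror_append, endpoint_mirror, hend]; rfl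
        · exact hwest ⟨_, _, le_rfl, hmem⟩ (by rw [he']; norm_num) hs
    | east =>
      exfalso
      have he' : endpoint (descend p i ++ [.east]) = (2, (y : ℤ) - i) := by
        rw [endpoint_snoc, hei]; ext <;> simp [Step.vec]
      have hmem := mem_visited_self he'
      rcases hv.onSide with hs | hs | hs
      -- An end on the north side must be (0, 1), and then y = 1: but p already ended there.
      · have e1 := hs _ (hsub (hsub' (hp (mem_visited_self he))))
        have e2 : endpoint (descend p i ++ [.east] ++ r) = endpoint p := by
          rcases hc.endpoint with h | h | h | h
          · rw [h] at e1 ⊢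
            rw [he]
            dsimp only at e1
            ext <;> dsimp only; omega
          all_goals rw [h] at e1; dsimp only at e1; omega
        have e3 := hv.1.1 _ p List.prefix_rfl
          (by simp [descend]) e2
        have := congrArg List.length e3
        simp [descend] at this
      · have := hs _ (hsub hmem)
        rcases hc.endpoint with h | h | h | h <;> rw [h] at this <;> dsimp only at this <;> omega
      · exact hwest ⟨_, _, one_le_two, hmem⟩ (by rw [he']; norm_num) hs

end PrudentPolygon

namespace PrudentPolygon

open State

/-! ### Classification of the polygons -/

/-- At width zero the walk has not left the axis and is straight. Such walks equal their own
reflections, which lets a first east step be read as a reflected west step. -/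
theorem LeftWalk.eq_replicate {p : List Step} {σ : State} {n : ℕ} (h : LeftWalk p σ n) :
    (∀ d₀ d y, σ = row 0 d₀ d y → p = List.replicate y .north) ∧
    (∀ h₀ h y, σ = col 0 h₀ h y → p = List.replicate h .south) := by
  induction h with
  | nil => simp
  | col_south h hh ih =>
    refine ⟨by simp, ?_⟩
    rintro _ _ _ ⟨⟩
    rw [ih.2 _ _ _ rfl, List.replicate_succ']
  | col_north h hh ih =>
    refine ⟨by simp, ?_⟩
    rintro _ _ _ ⟨⟩
    obtain ⟨-, -, -, -, -, -, h6, -⟩ := h.inv_valid.1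
    have := h6 rfl
    omega
  | col_up h ih =>
    refine ⟨?_, by simp⟩
    rintro _ _ _ ⟨⟩
    obtain ⟨-, -, -, -, -, -, h6, -⟩ := h.inv_valid.1
    rw [ih.2 _ _ _ rfl, (h6 rfl).2]
    rfl
  | col_west h ih => simp
  | row_east h hd ih =>
    refine ⟨?_, by simp⟩
    rintro _ _ _ ⟨⟩
    obtain ⟨-, hd, -⟩ := h.inv_valid.1
    omega
  | row_west h hd hdm ih =>
    refine ⟨?_, by simp⟩
    rintro _ _ _ ⟨⟩
    omega
  | row_north h ih =>
    refine ⟨?_, by simp⟩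
    rintro _ _ _ ⟨⟩
    rw [ih.1 _ _ _ rfl, List.replicate_succ']
  | row_out h ih => simp

/-- A left walk, or a left walk with box of non-zero width followed by an east step from the axis
and further steps. -/
def LeftOrExit (w : List Step) : Prop :=
  (∃ σ n, LeftWalk w σ n) ∨
    ∃ p r m d₀ y n, LeftWalk p (row m d₀ 0 y) n ∧ 0 < m ∧ w = descend p 0 ++ r

theorem LeftOrExit.step {p : List Step} {s : Step} (h : LeftOrExit p) (hv : Valid (p ++ [s])) :
    LeftOrExit (p ++ [s]) ∨ LeftOrExit (mirror (p ++ [s])) := by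
  rcases h with ⟨σ, n, h⟩ | ⟨p', r, m, d₀, y, n, h, hm, rfl⟩
  · rcases h.step hv with ⟨σ', n', h'⟩ | ⟨rfl, ⟨m, d₀, y, rfl⟩ | ⟨h₀, h', y, rfl⟩⟩
    · exact Or.inl (Or.inl ⟨_, _, h'⟩)
    -- At width zero the walk is its own reflection, so the reflected walk simply leaves the row to
    -- the west.
    · rcases Nat.eq_zero_or_pos m with rfl | hm
      · right; left
        refine ⟨col 1 0 0 y, n, ?_⟩
        rw [mirror_snoc]
        have e : mirror p = p := by
          rw [h.eq_replicate.1 _ _ _ rfl]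
          simp [mirror, Step.mirror]
        rw [e]
        exact h.row_out
      · exact Or.inl (Or.inr ⟨p, [], m, d₀, y, n, h, hm, by simp [descend]⟩)
    · right; left
      refine ⟨col 1 h' h' y, n + h', ?_⟩
      rw [mirror_snoc]
      have e : mirror p = p := by
        rw [h.eq_replicate.2 _ _ _ rfl]
        simp [mirror, Step.mirror]
      rw [e]
      exact h.col_west
  · exact Or.inl (Or.inr ⟨p', r ++ [s], m, d₀, y, n, h, hm, by simp⟩)

theorem Valid.leftOrExit {w : List Step} (hv : Valid w) :
    LeftOrExit w ∨ LeftOrExit (PrudentPolygon.mirror w) := by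
  induction w using List.reverseRecOn with
  | nil => exact Or.inl (Or.inl ⟨_, _, LeftWalk.nil⟩)
  | append_singleton p s ih =>
    rcases ih hv.of_append with h | h
    · exact h.step hv
    · have hv' := hv.mirror
      rw [mirror_snoc] at hv'
      have := h.step hv'
      rw [← mirror_snoc, mirror_mirror] at this
      exact this.symm

/-- The left polygons: `IsLeftPolygon w n` says that `w` is the walk of one of these polygons and
that its area is `n`. Every polygon is a left polygon or the mirror image of one. -/
inductive IsLeftPolygon : List Step → ℕ → Prop where
  | column {w : List Step} {k n : ℕ} : 0 < k → LeftWalk w (col 1 k 0 0) n → IsLeftPolygon w n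
  | bargraph {w : List Step} {m d₀ n : ℕ} : 0 < m → LeftWalk w (row m d₀ 0 1) n →
      IsLeftPolygon w n
  | loop {p : List Step} {m d₀ y n : ℕ} : LeftWalk p (row m d₀ 0 y) n →
      IsLeftPolygon (descend p y) (n + y)

/-- A west step straight from the axis in a column state keeps the top at 0. So at width one a
positive top means: straight north, one step west out of the row, then south. These walks are the
reflections of the loops of width zero. -/
theorem LeftWalk.exists_of_col_one {w : List Step} {σ : State} {n : ℕ} (h : LeftWalk w σ n) :
    ∀ h₀ h y, σ = col 1 h₀ h y → 0 < y →
      h₀ = 0 ∧ ∃ p d₀ n', LeftWalk p (row 0 d₀ 0 y) n' ∧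
        w = p ++ .west :: List.replicate h .south := by
  induction h with
  | nil => simp
  | col_south h hh ih =>
    rintro _ _ _ ⟨⟩ hy
    obtain ⟨h0, p, d₀, n', hp, rfl⟩ := ih _ _ _ rfl hy
    exact ⟨h0, p, d₀, n', hp, by simp [List.replicate_succ']⟩
  | col_north h hh ih =>
    rintro _ _ _ ⟨⟩ hy
    obtain ⟨h0, -⟩ := ih _ _ _ rfl hy
    omega
  | col_up h ih => simp
  | col_west h ih =>
    rintro _ _ _ ⟨⟩ hy
    obtain ⟨-, -, -, -, -, -, h6, -⟩ := h.inv_valid.1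
    have := h6 rfl
    omega
  | row_east h hd ih => simp
  | row_west h hd hdm ih => simp
  | row_north h ih => simp
  | row_out h ih =>
    rintro _ _ _ ⟨⟩ hy
    exact ⟨rfl, _, _, _, h, rfl⟩

theorem LeftWalk.isLeftPolygon {w : List Step} {σ : State} {n : ℕ} (h : LeftWalk w σ n)
    (hc : Closes w) : (∃ n, IsLeftPolygon w n) ∨ ∃ n, IsLeftPolygon (mirror w) n := by
  have hI := h.inv_valid.1
  have hend := hc.endpoint
  have hlen := hc.1
  cases σ with
  | row m d₀ d y =>
    obtain ⟨he, -, -, hy, -⟩ := hI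
    rw [he] at hend
    simp only [Prod.mk.injEq] at hend
    obtain rfl : d = 0 := by omega
    obtain rfl : y = 1 := by omega
    rcases Nat.eq_zero_or_pos m with rfl | hm
    · rw [h.eq_replicate.1 _ _ _ rfl] at hlen
      simp at hlen
    · exact Or.inl ⟨_, .bargraph hm h⟩
  | col m h₀ h' y =>
    obtain ⟨he, -, -, -, -, -, h6, -⟩ := hI
    rw [he] at hend
    simp only [Prod.mk.injEq] at hend
    rcases Nat.eq_zero_or_pos m with rfl | hm
    · rw [h.eq_replicate.2 _ _ _ rfl, List.length_replicate] at hlen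
      have := h6 rfl
      omega
    · obtain rfl : m = 1 := by omega
      obtain rfl : y = h' := by omega
      rcases Nat.eq_zero_or_pos y with rfl | hy
      · rcases Nat.eq_zero_or_pos h₀ with rfl | hh
        -- Here the walk would be the single step west, which is too short to close.
        · exfalso
          cases h with
          | col_north _ hh => omega
          | col_west h =>
            rw [h.eq_replicate.2 _ _ _ rfl] at hlen
            simp at hlen
          | row_out h =>
            obtain ⟨-, -, -, hy, -⟩ := h.inv_valid.1
            omega
        · exact Or.inl ⟨_, .column hh h⟩
      · obtain ⟨-, p, d₀, n', hp, rfl⟩ := h.exists_of_col_one _ _ _ rfl hy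
        right
        refine ⟨n' + y, ?_⟩
        have e : mirror (p ++ .west :: List.replicate y .south) = descend p y := by
          rw [hp.eq_replicate.1 _ _ _ rfl]
          simp [mirror, descend, Step.mirror]
        rw [e]
        exact .loop hp

theorem LeftOrExit.isLeftPolygon {w : List Step} (h : LeftOrExit w) (hv : Valid w)
    (hc : Closes w) : (∃ n, IsLeftPolygon w n) ∨ ∃ n, IsLeftPolygon (mirror w) n := by
  rcases h with ⟨σ, n, h⟩ | ⟨p, r, m, d₀, y, n, h, hm, rfl⟩
  · exact h.isLeftPolygon hc
  · left
    rw [h.eq_descend hm 0 hv hc]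
    exact ⟨_, .loop h⟩

theorem exists_isLeftPolygon {w : List Step} (hv : Valid w) (hc : Closes w) :
    (∃ n, IsLeftPolygon w n) ∨ ∃ n, IsLeftPolygon (mirror w) n := by
  rcases hv.leftOrExit with h | h
  · exact h.isLeftPolygon hv hc
  · have := h.isLeftPolygon hv.mirror hc.mirror
    rw [mirror_mirror] at this
    exact this.symm

theorem LeftWalk.two_le_length {w : List Step} {σ : State} {n : ℕ} (h : LeftWalk w σ n)
    (h0 : σ ≠ col 0 0 0 0) (h1 : ∀ s, σ ≠ (State.next (col 0 0 0 0, 0) s).1) : 2 ≤ w.length := by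
  have := h.foldl_next
  match w with
  | [] => exact absurd (congrArg Prod.fst this).symm h0
  | [s] => exact absurd (congrArg Prod.fst this).symm (h1 s)
  | _ :: _ :: _ => simp

theorem closes_of_endpoint {w : List Step} (h : 2 ≤ w.length) (s : Step)
    (he : endpoint w = -s.vec) : Closes w := ⟨h, s, by rw [he]; simp⟩

theorem IsLeftPolygon.spec {w : List Step} {n : ℕ} (h : IsLeftPolygon w n) :
    Valid w ∧ Closes w ∧ area w = n := by
  cases h with
  | column hk h =>
    obtain ⟨⟨he, -⟩, hv⟩ := h.inv_valid
    refine ⟨hv, closes_of_endpoint (h.two_le_length (by simp) ?_) .east ?_, ?_⟩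
    · rintro (_ | _) <;> simp [State.next]; omega
    · rw [he]; simp [Step.vec]
    · rw [area_eq, h.signedArea, he]; simp
  | bargraph hm h =>
    obtain ⟨⟨he, -⟩, hv⟩ := h.inv_valid
    refine ⟨hv, closes_of_endpoint (h.two_le_length (by simp) ?_) .south ?_, ?_⟩
    · rintro (_ | _) <;> simp [State.next]; omega
    · rw [he]; simp [Step.vec]
    · rw [area_eq, h.signedArea, he]; simp
  | @loop p m d₀ y n h =>
    obtain ⟨⟨he, -, -, hy, -⟩, hv⟩ := h.inv_valid
    rw [Nat.cast_zero, neg_zero] at he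
    refine ⟨h.valid_descend _, closes_of_endpoint ?_ .west ?_, ?_⟩
    · simp [descend]; omega
    · rw [endpoint_descend he]; simp [Step.vec]
    · rw [area_eq, signedArea_descend he, h.signedArea, endpoint_descend he]
      simp; omega

theorem LeftWalk.getLast_of_lt {w : List Step} {k j y m n : ℕ} (h : LeftWalk w (col m k j y) n)
    (hk : j < k) : w.getLast? = some .north := by
  cases h with
  | nil => omega
  | col_south _ _ => omega
  | col_north _ _ => simp
  | col_west _ => omega
  | row_out _ => omega

theorem LeftWalk.getLast_of_row {w : List Step} {m d₀ n : ℕ} (h : LeftWalk w (row m d₀ 0 1) n)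
    (hm : 0 < m) : w.getLast? = some .east := by
  cases h with
  | col_up _ => omega
  | row_east _ _ => simp
  | row_north h =>
    obtain ⟨-, -, -, hy, -⟩ := h.inv_valid.1
    omega

theorem getLast_descend (p : List Step) {y : ℕ} (hy : 0 < y) :
    (descend p y).getLast? = some .south := by
  obtain ⟨y, rfl⟩ : ∃ k, y = k + 1 := ⟨y - 1, by omega⟩
  rw [descend_succ]; simp

theorem IsLeftPolygon.last_endpoint {w : List Step} {n : ℕ} (h : IsLeftPolygon w n) :
    (w.getLast? = some .north ∧ (endpoint w).1 = -1) ∨ w.getLast? = some .east ∨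
      (w.getLast? = some .south ∧ (endpoint w).1 = 1) := by
  cases h with
  | column hk h =>
    obtain ⟨⟨he, -⟩, hv⟩ := h.inv_valid
    exact Or.inl ⟨h.getLast_of_lt hk, by rw [he]; simp⟩
  | bargraph hm h => exact Or.inr (Or.inl (h.getLast_of_row hm))
  | @loop p m d₀ y n h =>
    obtain ⟨⟨he, -, -, hy, -⟩, hv⟩ := h.inv_valid
    rw [Nat.cast_zero, neg_zero] at he
    exact Or.inr (Or.inr ⟨getLast_descend p hy, by rw [endpoint_descend he]⟩)

/-- The last step and the side of the endpoint decide. Left polygons end north at x = -1, or east,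
or south at x = 1; reflection turns these into north at x = 1, west, and south at x = -1. -/
theorem IsLeftPolygon.not_mirror {w : List Step} {n n' : ℕ} (h : IsLeftPolygon w n) :
    ¬ IsLeftPolygon (mirror w) n' := by
  intro h'
  have e1 := h.last_endpoint
  have e2 := h'.last_endpoint
  rw [endpoint_mirror, mirror, List.getLast?_map] at e2
  rcases e1 with ⟨a, b⟩ | a | ⟨a, b⟩ <;> rw [a] at e2 <;>
    simp [Step.mirror, reflect] at e2 <;> omega

end PrudentPolygon

open scoped ENNReal

namespace PrudentPolygon

open State

/-! ### Generating functions of left walks -/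

/-- The left walks in a given state, with their areas. -/
abbrev WalksTo (σ : State) : Type := {z : List Step × ℕ // LeftWalk z.1 σ z.2}

/-- The generating function by area of the left walks in the state `σ`. -/
noncomputable def walkGF (x : ℝ≥0∞) (σ : State) : ℝ≥0∞ := ∑' z : WalksTo σ, x ^ z.1.2

/-- Deleting the common last step is a bijection onto the walks in the states σ i; these do not
overlap because σ is injective and a walk determines its state. Working in [0, ∞] removes all
summability questions. -/
theorem walkGF_eq_of_pred {ι : Type*} (x : ℝ≥0∞) {τ : State} (σ : ι → State)
    (hσ : Function.Injective σ) (s : Step) (c : ℕ)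
    (h : ∀ p n, LeftWalk p τ n ↔ ∃ i p' n', LeftWalk p' (σ i) n' ∧ p = p' ++ [s] ∧ n = n' + c) :
    walkGF x τ = x ^ c * ∑' i, walkGF x (σ i) := by
  let f : (Σ i, WalksTo (σ i)) → WalksTo τ := fun z =>
    ⟨(z.2.1.1 ++ [s], z.2.1.2 + c), (h _ _).2 ⟨z.1, _, _, z.2.2, rfl, rfl⟩⟩
  have hf : Function.Bijective f := by
    constructor
    · rintro ⟨i, ⟨⟨p, n⟩, hp⟩⟩ ⟨j, ⟨⟨p', n'⟩, hp'⟩⟩ e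
      simp only [f, Subtype.mk.injEq, Prod.mk.injEq] at e
      obtain ⟨e1, e2⟩ := e
      obtain rfl := (List.append_inj' e1 rfl).1
      obtain ⟨e3, rfl⟩ := LeftWalk.unique hp hp'
      obtain rfl := hσ e3
      rfl
    · rintro ⟨⟨p, n⟩, hp⟩
      obtain ⟨i, p', n', h1, rfl, rfl⟩ := (h p n).1 hp
      exact ⟨⟨i, ⟨(p', n'), h1⟩⟩, rfl⟩
  unfold walkGF
  rw [← (Equiv.ofBijective f hf).tsum_eq, ENNReal.tsum_sigma', ← ENNReal.tsum_mul_left]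
  refine tsum_congr fun i => ?_
  rw [← ENNReal.tsum_mul_left]
  refine tsum_congr fun z => ?_
  simp [f, pow_add, mul_comm]

theorem walkGF_eq_zero (x : ℝ≥0∞) {σ : State} (h : ∀ p n, ¬ LeftWalk p σ n) : walkGF x σ = 0 := by
  have : IsEmpty (WalksTo σ) := ⟨fun z => h _ _ z.2⟩
  exact tsum_empty

theorem walkGF_eq_of_unique_pred (x : ℝ≥0∞) {τ σ : State} (s : Step)
    (h : ∀ p n, LeftWalk p τ n ↔ ∃ p', LeftWalk p' σ n ∧ p = p' ++ [s]) :
    walkGF x τ = walkGF x σ := by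
  rw [walkGF_eq_of_pred x (fun _ : Unit => σ) (Function.injective_of_subsingleton _) s 0]
  · simp
  · intro p n
    rw [h]
    constructor
    · rintro ⟨p', h1, rfl⟩
      exact ⟨(), p', n, h1, rfl, rfl⟩
    · rintro ⟨-, p', n', h1, rfl, rfl⟩
      exact ⟨p', h1, rfl⟩

theorem walkGF_col_south (x : ℝ≥0∞) {m h₀ h y : ℕ} (hh : h₀ ≤ h) :
    walkGF x (col m h₀ (h + 1) y) = walkGF x (col m h₀ h y) := by
  refine walkGF_eq_of_unique_pred x .south fun p n => ⟨fun hp => ?_, ?_⟩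
  · cases hp with
    | col_south hp _ => exact ⟨_, hp, rfl⟩
    | col_north hp _ => omega
    | col_west hp => omega
  · rintro ⟨p', hp, rfl⟩
    exact hp.col_south hh

theorem walkGF_col_north (x : ℝ≥0∞) {m h₀ h y : ℕ} (hh : h + 1 ≤ h₀) :
    walkGF x (col m h₀ h y) = walkGF x (col m h₀ (h + 1) y) := by
  refine walkGF_eq_of_unique_pred x .north fun p n => ⟨fun hp => ?_, ?_⟩
  · cases hp with
    | nil => omega
    | col_south hp _ => omega
    | col_north hp _ => exact ⟨_, hp, rfl⟩
    | col_west hp => omega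
    | row_out hp => omega
  · rintro ⟨p', hp, rfl⟩
    exact hp.col_north hh

/-- Once on a side, the walk can only continue straight away from its entry depth. Each such
position has exactly one predecessor and the area does not change. -/
theorem walkGF_col (x : ℝ≥0∞) (m h₀ h y : ℕ) :
    walkGF x (col m h₀ h y) = walkGF x (col m h₀ h₀ y) := by
  rcases le_total h₀ h with hh | hh
  · induction h, hh using Nat.le_induction with
    | base => rfl
    | succ h hh ih => rw [walkGF_col_south x hh, ih]
  · induction hh using Nat.decreasingInduction with
    | self => rfl
    | of_succ h hh ih => rw [walkGF_col_north x hh, ih]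

theorem walkGF_row_east (x : ℝ≥0∞) {m d₀ d y : ℕ} (hd : d + 1 ≤ d₀) (hd₀ : d₀ ≤ m) :
    walkGF x (row m d₀ d y) = walkGF x (row m d₀ (d + 1) y) := by
  refine walkGF_eq_of_unique_pred x .east fun p n => ⟨fun hp => ?_, ?_⟩
  · cases hp with
    | col_up hp => omega
    | row_east hp _ => exact ⟨_, hp, rfl⟩
    | row_west hp _ => omega
    | row_north hp => omega
  · rintro ⟨p', hp, rfl⟩
    exact hp.row_east hd

theorem walkGF_row_west (x : ℝ≥0∞) {m d₀ d y : ℕ} (hd : d₀ ≤ d) (hdm : d < m) :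
    walkGF x (row m d₀ (d + 1) y) = walkGF x (row m d₀ d y) := by
  refine walkGF_eq_of_unique_pred x .west fun p n => ⟨fun hp => ?_, ?_⟩
  · cases hp with
    | col_up hp => omega
    | row_east hp _ => omega
    | row_west hp _ => exact ⟨_, hp, rfl⟩
    | row_north hp => omega
  · rintro ⟨p', hp, rfl⟩
    exact hp.row_west hd hdm

theorem walkGF_row (x : ℝ≥0∞) {m d₀ d : ℕ} (y : ℕ) (hd₀ : d₀ ≤ m) (hd : d ≤ m) :
    walkGF x (row m d₀ d y) = walkGF x (row m d₀ d₀ y) := by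
  rcases le_total d₀ d with hh | hh
  · induction d, hh using Nat.le_induction with
    | base => rfl
    | succ d hh ih => rw [walkGF_row_west x hh (by omega), ih (by omega)]
  · induction hh using Nat.decreasingInduction with
    | self => rfl
    | of_succ d hh ih => rw [walkGF_row_east x hh hd₀, ih (by omega)]

/-- The generating function of the left walks on the west side, at a fixed depth. -/
noncomputable def colGF (x : ℝ≥0∞) (m y : ℕ) : ℝ≥0∞ := ∑' h, walkGF x (col m h h y)

/-- The generating function of the left walks on the top row, at a fixed distance. -/
noncomputable def rowGF (x : ℝ≥0∞) (m y : ℕ) : ℝ≥0∞ :=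
  ∑ d : Fin (m + 1), walkGF x (row m d d y)

theorem rowGF_zero (x : ℝ≥0∞) (m : ℕ) : rowGF x m 0 = 0 := by
  refine Finset.sum_eq_zero fun d _ => walkGF_eq_zero x fun p n hp => ?_
  obtain ⟨-, -, -, hy, -⟩ := hp.inv_valid.1
  omega

theorem walkGF_row_succ_of_lt (x : ℝ≥0∞) {m d : ℕ} (y : ℕ) (hd : d < m) :
    walkGF x (row m d d (y + 1)) = x ^ d * rowGF x m y := by
  rw [walkGF_eq_of_pred x (fun d₀ : Fin (m + 1) => row m d₀ d y) ?_ .north d, tsum_fintype]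
  · congr 1
    exact Finset.sum_congr rfl fun d₀ _ => walkGF_row x y (by omega) hd.le
  · intro p n
    constructor
    · intro hp
      cases hp with
      | col_up hp => omega
      | row_east hp _ => omega
      | row_west hp _ => omega
      | row_north hp =>
        obtain ⟨-, -, hd₀, -⟩ := hp.inv_valid.1
        exact ⟨⟨_, Nat.lt_succ_of_le hd₀⟩, _, _, hp, rfl, rfl⟩
    · rintro ⟨d₀, p', n', hp, rfl, rfl⟩
      exact hp.row_north
  · intro a b hab
    simpa [Fin.ext_iff] using hab

theorem walkGF_row_succ_self (x : ℝ≥0∞) (m y : ℕ) :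
    walkGF x (row m m m (y + 1)) = x ^ m * (rowGF x m y + colGF x m y) := by
  rw [walkGF_eq_of_pred x
    (Sum.elim (fun d₀ : Fin (m + 1) => row m d₀ m y) (fun h₀ : ℕ => col m h₀ 0 y)) ?_ .north m]
  · rw [ENNReal.summable.tsum_sum ENNReal.summable, tsum_fintype]
    congr 2
    · exact Finset.sum_congr rfl fun d₀ _ => walkGF_row x y (by omega) le_rfl
    · exact tsum_congr fun h => walkGF_col x m h 0 y
  · intro p n
    constructor
    · intro hp
      cases hp with
      | col_up hp => exact ⟨Sum.inr _, _, _, hp, rfl, rfl⟩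
      | row_east hp _ => omega
      | row_west hp _ => omega
      | row_north hp =>
        obtain ⟨-, -, hd₀, -⟩ := hp.inv_valid.1
        exact ⟨Sum.inl ⟨_, Nat.lt_succ_of_le hd₀⟩, _, _, hp, rfl, rfl⟩
    · rintro ⟨d₀ | h₀, p', n', hp, rfl, rfl⟩
      · exact hp.row_north
      · exact hp.col_up
  · rintro (a | a) (b | b) hab <;> simp [Fin.ext_iff] at hab ⊢ <;> exact hab

/-- A north step at distance d sweeps area d and may come from any entry point of the current row.
Only at d = m can the new row also be entered from the west side, at its top. -/
theorem rowGF_succ (x : ℝ≥0∞) (m y : ℕ) :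
    rowGF x m (y + 1) =
      (∑ d ∈ Finset.range (m + 1), x ^ d) * rowGF x m y + x ^ m * colGF x m y := by
  rw [rowGF, Fin.sum_univ_castSucc, Finset.sum_range_succ, Fin.val_last, walkGF_row_succ_self]
  rw [Finset.sum_congr rfl fun (d : Fin m) _ =>
    walkGF_row_succ_of_lt x (d := (d.castSucc : Fin (m + 1))) y (by simp)]
  rw [← Finset.sum_mul]
  simp only [Fin.val_castSucc]
  rw [Fin.sum_univ_eq_sum_range (fun d => x ^ d)]
  ring

theorem walkGF_col_succ_of_pos (x : ℝ≥0∞) (m y : ℕ) {h : ℕ} (hh : 0 < h) :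
    walkGF x (col (m + 1) h h y) = x ^ h * colGF x m y := by
  rw [walkGF_eq_of_pred x (fun h₀ : ℕ => col m h₀ h y) ?_ .west h]
  · congr 1
    exact tsum_congr fun h₀ => walkGF_col x m h₀ h y
  · intro p n
    constructor
    · intro hp
      cases hp with
      | col_south hp _ => omega
      | col_north hp _ => omega
      | col_west hp => exact ⟨_, _, _, hp, rfl, rfl⟩
      | row_out hp => omega
    · rintro ⟨h₀, p', n', hp, rfl, rfl⟩
      exact hp.col_west
  · intro a b hab
    simpa using hab

theorem walkGF_col_succ_zero (x : ℝ≥0∞) (m y : ℕ) :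
    walkGF x (col (m + 1) 0 0 y) = colGF x m y + rowGF x m y := by
  rw [walkGF_eq_of_pred x
    (Sum.elim (fun h₀ : ℕ => col m h₀ 0 y) (fun d₀ : Fin (m + 1) => row m d₀ m y)) ?_ .west 0]
  · rw [ENNReal.summable.tsum_sum ENNReal.summable, pow_zero, one_mul]
    congr 1
    · exact tsum_congr fun h => walkGF_col x m h 0 y
    · rw [tsum_fintype]
      exact Finset.sum_congr rfl fun d₀ _ => walkGF_row x y (by omega) le_rfl
  · intro p n
    constructor
    · intro hp
      cases hp with
      | col_north hp _ => omega
      | col_west hp => exact ⟨Sum.inl _, _, _, hp, rfl, rfl⟩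
      | row_out hp =>
        obtain ⟨-, -, hd₀, -⟩ := hp.inv_valid.1
        exact ⟨Sum.inr ⟨_, Nat.lt_succ_of_le hd₀⟩, _, _, hp, rfl, rfl⟩
    · rintro ⟨h₀ | d₀, p', n', hp, rfl, rfl⟩
      · exact hp.col_west
      · exact hp.row_out
  · rintro (a | a) (b | b) hab <;> simp [Fin.ext_iff] at hab ⊢ <;> exact hab

/-- The factor (1 - x)⁻¹ sums x^h over the depth h of the new column. From the top row a new column
can only be entered at depth zero, by stepping out at the west end. -/
theorem colGF_succ (x : ℝ≥0∞) (m y : ℕ) :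
    colGF x (m + 1) y = (1 - x)⁻¹ * colGF x m y + rowGF x m y := by
  rw [colGF, tsum_eq_zero_add' ENNReal.summable, walkGF_col_succ_zero]
  rw [tsum_congr fun h => walkGF_col_succ_of_pos x m y h.succ_pos, ENNReal.tsum_mul_right,
    ← ENNReal.tsum_geometric, tsum_eq_zero_add' (f := fun n : ℕ => x ^ n) ENNReal.summable]
  ring

theorem colGF_zero_succ (x : ℝ≥0∞) (y : ℕ) : colGF x 0 (y + 1) = 0 := by
  refine ENNReal.tsum_eq_zero.2 fun h => walkGF_eq_zero x fun p n hp => ?_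
  obtain ⟨-, -, -, -, -, -, h6, -⟩ := hp.inv_valid.1
  exact absurd (h6 rfl).2 (by omega)

theorem colGF_zero_zero (x : ℝ≥0∞) : colGF x 0 0 = 1 := by
  rw [colGF, tsum_eq_single 0]
  · rw [walkGF, tsum_eq_single (⟨([], 0), LeftWalk.nil⟩ : WalksTo (col 0 0 0 0))]
    · simp
    · rintro ⟨⟨p, n⟩, hp⟩ hne
      cases hp with
      | nil => exact absurd rfl hne
      | col_north _ hh => omega
  · intro h hh
    refine walkGF_eq_zero x fun p n hp => ?_
    obtain ⟨-, -, -, -, -, -, h6, -⟩ := hp.inv_valid.1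
    exact hh (h6 rfl).1

/-! ### The generating function of the polygons -/

/-- The left polygons, with their areas. -/
abbrev LeftPolygons : Type := {z : List Step × ℕ // IsLeftPolygon z.1 z.2}

/-- The walks of 3-sided prudent polygons. -/
abbrev Polygons : Type := {w : List Step // Valid w ∧ Closes w}

/-- Exactly one of a polygon and its reflection is a left polygon, and reflection preserves the
area. -/
theorem tsum_polygons (x : ℝ≥0∞) :
    ∑' w : Polygons, x ^ area w.1 = 2 * ∑' z : LeftPolygons, x ^ z.1.2 := by
  let f : LeftPolygons ⊕ LeftPolygons → Polygons := Sum.elim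
    (fun z => ⟨z.1.1, z.2.spec.1, z.2.spec.2.1⟩)
    (fun z => ⟨mirror z.1.1, z.2.spec.1.mirror, z.2.spec.2.1.mirror⟩)
  have hf : Function.Bijective f := by
    constructor
    · rintro (⟨⟨p, n⟩, hp⟩ | ⟨⟨p, n⟩, hp⟩) (⟨⟨p', n'⟩, hp'⟩ | ⟨⟨p', n'⟩, hp'⟩) e <;>
        simp only [f, Sum.elim_inl, Sum.elim_inr, Subtype.mk.injEq] at e
      · subst e
        obtain rfl : n = n' := hp.spec.2.2.symm.trans hp'.spec.2.2
        rfl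
      · subst e
        exact absurd hp hp'.not_mirror
      · subst e
        exact absurd hp' hp.not_mirror
      · obtain rfl : p = p' := by rw [← mirror_mirror p, e, mirror_mirror]
        obtain rfl : n = n' := hp.spec.2.2.symm.trans hp'.spec.2.2
        rfl
    · rintro ⟨w, hv, hc⟩
      rcases exists_isLeftPolygon hv hc with ⟨n, h⟩ | ⟨n, h⟩
      · exact ⟨Sum.inl ⟨(w, n), h⟩, rfl⟩
      · exact ⟨Sum.inr ⟨(mirror w, n), h⟩, by simp [f]⟩
  rw [← (Equiv.ofBijective f hf).tsum_eq, ENNReal.summable.tsum_sum ENNReal.summable, two_mul]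
  congr 1 <;> refine tsum_congr fun z => ?_
  · simp [f, z.2.spec.2.2]
  · simp [f, area_mirror, z.2.spec.2.2]

theorem descend_inj {p p' : List Step} {y y' : ℕ} (h : descend p y = descend p' y') :
    p = p' ∧ y = y' := by
  induction y generalizing y' with
  | zero =>
    cases y' with
    | zero => exact ⟨(List.append_inj' h rfl).1, rfl⟩
    | succ y' =>
      rw [descend_succ, descend_zero] at h
      have := (List.append_inj' h rfl).2
      simp at this
  | succ y ih =>
    cases y' with
    | zero =>
      rw [descend_succ, descend_zero] at h
      have := (List.append_inj' h rfl).2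
      simp at this
    | succ y' =>
      rw [descend_succ, descend_succ] at h
      obtain ⟨h1, h2⟩ := ih (List.append_inj' h rfl).1
      exact ⟨h1, by rw [h2]⟩

/-- Loops are recognised by their final south step; columns and bargraphs are separated by the
uniqueness of the state. The entry distance belongs to the state, so summing over it produces
`rowGF`. -/
theorem tsum_leftPolygons (x : ℝ≥0∞) :
    ∑' z : LeftPolygons, x ^ z.1.2 =
      ∑' k : ℕ, walkGF x (col 1 (k + 1) (k + 1) 0) + ∑' m : ℕ, rowGF x (m + 1) 1 +
        ∑' m : ℕ, ∑' y : ℕ, x ^ y * rowGF x m y := by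
  let ι₁ : Type := Σ k : ℕ, WalksTo (col 1 (k + 1) 0 0)
  let ι₂ : Type := Σ m : ℕ, Σ d₀ : Fin (m + 2), WalksTo (row (m + 1) d₀ 0 1)
  let ι₃ : Type := Σ m : ℕ, Σ y : ℕ, Σ d₀ : Fin (m + 1), WalksTo (row m d₀ 0 y)
  let f : (ι₁ ⊕ ι₂) ⊕ ι₃ → LeftPolygons := Sum.elim (Sum.elim
    (fun z => ⟨z.2.1, .column z.1.succ_pos z.2.2⟩)
    (fun z => ⟨z.2.2.1, .bargraph z.1.succ_pos z.2.2.2⟩))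
    (fun z => ⟨(descend z.2.2.2.1.1 z.2.1, z.2.2.2.1.2 + z.2.1), .loop z.2.2.2.2⟩)
  have hy : ∀ {p m d₀ d y n}, LeftWalk p (row m d₀ d y) n → 0 < y := fun h => by
    obtain ⟨-, -, -, hy, -⟩ := h.inv_valid.1
    exact hy
  have hf : Function.Bijective f := by
    constructor
    · rintro ((⟨k, ⟨⟨p, n⟩, hp⟩⟩ | ⟨m, d, ⟨⟨p, n⟩, hp⟩⟩) | ⟨m, y, d, ⟨⟨p, n⟩, hp⟩⟩)
        ((⟨k', ⟨⟨p', n'⟩, hp'⟩⟩ | ⟨m', d', ⟨⟨p', n'⟩, hp'⟩⟩) | ⟨m', y', d', ⟨⟨p', n'⟩, hp'⟩⟩) e <;>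
        simp only [f, Sum.elim_inl, Sum.elim_inr, Subtype.mk.injEq, Prod.mk.injEq] at e <;>
        obtain ⟨e1, e2⟩ := e <;> dsimp only at hp hp'
      · subst e1 e2
        obtain ⟨e3, -⟩ := LeftWalk.unique hp hp'
        obtain rfl : k = k' := by simpa using e3
        rfl
      · subst e1
        have := (LeftWalk.unique hp hp').1
        simp at this
      · have := hp.getLast_of_lt k.succ_pos
        rw [e1, getLast_descend _ (hy hp')] at this
        simp at this
      · subst e1
        have := (LeftWalk.unique hp hp').1
        simp at this
      · subst e1 e2
        obtain ⟨e3, -⟩ := LeftWalk.unique hp hp'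
        obtain rfl : m = m' := by simp at e3; exact e3.1
        obtain rfl : d = d' := by simpa [Fin.ext_iff] using e3
        rfl
      · have := hp.getLast_of_row m.succ_pos
        rw [e1, getLast_descend _ (hy hp')] at this
        simp at this
      · have := hp'.getLast_of_lt k'.succ_pos
        rw [← e1, getLast_descend _ (hy hp)] at this
        simp at this
      · have := hp'.getLast_of_row m'.succ_pos
        rw [← e1, getLast_descend _ (hy hp)] at this
        simp at this
      · obtain ⟨rfl, rfl⟩ := descend_inj e1
        obtain ⟨e3, rfl⟩ := LeftWalk.unique hp hp'
        obtain rfl : m = m' := by simp at e3; exact e3.1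
        obtain rfl : d = d' := by simpa [Fin.ext_iff] using e3
        rfl
    · rintro ⟨⟨w, n⟩, h⟩
      cases h with
      | @column w k n hk h =>
        obtain ⟨k, rfl⟩ : ∃ j, k = j + 1 := ⟨k - 1, by omega⟩
        exact ⟨Sum.inl (Sum.inl ⟨k, ⟨_, h⟩⟩), rfl⟩
      | @bargraph w m d₀ n hm h =>
        obtain ⟨m, rfl⟩ : ∃ j, m = j + 1 := ⟨m - 1, by omega⟩
        obtain ⟨-, -, hd, -⟩ := h.inv_valid.1
        exact ⟨Sum.inl (Sum.inr ⟨m, ⟨d₀, by omega⟩, ⟨_, h⟩⟩), rfl⟩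
      | @loop p m d₀ y n h =>
        obtain ⟨-, -, hd, -⟩ := h.inv_valid.1
        exact ⟨Sum.inr ⟨m, y, ⟨d₀, by omega⟩, ⟨(p, n), h⟩⟩, rfl⟩
  rw [← (Equiv.ofBijective f hf).tsum_eq, ENNReal.summable.tsum_sum ENNReal.summable,
    ENNReal.summable.tsum_sum ENNReal.summable]
  congr 1
  · congr 1
    · rw [ENNReal.tsum_sigma']
      refine tsum_congr fun k => ?_
      rw [← walkGF_col x 1 (k + 1) 0 0]
      rfl
    · rw [ENNReal.tsum_sigma']
      refine tsum_congr fun m => ?_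
      rw [ENNReal.tsum_sigma', tsum_fintype]
      refine Finset.sum_congr rfl fun d _ => ?_
      rw [← walkGF_row x 1 (d := 0) (by omega) (by omega)]
      rfl
  · rw [ENNReal.tsum_sigma']
    refine tsum_congr fun m => ?_
    rw [ENNReal.tsum_sigma']
    refine tsum_congr fun y => ?_
    rw [ENNReal.tsum_sigma', tsum_fintype, rowGF, Finset.mul_sum]
    refine Finset.sum_congr rfl fun d _ => ?_
    rw [← walkGF_row x y (d := 0) (by omega) (by omega), walkGF, ← ENNReal.tsum_mul_left]
    refine tsum_congr fun z => ?_
    simp [f, pow_add, mul_comm]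

end PrudentPolygon

/-! ### Solution of the transfer equations for real `q` -/

open scoped ENNReal

namespace PrudentPolygon

open State

/-- The product `∏_{i<m} (t + w q^{i+1}) / ∏_{i≤m} (t + q^{i+2})`. -/
noncomputable def ratioProd {K : Type*} [Field K] (q t w : K) (m : ℕ) : K :=
  (∏ i ∈ Finset.range m, (t + w * q ^ (i + 1))) / ∏ i ∈ Finset.range (m + 1), (t + q ^ (i + 2))

/-- The total S satisfies S = cS + E, but for c > 0 this is also solved by ∞. The partial sums are
first bounded by the fixed point E/(1 - c); only then can the equation be solved for S. -/
theorem ENNReal.tsum_linear_recurrence {z e : ℕ → ℝ≥0∞} {c E : ℝ} (hc0 : 0 ≤ c) (hc : c < 1)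
    (hE : 0 ≤ E) (hz0 : z 0 = 0) (hz : ∀ y, z (y + 1) = ENNReal.ofReal c * z y + e y)
    (he : ∑' y, e y = ENNReal.ofReal E) : ∑' y, z y = ENNReal.ofReal (E / (1 - c)) := by
  have hbound : ∀ n, ∑ y ∈ Finset.range n, z y ≤ ENNReal.ofReal (E / (1 - c)) := by
    intro n
    induction n with
    | zero => simp
    | succ n ih =>
      rw [Finset.sum_range_succ', hz0, add_zero, Finset.sum_congr rfl fun y _ => hz y,
        Finset.sum_add_distrib, ← Finset.mul_sum]
      calc _ ≤ ENNReal.ofReal c * ENNReal.ofReal (E / (1 - c)) + ENNReal.ofReal E := by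
            gcongr
            rw [← he]
            exact ENNReal.sum_le_tsum _
        _ = ENNReal.ofReal (E / (1 - c)) := by
            rw [← ENNReal.ofReal_mul hc0, ← ENNReal.ofReal_add (by
              have := sub_pos.2 hc
              positivity) hE]
            congr 1
            have : 1 - c ≠ 0 := (sub_pos.2 hc).ne'
            field_simp
            ring
  have hle : ∑' y, z y ≤ ENNReal.ofReal (E / (1 - c)) := by
    rw [ENNReal.tsum_eq_iSup_nat]
    exact iSup_le hbound
  have hfin : ∑' y, z y ≠ ∞ := ne_top_of_le_ne_top ENNReal.ofReal_ne_top hle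
  have heq : ∑' y, z y = ENNReal.ofReal c * ∑' y, z y + ENNReal.ofReal E := by
    conv_lhs => rw [tsum_eq_zero_add' ENNReal.summable, hz0, zero_add, tsum_congr hz,
      ENNReal.tsum_add, ENNReal.tsum_mul_left, he]
  rw [← ENNReal.ofReal_toReal hfin]
  congr 1
  have h := congrArg ENNReal.toReal heq
  rw [ENNReal.toReal_add (ENNReal.mul_ne_top ENNReal.ofReal_ne_top hfin) ENNReal.ofReal_ne_top,
    ENNReal.toReal_mul, ENNReal.toReal_ofReal hc0, ENNReal.toReal_ofReal hE] at h
  rw [eq_div_iff (sub_pos.2 hc).ne']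
  linarith

section Real

variable {q : ℝ}

theorem one_sub_two_mul_add_pow_pos (h0 : 0 < q) (h1 : q < 1 / 2) (n : ℕ) :
    0 < 1 - 2 * q + q ^ n := by
  have : 0 < q ^ n := pow_pos h0 n
  linarith

theorem ratioProd_pos (h0 : 0 < q) (h1 : q < 1 / 2) (m : ℕ) :
    0 < ratioProd q (1 - 2 * q) (1 - q + q ^ 2) m := by
  refine div_pos (Finset.prod_pos fun i _ => ?_)
    (Finset.prod_pos fun i _ => one_sub_two_mul_add_pow_pos h0 h1 _)
  have : 0 < q ^ (i + 1) := pow_pos h0 _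
  have : 0 < 1 - q + q ^ 2 := by nlinarith
  have : 0 < (1 - q + q ^ 2) * q ^ (i + 1) := by positivity
  linarith

theorem ratioProd_succ {K : Type*} [Field K] (q t w : K) (m : ℕ) :
    ratioProd q t w (m + 1) = ratioProd q t w m * ((t + w * q ^ (m + 1)) / (t + q ^ (m + 3))) := by
  rw [ratioProd, ratioProd, Finset.prod_range_succ, Finset.prod_range_succ _ (m + 1),
    mul_div_mul_comm]

theorem one_sub_ofReal_inv (h1 : q < 1) (h0 : 0 ≤ q) :
    (1 - ENNReal.ofReal q)⁻¹ = ENNReal.ofReal (1 / (1 - q)) := by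
  rw [← ENNReal.ofReal_one, ← ENNReal.ofReal_sub _ h0, ← ENNReal.ofReal_inv_of_pos (by linarith),
    one_div]

/-- Multiply the row equation by q^{y+1} and sum over y. The poles of the problem appear here: 1 -
q(1 + q + ⋯ + q^m) = (1 - 2q + q^{m+2})/(1 - q). -/
theorem tsum_rowGF_of_tsum_colGF (h0 : 0 < q) (h1 : q < 1 / 2) (m : ℕ)
    (hcol : ∑' y, ENNReal.ofReal q ^ y * colGF (ENNReal.ofReal q) m y =
        ENNReal.ofReal (ratioProd q (1 - 2 * q) (1 - q + q ^ 2) m * (1 - 2 * q + q ^ (m + 2)) /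
          (1 - q) ^ m)) :
    ∑' y, ENNReal.ofReal q ^ y * rowGF (ENNReal.ofReal q) m y =
        ENNReal.ofReal ((1 - q) * q * ((q / (1 - q)) ^ m *
          ratioProd q (1 - 2 * q) (1 - q + q ^ 2) m)) := by
  set x := ENNReal.ofReal q with hx
  set E := ratioProd q (1 - 2 * q) (1 - q + q ^ 2) m * (1 - 2 * q + q ^ (m + 2)) / (1 - q) ^ m
    with hE
  have hq1 : 0 < 1 - q := by linarith
  have hR := ratioProd_pos h0 h1 m
  have ht := one_sub_two_mul_add_pow_pos h0 h1
  have hE0 : 0 ≤ E := by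
    have := (ht (m + 2)).le
    positivity
  have hxpow : ∀ d, x ^ d = ENNReal.ofReal (q ^ d) := fun d => by
    rw [hx, ENNReal.ofReal_pow h0.le]
  have hgeom : ∑ d ∈ Finset.range (m + 1), q ^ d = (1 - q ^ (m + 1)) / (1 - q) := by
    rw [geom_sum_eq (by linarith)]
    rw [← neg_div_neg_eq]; congr 1 <;> ring
  have hp := pow_pos h0 (m + 1)
  have hp1 : q ^ (m + 1) ≤ 1 := pow_le_one₀ h0.le (by linarith)
  rw [ENNReal.tsum_linear_recurrence (z := fun y => x ^ y * rowGF x m y)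
      (e := fun y => x ^ (m + 1) * (x ^ y * colGF x m y))
      (c := q * ((1 - q ^ (m + 1)) / (1 - q))) (E := q ^ (m + 1) * E) ?_ ?_ (by positivity) ?_ ?_ ?_]
  · congr 1
    have e : 1 - q * ((1 - q ^ (m + 1)) / (1 - q)) = (1 - 2 * q + q ^ (m + 2)) / (1 - q) := by
      field_simp; ring
    rw [e, div_pow, hE]
    have := (ht (m + 2)).ne'
    field_simp
    ring
  · have : 0 ≤ 1 - q ^ (m + 1) := by linarith
    positivity
  · rw [← mul_div_assoc, div_lt_one hq1]
    nlinarith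
  · simp [rowGF_zero]
  · intro y
    rw [rowGF_succ, ← hgeom, ENNReal.ofReal_mul h0.le,
      ENNReal.ofReal_sum_of_nonneg fun i _ => by positivity, ← hx]
    simp only [← hxpow]
    ring
  · rw [ENNReal.tsum_mul_left, hcol, hxpow, ← ENNReal.ofReal_mul hp.le]

/-- The new numerator factor comes from (1 - 2q + q^{m+2}) + q^{m+1}(1 - q)² = (1 - 2q) + (1 - q +
q²)q^{m+1}. -/
theorem tsum_colGF (h0 : 0 < q) (h1 : q < 1 / 2) (m : ℕ) :
    ∑' y, ENNReal.ofReal q ^ y * colGF (ENNReal.ofReal q) m y =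
        ENNReal.ofReal (ratioProd q (1 - 2 * q) (1 - q + q ^ 2) m * (1 - 2 * q + q ^ (m + 2)) /
          (1 - q) ^ m) := by
  have hq1 : 0 < 1 - q := by linarith
  have ht := one_sub_two_mul_add_pow_pos h0 h1
  induction m with
  | zero =>
    rw [tsum_eq_single 0]
    · rw [colGF_zero_zero, ratioProd]
      have := (ht 2).ne'
      simp only [pow_zero, one_mul, zero_add, Finset.range_zero, Finset.prod_empty,
        Finset.range_one, Finset.prod_singleton, div_one]
      rw [div_mul_cancel₀ _ this, ENNReal.ofReal_one]
    · intro y hy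
      obtain ⟨y, rfl⟩ : ∃ k, y = k + 1 := ⟨y - 1, by omega⟩
      rw [colGF_zero_succ, mul_zero]
  | succ m ih =>
    have hR := ratioProd_pos h0 h1 m
    have hrow := tsum_rowGF_of_tsum_colGF h0 h1 m ih
    rw [tsum_congr fun y => by rw [colGF_succ, mul_add, mul_left_comm], ENNReal.tsum_add,
      ENNReal.tsum_mul_left, ih, hrow, one_sub_ofReal_inv (by linarith) h0.le,
      ← ENNReal.ofReal_mul (by positivity), ← ENNReal.ofReal_add]
    · congr 1
      have h2 := (ht (m + 2)).ne'
      have h3 := (ht (m + 3)).ne'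
      rw [ratioProd_succ, div_pow, show m + 1 + 2 = m + 3 from rfl,
        mul_assoc (ratioProd q _ _ m), div_mul_cancel₀ _ h3]
      field_simp
      ring
    · have := (ht (m + 2)).le
      positivity
    · positivity

/-- The three terms belong to the columns, ∑ q^{k+1}; the bargraphs, ∑ (q/(1 - q))^{m+1}; and the
loops. -/
theorem tsum_leftPolygons_ofReal (h0 : 0 < q) (h1 : q < 1 / 2) {B : ℝ}
    (hB : HasSum (fun m => (1 - q) * q * ((q / (1 - q)) ^ m *
      ratioProd q (1 - 2 * q) (1 - q + q ^ 2) m)) B) :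
    ∑' z : LeftPolygons, ENNReal.ofReal q ^ z.1.2 =
      ENNReal.ofReal (q / (1 - q) + q / (1 - 2 * q) + B) := by
  have hq1 : 0 < 1 - q := by linarith
  have ht : 0 < 1 - 2 * q := by linarith
  have hz1 : q / (1 - q) < 1 := by rw [div_lt_one hq1]; linarith
  have hz0 : 0 ≤ q / (1 - q) := by positivity
  have hM : ∀ m, 0 ≤ (1 - q) * q * ((q / (1 - q)) ^ m *
      ratioProd q (1 - 2 * q) (1 - q + q ^ 2) m) := fun m => by
    have := ratioProd_pos h0 h1 m
    positivity
  have hcol0 : ∀ m, colGF (ENNReal.ofReal q) m 0 = ENNReal.ofReal ((1 / (1 - q)) ^ m) := by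
    intro m
    induction m with
    | zero => simp [colGF_zero_zero]
    | succ m ih =>
      rw [colGF_succ, rowGF_zero, add_zero, ih, one_sub_ofReal_inv (by linarith) h0.le,
        ← ENNReal.ofReal_mul (by positivity), pow_succ']
  rw [tsum_leftPolygons, ENNReal.ofReal_add (by positivity) (hB.nonneg hM),
    ENNReal.ofReal_add (by positivity) (by positivity)]
  congr 1
  · congr 1
    · have hs : HasSum (fun k : ℕ => q ^ (k + 1)) (q / (1 - q)) := by
        have := (hasSum_geometric_of_lt_one h0.le (by linarith : q < 1)).mul_left q
        rw [← div_eq_mul_inv] at this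
        exact this.congr_fun fun k => by ring
      rw [← hs.tsum_eq, ENNReal.ofReal_tsum_of_nonneg (fun k => by positivity) hs.summable]
      refine tsum_congr fun k => ?_
      rw [walkGF_col_succ_of_pos _ _ _ k.succ_pos, colGF_zero_zero, mul_one,
        ENNReal.ofReal_pow h0.le]
    · have hs : HasSum (fun m : ℕ => (q / (1 - q)) ^ (m + 1)) (q / (1 - 2 * q)) := by
        have := (hasSum_geometric_of_lt_one hz0 hz1).mul_left (q / (1 - q))
        have e : q / (1 - q) * (1 - q / (1 - q))⁻¹ = q / (1 - 2 * q) := by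
          have : 1 - q / (1 - q) = (1 - 2 * q) / (1 - q) := by field_simp; ring
          rw [this]
          field_simp
        rw [e] at this
        exact this.congr_fun fun k => by ring
      rw [← hs.tsum_eq, ENNReal.ofReal_tsum_of_nonneg (fun k => by positivity) hs.summable]
      refine tsum_congr fun m => ?_
      rw [rowGF_succ, rowGF_zero, mul_zero, zero_add, hcol0, ← ENNReal.ofReal_pow h0.le,
        ← ENNReal.ofReal_mul (by positivity), ← mul_pow, mul_one_div]
  · rw [← hB.tsum_eq, ENNReal.ofReal_tsum_of_nonneg hM hB.summable]
    exact tsum_congr fun m => tsum_rowGF_of_tsum_colGF h0 h1 m (tsum_colGF h0 h1 m)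

theorem tsum_polygons_fiber (x : ℝ≥0∞) :
    ∑' w : Polygons, x ^ area w.1 = ∑' n, ∑' _ : threeSidedPolygons n, x ^ n := by
  let f : (Σ n, threeSidedPolygons n) → Polygons :=
    fun z => ⟨z.2.1, ⟨z.2.2.1, z.2.2.2.1⟩, z.2.2.2.2.1⟩
  have hf : Function.Bijective f := by
    constructor
    · rintro ⟨n, w, h1, h2, h3, rfl⟩ ⟨n', w', h1', h2', h3', rfl⟩ e
      simp only [f, Subtype.mk.injEq] at e
      subst e
      rfl
    · rintro ⟨w, ⟨h1, h2⟩, h3⟩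
      exact ⟨⟨area w, w, h1, h2, h3, rfl⟩, rfl⟩
  rw [← (Equiv.ofBijective f hf).tsum_eq, ENNReal.tsum_sigma']
  refine tsum_congr fun n => tsum_congr fun w => ?_
  simp [f, w.2.2.2.2]

/-- The generating function of the 3-sided prudent polygons on `(0, 1/2)`. -/
theorem hasSum_PAcoeff (h0 : 0 < q) (h1 : q < 1 / 2) {B : ℝ}
    (hB : HasSum (fun m => (1 - q) * q * ((q / (1 - q)) ^ m *
      ratioProd q (1 - 2 * q) (1 - q + q ^ 2) m)) B) :
    (∀ n, (threeSidedPolygons n).Finite) ∧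
    HasSum (fun n => (PAcoeff n : ℝ) * q ^ n) (2 * (q / (1 - q) + q / (1 - 2 * q) + B)) := by
  have htot : ∑' n, ∑' _ : threeSidedPolygons n, ENNReal.ofReal q ^ n =
      ENNReal.ofReal (2 * (q / (1 - q) + q / (1 - 2 * q) + B)) := by
    rw [← tsum_polygons_fiber, tsum_polygons, tsum_leftPolygons_ofReal h0 h1 hB,
      ENNReal.ofReal_mul (by norm_num)]
    simp
  -- Infinitely many polygons of one area would make the total infinite.
  have hfin : ∀ n, (threeSidedPolygons n).Finite := by
    intro n
    by_contra hinf
    have : Infinite (threeSidedPolygons n) := Set.infinite_coe_iff.2 hinf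
    have htop : ∑' _ : threeSidedPolygons n, ENNReal.ofReal q ^ n = ∞ :=
      ENNReal.tsum_const_eq_top_of_ne_zero (pow_ne_zero _ (by simpa using h0))
    have := ENNReal.tsum_eq_top_of_eq_top
      (f := fun n => ∑' _ : threeSidedPolygons n, ENNReal.ofReal q ^ n) ⟨n, htop⟩
    rw [htot] at this
    exact ENNReal.ofReal_ne_top this
  refine ⟨hfin, ?_⟩
  have hterm : ∀ n, ∑' _ : threeSidedPolygons n, ENNReal.ofReal q ^ n =
      ENNReal.ofReal ((PAcoeff n : ℝ) * q ^ n) := by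
    intro n
    have := (hfin n).fintype
    rw [tsum_fintype, Finset.sum_const, PAcoeff, Set.ncard_eq_toFinset_card',
      Set.toFinset_card, Finset.card_univ, nsmul_eq_mul, ENNReal.ofReal_mul (by positivity),
      ENNReal.ofReal_natCast, ENNReal.ofReal_pow h0.le]
  rw [tsum_congr hterm] at htot
  have hnn : ∀ n, 0 ≤ (PAcoeff n : ℝ) * q ^ n := fun n => by positivity
  have hB0 : 0 ≤ B := hB.nonneg fun m => by
    have := ratioProd_pos h0 h1 m
    have : 0 < 1 - q := by linarith
    positivity
  have hsum : Summable fun n => (PAcoeff n : ℝ) * q ^ n := by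
    have h := ENNReal.summable_toReal (f := fun n => ENNReal.ofReal ((PAcoeff n : ℝ) * q ^ n))
      (by rw [htot]; exact ENNReal.ofReal_ne_top)
    exact h.congr fun n => ENNReal.toReal_ofReal (hnn n)
  rw [← ENNReal.ofReal_tsum_of_nonneg hnn hsum] at htot
  have : 0 < 1 - q := by linarith
  have : 0 < 1 - 2 * q := by linarith
  rw [ENNReal.ofReal_eq_ofReal_iff (tsum_nonneg hnn) (by positivity)] at htot
  rw [← htot]
  exact hsum.hasSum

end Real

end PrudentPolygon

open Filter Topology

namespace PrudentPolygon

/-! ### q-series -/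

theorem qPoch_zero (x q : ℂ) : qPoch x q 0 = 1 := by simp [qPoch]

theorem qPoch_succ (x q : ℂ) (n : ℕ) : qPoch x q (n + 1) = qPoch x q n * (1 - x * q ^ n) := by
  rw [qPoch, Finset.prod_range_succ, ← qPoch]

theorem qPoch_ne_zero {x q : ℂ} (h : ∀ i : ℕ, x * q ^ i ≠ 1) (n : ℕ) : qPoch x q n ≠ 0 :=
  Finset.prod_ne_zero_iff.2 fun i _ => sub_ne_zero.2 (h i).symm

theorem mul_pow_ne_one {x q : ℂ} (hx : ‖x‖ < 1) (hq : ‖q‖ < 1) (i : ℕ) : x * q ^ i ≠ 1 := by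
  intro h
  have : ‖x * q ^ i‖ < 1 := by
    rw [norm_mul, norm_pow]
    exact mul_lt_one_of_nonneg_of_lt_one_left (norm_nonneg _) hx
      (pow_le_one₀ (norm_nonneg _) hq.le)
  rw [h, norm_one] at this
  exact lt_irrefl _ this

theorem tendsto_qPoch (x : ℂ) {q : ℂ} (hq : ‖q‖ < 1) :
    Tendsto (qPoch x q) atTop (𝓝 (qPochInf x q)) :=
  (multipliable_qPochInf x hq).tendsto_prod_tprod_nat

theorem qPochInf_eq_mul (x : ℂ) {q : ℂ} (hq : ‖q‖ < 1) :
    qPochInf x q = (1 - x) * qPochInf (x * q) q := by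
  have h : (fun i : ℕ => 1 - x * q ^ (i + 1)) = fun i : ℕ => 1 - x * q * q ^ i := by
    ext i; ring
  rw [qPochInf, tprod_eq_zero_mul' (by rw [h]; exact multipliable_qPochInf _ hq), h, pow_zero,
    mul_one, qPochInf]

theorem qPochInf_eq_qPoch_mul (x : ℂ) {q : ℂ} (hq : ‖q‖ < 1) (n : ℕ) :
    qPochInf x q = qPoch x q n * qPochInf (x * q ^ n) q := by
  induction n with
  | zero => simp [qPoch_zero]
  | succ n ih =>
    rw [ih, qPochInf_eq_mul (x * q ^ n) hq, qPoch_succ, pow_succ, ← mul_assoc x, mul_assoc (qPoch x q n)]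

theorem qPochInf_ne_zero {x q : ℂ} (hq : ‖q‖ < 1) (h : ∀ i : ℕ, x * q ^ i ≠ 1) :
    qPochInf x q ≠ 0 := by
  have hs : Summable fun i : ℕ => ‖-(x * q ^ i)‖ := by
    simpa [norm_mul, norm_pow] using
      (summable_geometric_of_lt_one (norm_nonneg q) hq).mul_left ‖x‖
  have := tprod_one_add_ne_zero_of_summable (f := fun i : ℕ => -(x * q ^ i)) (fun i => by
    rw [← sub_eq_add_neg]
    exact sub_ne_zero.2 (h i).symm) hs
  simpa [qPochInf, sub_eq_add_neg] using this

theorem qPochInf_ne_zero_of_norm_lt {x q : ℂ} (hq : ‖q‖ < 1) (hx : ‖x‖ < 1) :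
    qPochInf x q ≠ 0 :=
  qPochInf_ne_zero hq (mul_pow_ne_one hx hq)

theorem tendsto_qPochInf_mul_pow {x q : ℂ} (hq : ‖q‖ < 1) (h : ∀ i : ℕ, x * q ^ i ≠ 1) :
    Tendsto (fun n : ℕ => qPochInf (x * q ^ n) q) atTop (𝓝 1) := by
  have h0 := qPochInf_ne_zero hq h
  have h1 := (tendsto_const_nhds (x := qPochInf x q)).div (tendsto_qPoch x hq) h0
  rw [div_self h0] at h1
  refine h1.congr fun n => ?_
  rw [Pi.div_apply, qPochInf_eq_qPoch_mul x hq n, mul_div_cancel_left₀ _ (qPoch_ne_zero h n)]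

theorem exists_norm_qPoch_div_le (x : ℂ) {b q : ℂ} (hq : ‖q‖ < 1) (h : ∀ i : ℕ, b * q ^ i ≠ 1) :
    ∃ C : ℝ, 0 < C ∧ ∀ n, ‖qPoch x q n / qPoch b q n‖ ≤ C := by
  have h1 := (tendsto_qPoch x hq).div (tendsto_qPoch b hq) (qPochInf_ne_zero hq h)
  obtain ⟨C, hC⟩ := h1.norm.bddAbove_range
  exact ⟨max C 1, by positivity, fun n => (hC ⟨n, rfl⟩).trans (le_max_left _ _)⟩

/-- The coefficients `(a; q)_n / (q; q)_n` of the `q`-binomial series. -/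
noncomputable def qBinom (a q : ℂ) (n : ℕ) : ℂ := qPoch a q n / qPoch q q n

theorem qBinom_zero (a q : ℂ) : qBinom a q 0 = 1 := by simp [qBinom, qPoch_zero]

theorem qBinom_succ {q : ℂ} (hq : ‖q‖ < 1) (a : ℂ) (n : ℕ) :
    qBinom a q (n + 1) * (1 - q ^ (n + 1)) = qBinom a q n * (1 - a * q ^ n) := by
  have h1 := qPoch_ne_zero (mul_pow_ne_one hq hq) n
  have h2 : 1 - q * q ^ n ≠ 0 := sub_ne_zero.2 (mul_pow_ne_one hq hq n).symm
  rw [qBinom, qBinom, qPoch_succ, qPoch_succ, pow_succ', mul_div_mul_comm, mul_assoc,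
    div_mul_cancel₀ _ h2]

theorem exists_norm_qBinom_le (a : ℂ) {q : ℂ} (hq : ‖q‖ < 1) :
    ∃ C : ℝ, 0 < C ∧ ∀ n, ‖qBinom a q n‖ ≤ C :=
  exists_norm_qPoch_div_le a hq (mul_pow_ne_one hq hq)

theorem summable_norm_qBinom_mul_pow (a : ℂ) {q z : ℂ} (hq : ‖q‖ < 1) (hz : ‖z‖ < 1) :
    Summable fun n => ‖qBinom a q n * z ^ n‖ := by
  obtain ⟨C, -, hC⟩ := exists_norm_qBinom_le a hq
  refine Summable.of_nonneg_of_le (fun _ => norm_nonneg _) (fun n => ?_)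
    ((summable_geometric_of_lt_one (norm_nonneg z) hz).mul_left C)
  rw [norm_mul, norm_pow]
  gcongr
  exact hC n

/-- The `q`-binomial theorem. -/
theorem tsum_qBinom_mul_pow (a : ℂ) {q z : ℂ} (hq : ‖q‖ < 1) (hz : ‖z‖ < 1) :
    ∑' n, qBinom a q n * z ^ n = qPochInf (a * z) q / qPochInf z q := by
  set f : ℂ → ℂ := fun z => ∑' n, qBinom a q n * z ^ n with hf
  have hlt : ∀ {z : ℂ}, ‖z‖ < 1 → ∀ n : ℕ, ‖z * q ^ n‖ < 1 := fun {z} hz n => by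
    rw [norm_mul, norm_pow]
    exact mul_lt_one_of_nonneg_of_lt_one_left (norm_nonneg _) hz
      (pow_le_one₀ (norm_nonneg _) hq.le)
  -- The recurrence of the coefficients is a functional equation relating z to zq. Iterating it
  -- towards zq^n → 0, where the series tends to 1, produces the products.
  have hfe : ∀ z : ℂ, ‖z‖ < 1 → (1 - z) * f z = (1 - a * z) * f (z * q) := by
    intro z hz
    have hs := (summable_norm_qBinom_mul_pow a hq hz).of_norm
    have hzq : ‖z * q‖ < 1 := by simpa using hlt hz 1
    have hs' := (summable_norm_qBinom_mul_pow a hq hzq).of_norm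
    have e1 : f z - f (z * q) = z * f z - a * z * f (z * q) := by
      have h1 : f z - f (z * q) = ∑' n, qBinom a q n * (1 - q ^ n) * z ^ n := by
        rw [hf, ← hs.tsum_sub hs']
        refine tsum_congr fun n => ?_
        rw [mul_pow]; ring
      have h2 : z * f z - a * z * f (z * q) =
          ∑' n, qBinom a q (n + 1) * (1 - q ^ (n + 1)) * z ^ (n + 1) := by
        rw [hf, ← tsum_mul_left, ← tsum_mul_left, ← (hs.mul_left z).tsum_sub (hs'.mul_left _)]
        refine tsum_congr fun n => ?_
        rw [qBinom_succ hq, mul_pow]; ring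
      have hs'' : Summable fun n => qBinom a q n * (1 - q ^ n) * z ^ n :=
        (hs.sub hs').congr fun n => by rw [mul_pow]; ring
      rw [h1, h2, hs''.tsum_eq_zero_add]
      simp
    linear_combination e1
  have hit : ∀ n : ℕ, f z * qPochInf z q =
      qPoch (a * z) q n * (f (z * q ^ n) * qPochInf (z * q ^ n) q) := by
    intro n
    induction n with
    | zero => simp [qPoch_zero]
    | succ n ih =>
      rw [ih, qPochInf_eq_mul (z * q ^ n) hq, qPoch_succ, pow_succ, ← mul_assoc z]
      linear_combination qPoch (a * z) q n * qPochInf (z * q ^ n * q) q * hfe _ (hlt hz n)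
  have hlim : Tendsto (fun n : ℕ => f (z * q ^ n)) atTop (𝓝 1) := by
    have h0 : Tendsto (fun n : ℕ => z * q ^ n) atTop (𝓝 0) := by
      simpa using (tendsto_pow_atTop_nhds_zero_of_norm_lt_one hq).const_mul z
    have := tendsto_tsum_of_dominated_convergence (𝓕 := atTop)
      (f := fun (n : ℕ) k => qBinom a q k * (z * q ^ n) ^ k)
      (g := fun k => qBinom a q k * 0 ^ k) (bound := fun k => ‖qBinom a q k * z ^ k‖)
      (summable_norm_qBinom_mul_pow a hq hz) (fun k => (h0.pow k).const_mul _)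
      (Eventually.of_forall fun n k => ?_)
    · have e : ∑' k, qBinom a q k * 0 ^ k = 1 := by
        rw [tsum_eq_single 0 fun k hk => by simp [hk]]
        simp [qBinom_zero]
      rwa [e] at this
    · rw [norm_mul, norm_mul, norm_pow, norm_pow]
      gcongr
      rw [norm_mul, norm_pow]
      exact mul_le_of_le_one_right (norm_nonneg _) (pow_le_one₀ (norm_nonneg _) hq.le)
  have hz0 := qPochInf_ne_zero_of_norm_lt hq hz
  rw [eq_div_iff hz0]
  have h1 := (tendsto_qPoch (a * z) hq).mul
    (hlim.mul (tendsto_qPochInf_mul_pow hq (mul_pow_ne_one hz hq)))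
  rw [one_mul, mul_one] at h1
  exact tendsto_nhds_unique (tendsto_const_nhds.congr hit) h1

/-- Near the point, X is bounded and |Q| < ρ < 1, so the factors are 1 + O(ρ^n) uniformly and the
product converges locally uniformly. -/
theorem analyticAt_qPochInf {X Q : ℂ → ℂ} {z₀ : ℂ} (hX : AnalyticAt ℂ X z₀)
    (hQ : AnalyticAt ℂ Q z₀) (h : ‖Q z₀‖ < 1) :
    AnalyticAt ℂ (fun z => qPochInf (X z) (Q z)) z₀ := by
  obtain ⟨ρ, h1, h2⟩ := exists_between h
  have hρ0 : 0 ≤ ρ := (norm_nonneg _).trans h1.le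
  have e1 : ∀ᶠ z in 𝓝 z₀, ‖Q z‖ < ρ := hQ.continuousAt.norm.eventually_lt continuousAt_const h1
  have e2 : ∀ᶠ z in 𝓝 z₀, ‖X z‖ < ‖X z₀‖ + 1 :=
    hX.continuousAt.norm.eventually_lt continuousAt_const (lt_add_one _)
  obtain ⟨ε, hε, hball⟩ := Metric.eventually_nhds_iff_ball.1
    (e1.and (e2.and (hX.eventually_analyticAt.and hQ.eventually_analyticAt)))
  have hdiff : ∀ n : ℕ, DifferentiableOn ℂ (fun z => -(X z * Q z ^ n)) (Metric.ball z₀ ε) := by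
    intro n z hz
    obtain ⟨-, -, a, b⟩ := hball z hz
    exact ((a.differentiableAt.mul (b.differentiableAt.pow n)).neg).differentiableWithinAt
  have hprod := Summable.hasProdLocallyUniformlyOn_nat_one_add
    (f := fun (n : ℕ) z => -(X z * Q z ^ n)) (K := Metric.ball z₀ ε)
    (u := fun n => (‖X z₀‖ + 1) * ρ ^ n) Metric.isOpen_ball
    ((summable_geometric_of_lt_one hρ0 h2).mul_left _)
    (Eventually.of_forall fun n z hz => by
      obtain ⟨a, b, -⟩ := hball z hz
      rw [norm_neg, norm_mul, norm_pow]
      gcongr) (fun n => (hdiff n).continuousOn)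
  have hd := TendstoLocallyUniformlyOn.differentiableOn hprod
    (Eventually.of_forall fun s => by
      simpa [Finset.prod_fn] using
        DifferentiableOn.finsetProd (fun n _ => (hdiff n).const_add 1)) Metric.isOpen_ball
  have := hd.analyticAt (Metric.ball_mem_nhds z₀ hε)
  simpa [qPochInf, sub_eq_add_neg] using this

/-! ### The partial fraction expansion of the polygon series -/

/-- The coefficients of the partial fraction expansion of `ratioProd`. -/
noncomputable def pfCoeff (q w : ℂ) (m ν : ℕ) : ℂ :=
  (w / q) ^ ν * qBinom (q ^ 2 / w) q ν * qBinom (w / q) q (m - ν)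

/-- From m to m + 1 the residue at an old pole t = -q^{ν+2} is multiplied by the value of the new
factor there. -/
theorem pfCoeff_succ {q w : ℂ} (hq0 : q ≠ 0) (hq : ‖q‖ < 1) {m ν : ℕ} (h : ν ≤ m) :
    pfCoeff q w (m + 1) ν * (q ^ (m + 3) - q ^ (ν + 2)) =
      pfCoeff q w m ν * (w * q ^ (m + 1) - q ^ (ν + 2)) := by
  obtain ⟨k, rfl⟩ := Nat.exists_eq_add_of_le h
  have e := qBinom_succ hq (w / q) k
  rw [pfCoeff, pfCoeff, show ν + k + 1 - ν = k + 1 by omega, show ν + k - ν = k by omega]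
  have e1 : q ^ (ν + k + 3) - q ^ (ν + 2) = -q ^ (ν + 2) * (1 - q ^ (k + 1)) := by ring
  have e2 : w * q ^ (ν + k + 1) - q ^ (ν + 2) = -q ^ (ν + 2) * (1 - w / q * q ^ k) := by
    field_simp
    ring
  rw [e1, e2]
  linear_combination -(w / q) ^ ν * qBinom (q ^ 2 / w) q ν * q ^ (ν + 2) * e

theorem pow_sub_pow_ne_zero {q : ℂ} (hq0 : q ≠ 0) (hq : ‖q‖ < 1) {i j : ℕ} (h : i ≠ j) :
    q ^ i - q ^ j ≠ 0 := by
  refine sub_ne_zero.2 fun e => h ?_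
  have := congrArg norm e
  rw [norm_pow, norm_pow] at this
  exact (pow_right_strictAnti₀ (norm_pos_iff.2 hq0) hq).injective this

theorem pow_mul_qBinom {q w : ℂ} (hq0 : q ≠ 0) (hw : w ≠ 0) (n : ℕ) :
    (w / q) ^ n * qBinom (q ^ 2 / w) q n =
      ∏ i ∈ Finset.range n, ((w * q ^ (i + 1) - q ^ (n + 2)) / (q ^ (i + 2) - q ^ (n + 2))) := by
  rw [← Finset.prod_range_reflect, qBinom, qPoch, qPoch, ← Finset.prod_div_distrib]
  nth_rewrite 1 [← Finset.card_range n]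
  rw [← Finset.prod_const, ← Finset.prod_mul_distrib]
  refine Finset.prod_congr rfl fun j hj => ?_
  rw [Finset.mem_range] at hj
  obtain ⟨k, rfl⟩ : ∃ k, n = j + 1 + k := Nat.exists_eq_add_of_le hj
  rw [show j + 1 + k - 1 - j = k by omega]
  have e1 : w * q ^ (k + 1) - q ^ (j + 1 + k + 2) = w * q ^ (k + 1) * (1 - q ^ 2 / w * q ^ j) := by
    field_simp
    ring
  have e2 : q ^ (k + 2) - q ^ (j + 1 + k + 2) = q * q ^ (k + 1) * (1 - q * q ^ j) := by ring
  rw [e1, e2, mul_div_mul_comm, mul_div_mul_right _ _ (pow_ne_zero _ hq0)]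

/-- The residue at the newest pole t = -q^{m+3} is the previous product evaluated there, times the
new numerator factor. -/
theorem pfCoeff_self {q w : ℂ} (hq0 : q ≠ 0) (hw : w ≠ 0) (m : ℕ) :
    pfCoeff q w (m + 1) (m + 1) =
      (w * q ^ (m + 1) - q ^ (m + 3)) * ratioProd q (-q ^ (m + 3)) w m := by
  rw [pfCoeff, Nat.sub_self, qBinom_zero, mul_one, pow_mul_qBinom hq0 hw, Finset.prod_div_distrib,
    Finset.prod_range_succ, ratioProd, mul_comm (∏ i ∈ Finset.range m, _), mul_div_assoc]
  congr 2
  · exact Finset.prod_congr rfl fun i _ => by ring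
  · exact Finset.prod_congr rfl fun i _ => by ring

/-- Both claims go through one induction because the coefficient of the newest pole is computed from
the previous expansion at t = -q^{m+3}. The coefficients sum to one because the product behaves like
1/t at infinity. -/
theorem ratioProd_eq_sum {q w : ℂ} (hq0 : q ≠ 0) (hw : w ≠ 0) (hq : ‖q‖ < 1) (m : ℕ) :
    (∀ t : ℂ, (∀ i : ℕ, i ≤ m → t + q ^ (i + 2) ≠ 0) →
      ratioProd q t w m = ∑ ν ∈ Finset.range (m + 1), pfCoeff q w m ν / (t + q ^ (ν + 2))) ∧
    ∑ ν ∈ Finset.range (m + 1), pfCoeff q w m ν = 1 := by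
  induction m with
  | zero => simp [ratioProd, pfCoeff, qBinom_zero]
  | succ m ih =>
    obtain ⟨ih1, ih2⟩ := ih
    have hne : ∀ ν : ℕ, ν ≤ m → q ^ (m + 3) - q ^ (ν + 2) ≠ 0 := fun ν hν =>
      pow_sub_pow_ne_zero hq0 hq (by omega)
    have hne' : ∀ ν : ℕ, ν ≤ m → -q ^ (m + 3) + q ^ (ν + 2) ≠ 0 := fun ν hν h =>
      hne ν hν (by linear_combination -h)
    have hself : pfCoeff q w (m + 1) (m + 1) = ∑ ν ∈ Finset.range (m + 1),
        pfCoeff q w m ν * ((w * q ^ (m + 1) - q ^ (m + 3)) / (-q ^ (m + 3) + q ^ (ν + 2))) := by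
      rw [pfCoeff_self hq0 hw, ih1 _ hne', Finset.mul_sum]
      exact Finset.sum_congr rfl fun ν _ => by ring
    have hstep : ∀ ν : ℕ, ν ≤ m → pfCoeff q w (m + 1) ν =
        pfCoeff q w m ν * ((w * q ^ (m + 1) - q ^ (ν + 2)) / (q ^ (m + 3) - q ^ (ν + 2))) := by
      intro ν hν
      rw [← mul_div_assoc, eq_div_iff (hne ν hν), pfCoeff_succ hq0 hq hν]
    constructor
    · intro t ht
      rw [ratioProd_succ, ih1 t fun i hi => ht i (by omega), Finset.sum_range_succ _ (m + 1), hself,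
        Finset.sum_div, Finset.sum_mul, ← Finset.sum_add_distrib]
      refine Finset.sum_congr rfl fun ν hν => ?_
      have hν : ν ≤ m := by simpa [Nat.lt_succ_iff] using hν
      rw [hstep ν hν]
      have a1 := hne ν hν
      have a2 := hne' ν hν
      have a3 := ht ν (by omega)
      have a4 := ht (m + 1) le_rfl
      rw [show m + 1 + 2 = m + 3 from rfl] at a4 ⊢
      generalize q ^ (m + 3) = Y at *
      generalize q ^ (ν + 2) = P at *
      generalize w * q ^ (m + 1) = X at *
      have a5 : -Y + P = -(Y - P) := by ring
      rw [a5]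
      field_simp
      ring
    · rw [Finset.sum_range_succ, hself, ← Finset.sum_add_distrib, ← ih2]
      refine Finset.sum_congr rfl fun ν hν => ?_
      have hν : ν ≤ m := by simpa [Nat.lt_succ_iff] using hν
      rw [hstep ν hν]
      have a1 := hne ν hν
      have a5 : -q ^ (m + 3) + q ^ (ν + 2) = -(q ^ (m + 3) - q ^ (ν + 2)) := by ring
      rw [a5]
      field_simp
      ring

/-- The series `∑_ν (a; q)_ν / (q; q)_ν (v q)^ν / (t + q^{ν+2})`. -/
noncomputable def poleSeries (q t a v : ℂ) : ℂ :=
  ∑' ν : ℕ, qBinom a q ν * (v * q) ^ ν / (t + q ^ (ν + 2))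

theorem exists_norm_inv_pole_le {q t : ℂ} (hq : ‖q‖ < 1) (ht : t ≠ 0) :
    ∃ c : ℝ, 0 < c ∧ ∀ ν : ℕ, ‖(t + q ^ (ν + 2))⁻¹‖ ≤ c := by
  have h1 : Tendsto (fun ν : ℕ => (t + q ^ (ν + 2))⁻¹) atTop (𝓝 (t + 0)⁻¹) :=
    (((tendsto_pow_atTop_nhds_zero_of_norm_lt_one hq).comp (tendsto_add_atTop_nat 2)).const_add
      t).inv₀ (by simpa using ht)
  obtain ⟨C, hC⟩ := h1.norm.bddAbove_range
  exact ⟨max C 1, by positivity, fun n => (hC ⟨n, rfl⟩).trans (le_max_left _ _)⟩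

theorem summable_norm_poleSeries (a : ℂ) {q t v : ℂ} (hq : ‖q‖ < 1) (hv : ‖v * q‖ < 1)
    (ht : t ≠ 0) :
    Summable fun ν : ℕ => ‖qBinom a q ν * (v * q) ^ ν / (t + q ^ (ν + 2))‖ := by
  obtain ⟨c, -, hc⟩ := exists_norm_inv_pole_le hq ht
  refine Summable.of_nonneg_of_le (fun _ => norm_nonneg _) (fun ν => ?_)
    ((summable_norm_qBinom_mul_pow a hq hv).mul_right c)
  rw [div_eq_mul_inv, norm_mul]
  gcongr
  exact hc ν

/-- The polygon series in terms of the pole series. -/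
theorem hasSum_ratioProd {q t w z : ℂ} (hq0 : q ≠ 0) (hw : w ≠ 0) (hq : ‖q‖ < 1) (hz : ‖z‖ < 1)
    (hzw : ‖z * w‖ < 1) (ht : t ≠ 0) (hp : ∀ ν : ℕ, t + q ^ (ν + 2) ≠ 0) :
    HasSum (fun m => z ^ m * ratioProd q t w m)
      (t⁻¹ * ((1 - z)⁻¹ - q ^ 2 * (qPochInf (z * w / q) q / qPochInf z q) *
        poleSeries q t (q ^ 2 / w) (z * w / q))) := by
  have hv : ‖z * w / q * q‖ < 1 := by rwa [div_mul_cancel₀ _ hq0]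
  have hF := summable_norm_poleSeries (q ^ 2 / w) hq hv ht
  have hG := summable_norm_qBinom_mul_pow (w / q) hq hz
  have hcauchy := (summable_norm_sum_mul_antidiagonal_of_summable_norm hF hG).of_norm.hasSum
  rw [← tsum_mul_tsum_eq_tsum_sum_antidiagonal_of_summable_norm hF hG] at hcauchy
  rw [tsum_qBinom_mul_pow (w / q) hq hz] at hcauchy
  -- With Q = q^{ν+2}, write 1/(t + Q) = t⁻¹(1 - Q/(t + Q)). The first part sums to the geometric
  -- series because the coefficients sum to one. The second gains a factor q^ν, so its series over ν
  -- has ratio zw instead of zw/q, which may exceed one in modulus.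
  have hgeo := hasSum_geometric_of_norm_lt_one hz
  have := (hgeo.sub (hcauchy.mul_left (q ^ 2))).mul_left t⁻¹
  rw [show w / q * z = z * w / q by ring, mul_comm (tsum _), ← mul_assoc (q ^ 2)] at this
  refine this.congr_fun fun m => ?_
  obtain ⟨h1, h2⟩ := ratioProd_eq_sum hq0 hw hq m
  rw [h1 t fun i _ => hp i, Finset.Nat.sum_antidiagonal_eq_sum_range_succ
    (fun i j => qBinom (q ^ 2 / w) q i * (z * w / q * q) ^ i / (t + q ^ (i + 2)) *
      (qBinom (w / q) q j * z ^ j))]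
  have e : (z : ℂ) ^ m = z ^ m * ∑ ν ∈ Finset.range (m + 1), pfCoeff q w m ν := by
    rw [h2, mul_one]
  rw [eq_inv_mul_iff_mul_eq₀ ht]
  nth_rewrite 2 [e]
  rw [Finset.mul_sum, Finset.mul_sum, Finset.mul_sum, Finset.mul_sum, ← Finset.sum_sub_distrib]
  refine Finset.sum_congr rfl fun ν hν => ?_
  have hν : ν ≤ m := by simpa [Nat.lt_succ_iff] using hν
  obtain ⟨k, rfl⟩ := Nat.exists_eq_add_of_le hν
  rw [pfCoeff, show ν + k - ν = k by omega, div_mul_cancel₀ _ hq0]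
  have := hp ν
  rw [pow_add z, mul_pow, div_pow]
  field_simp
  ring

end PrudentPolygon

open Filter Topology

namespace PrudentPolygon

/-! ### The connection formula -/

/-- The quotient `(q y; q)_∞ / (a y; q)_∞`. -/
noncomputable def pochRatio (a q y : ℂ) : ℂ := qPochInf (q * y) q / qPochInf (a * y) q

theorem norm_mul_lt_one {x y : ℂ} (hx : ‖x‖ < 1) (hy : ‖y‖ ≤ 1) : ‖x * y‖ < 1 := by
  rw [norm_mul]
  exact mul_lt_one_of_nonneg_of_lt_one_left (norm_nonneg _) hx hy

theorem norm_pow_le_one {q : ℂ} (hq : ‖q‖ < 1) (n : ℕ) : ‖q ^ n‖ ≤ 1 := by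
  rw [norm_pow]
  exact pow_le_one₀ (norm_nonneg _) hq.le

theorem pochRatio_mul {a q y : ℂ} (hq : ‖q‖ < 1) (ha : ‖a * y‖ < 1) :
    (1 - a * y) * pochRatio a q y = (1 - q * y) * pochRatio a q (q * y) := by
  have h1 : 1 - a * y ≠ 0 := by
    have := mul_pow_ne_one ha hq 0
    rw [pow_zero, mul_one] at this
    exact sub_ne_zero.2 this.symm
  have h2 : qPochInf (a * (q * y)) q ≠ 0 := by
    refine qPochInf_ne_zero_of_norm_lt hq ?_
    rw [mul_left_comm, mul_comm]
    exact norm_mul_lt_one ha hq.le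
  rw [pochRatio, pochRatio, qPochInf_eq_mul (q * y) hq, qPochInf_eq_mul (a * y) hq,
    show a * y * q = a * (q * y) by ring, show q * y * q = q * (q * y) by ring]
  field_simp

/-- The coefficients (a; q)_ν/(q; q)_ν are, up to a constant, the values at q^ν of one analytic
function; the connection formula rests on this interpolation. -/
theorem pochRatio_pow {a q : ℂ} (hq : ‖q‖ < 1) (ha : ‖a‖ < 1) (ν : ℕ) :
    pochRatio a q (q ^ ν) = qPochInf q q / qPochInf a q * qBinom a q ν := by
  have h1 := qPochInf_ne_zero_of_norm_lt hq (norm_mul_lt_one ha (norm_pow_le_one hq ν))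
  have h2 := qPoch_ne_zero (mul_pow_ne_one ha hq) ν
  have h3 := qPoch_ne_zero (mul_pow_ne_one hq hq) ν
  rw [pochRatio, qBinom, qPochInf_eq_qPoch_mul q hq ν, qPochInf_eq_qPoch_mul a hq ν]
  field_simp

theorem pochRatio_ne_zero {a q y : ℂ} (hq : ‖q‖ < 1) (ha : ‖a‖ < 1) (hy : ‖y‖ ≤ 1) :
    pochRatio a q y ≠ 0 :=
  div_ne_zero (qPochInf_ne_zero_of_norm_lt hq (norm_mul_lt_one hq hy))
    (qPochInf_ne_zero_of_norm_lt hq (norm_mul_lt_one ha hy))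

theorem analyticAt_pochRatio {a q y : ℂ} (hq : ‖q‖ < 1) (ha : ‖a‖ < 1) (hy : ‖y‖ ≤ 1) :
    AnalyticAt ℂ (pochRatio a q) y :=
  (analyticAt_qPochInf (analyticAt_const.mul analyticAt_id) analyticAt_const hq).div
    (analyticAt_qPochInf (analyticAt_const.mul analyticAt_id) analyticAt_const hq)
    (qPochInf_ne_zero_of_norm_lt hq (norm_mul_lt_one ha hy))

/-- The function is analytic on the closed unit disc because |a| < 1, so its derivative is bounded
there. This controls difference quotients uniformly, even when a point comes close to a pole q^ν. -/
theorem exists_lipschitz_pochRatio {a q : ℂ} (hq : ‖q‖ < 1) (ha : ‖a‖ < 1) :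
    ∃ C : ℝ, ∀ x y : ℂ, ‖x‖ ≤ 1 → ‖y‖ ≤ 1 →
      ‖pochRatio a q y - pochRatio a q x‖ ≤ C * ‖y - x‖ := by
  have han : ∀ y ∈ Metric.closedBall (0 : ℂ) 1, AnalyticAt ℂ (pochRatio a q) y := fun y hy =>
    analyticAt_pochRatio hq ha (by simpa using hy)
  have hcont : ContinuousOn (deriv (pochRatio a q)) (Metric.closedBall 0 1) := fun y hy =>
    (han y hy).deriv.continuousAt.continuousWithinAt
  obtain ⟨C, hC⟩ := (isCompact_closedBall (0 : ℂ) 1).exists_bound_of_continuousOn hcont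
  refine ⟨C, fun x y hx hy => ?_⟩
  exact (convex_closedBall (0 : ℂ) 1).norm_image_sub_le_of_norm_deriv_le
    (fun z hz => (han z hz).differentiableAt) hC (by simpa using hx) (by simpa using hy)

/-- The bilateral series `∑_{ν ∈ ℤ} (v q)^ν / (q^ν - x)`, split at `ν = 0`. -/
noncomputable def bilateral (q v x : ℂ) : ℂ :=
  ∑' ν : ℕ, (v * q) ^ ν / (q ^ ν - x) + ∑' k : ℕ, v⁻¹ ^ (k + 1) / (1 - x * q ^ (k + 1))

/-- The series `∑_{ν ≥ 0} (q^{ν+1}; q)_∞ / (a q^ν; q)_∞ (v q)^ν / (q^ν - x)`. -/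
noncomputable def unilateral (q a v x : ℂ) : ℂ :=
  ∑' ν : ℕ, pochRatio a q (q ^ ν) * (v * q) ^ ν / (q ^ ν - x)

/-- The series `∑_r (q / (a v); q)_r / (q / v; q)_r (a x)^r`. -/
noncomputable def regularSeries (q a v x : ℂ) : ℂ :=
  ∑' r : ℕ, qPoch (a⁻¹ * v⁻¹ * q) q r / qPoch (v⁻¹ * q) q r * (a * x) ^ r

section Connection

variable {q a v : ℂ}

theorem exists_norm_inv_pow_sub_le (hq : ‖q‖ < 1) {x : ℂ} (hx : x ≠ 0) :
    ∃ c : ℝ, 0 < c ∧ ∀ ν : ℕ, ‖(q ^ ν - x)⁻¹‖ ≤ c := by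
  have h1 : Tendsto (fun ν : ℕ => (q ^ ν - x)⁻¹) atTop (𝓝 (0 - x)⁻¹) :=
    ((tendsto_pow_atTop_nhds_zero_of_norm_lt_one hq).sub_const x).inv₀ (by simpa using hx)
  obtain ⟨C, hC⟩ := h1.norm.bddAbove_range
  exact ⟨max C 1, by positivity, fun n => (hC ⟨n, rfl⟩).trans (le_max_left _ _)⟩

theorem summable_bilateral_nonneg (hq : ‖q‖ < 1) (hvq : ‖v * q‖ < 1) {x : ℂ} (hx : x ≠ 0) :
    Summable fun ν : ℕ => (v * q) ^ ν / (q ^ ν - x) := by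
  obtain ⟨c, -, hc⟩ := exists_norm_inv_pow_sub_le hq hx
  refine Summable.of_norm_bounded ((summable_geometric_of_lt_one (norm_nonneg _) hvq).mul_right c)
    fun ν => ?_
  rw [div_eq_mul_inv, norm_mul, norm_pow]
  gcongr
  exact hc ν

theorem summable_unilateral (hq : ‖q‖ < 1) (ha : ‖a‖ < 1) (hvq : ‖v * q‖ < 1) {x : ℂ}
    (hx : x ≠ 0) : Summable fun ν : ℕ => pochRatio a q (q ^ ν) * (v * q) ^ ν / (q ^ ν - x) := by
  obtain ⟨c, -, hc⟩ := exists_norm_inv_pow_sub_le hq hx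
  refine Summable.of_norm_bounded ((summable_norm_qBinom_mul_pow a hq hvq).mul_left
    (‖qPochInf q q / qPochInf a q‖ * c)) fun ν => ?_
  rw [pochRatio_pow hq ha, div_eq_mul_inv, mul_assoc (qPochInf q q / qPochInf a q), norm_mul,
    norm_mul (qPochInf q q / qPochInf a q)]
  calc _ ≤ ‖qPochInf q q / qPochInf a q‖ * ‖qBinom a q ν * (v * q) ^ ν‖ * c := by
        gcongr; exact hc ν
    _ = _ := by ring

theorem norm_one_sub_inv_le (hq : ‖q‖ < 1) {x : ℂ} (hx : ‖x‖ < 1) (k : ℕ) :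
    ‖(1 - x * q ^ k)⁻¹‖ ≤ (1 - ‖x‖)⁻¹ := by
  rw [norm_inv]
  have h1 : ‖x * q ^ k‖ ≤ ‖x‖ := by
    rw [norm_mul]
    exact mul_le_of_le_one_right (norm_nonneg _) (norm_pow_le_one hq k)
  have h2 : 1 - ‖x * q ^ k‖ ≤ ‖1 - x * q ^ k‖ := by
    simpa using norm_sub_norm_le 1 (x * q ^ k)
  exact inv_anti₀ (by linarith) (by linarith)

theorem norm_bilateral_neg_term_le (hq : ‖q‖ < 1) {x : ℂ} (hx : ‖x‖ < 1) (k : ℕ) :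
    ‖v⁻¹ ^ (k + 1) / (1 - x * q ^ (k + 1))‖ ≤ ‖v⁻¹‖ ^ (k + 1) * (1 - ‖x‖)⁻¹ := by
  rw [div_eq_mul_inv, norm_mul, norm_pow]
  gcongr
  exact norm_one_sub_inv_le hq hx _

theorem norm_inv_lt_one (hv : 1 < ‖v‖) : ‖v⁻¹‖ < 1 := by
  rw [norm_inv]
  exact inv_lt_one_of_one_lt₀ hv

theorem summable_geometric_succ (hv : 1 < ‖v‖) (c : ℝ) :
    Summable fun k : ℕ => ‖v⁻¹‖ ^ (k + 1) * c :=
  (((summable_nat_add_iff 1).2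
    (summable_geometric_of_lt_one (norm_nonneg _) (norm_inv_lt_one hv)))).mul_right c

theorem summable_bilateral_neg (hq : ‖q‖ < 1) (hv : 1 < ‖v‖) {x : ℂ} (hx : ‖x‖ < 1) :
    Summable fun k : ℕ => v⁻¹ ^ (k + 1) / (1 - x * q ^ (k + 1)) :=
  Summable.of_norm_bounded (summable_geometric_succ hv _)
    fun k => norm_bilateral_neg_term_le hq hx k

/-- This is a shift of the index by one; the term 1/(1 - qx) crosses from one half of the split sum
to the other. -/
theorem bilateral_mul (hq0 : q ≠ 0) (hq : ‖q‖ < 1) (hv : 1 < ‖v‖) (hvq : ‖v * q‖ < 1) {x : ℂ}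
    (hx0 : x ≠ 0) (hx : ‖x‖ < 1) : bilateral q v (q * x) = v * bilateral q v x := by
  have hv0 : v ≠ 0 := norm_pos_iff.1 (one_pos.trans hv)
  have hqx : ‖q * x‖ < 1 := norm_mul_lt_one hq hx.le
  rw [bilateral, bilateral, (summable_bilateral_nonneg hq hvq (mul_ne_zero hq0 hx0)).tsum_eq_zero_add,
    (summable_bilateral_neg hq hv hx).tsum_eq_zero_add, mul_add, mul_add, ← tsum_mul_left,
    ← tsum_mul_left]
  have e1 : ∀ ν : ℕ, (v * q) ^ (ν + 1) / (q ^ (ν + 1) - q * x) = v * ((v * q) ^ ν / (q ^ ν - x)) := by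
    intro ν
    rw [pow_succ', pow_succ', ← mul_sub, mul_assoc v q, mul_left_comm v q, mul_div_mul_left _ _ hq0,
      mul_div_assoc]
  have e2 : ∀ k : ℕ, v * (v⁻¹ ^ (k + 1 + 1) / (1 - x * q ^ (k + 1 + 1))) =
      v⁻¹ ^ (k + 1) / (1 - q * x * q ^ (k + 1)) := by
    intro k
    rw [pow_succ' v⁻¹, pow_succ' q (k + 1), ← mul_div_assoc, ← mul_assoc v, mul_inv_cancel₀ hv0,
      one_mul, ← mul_assoc x, mul_comm x q]
  rw [tsum_congr e1, tsum_congr e2]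
  have e3 : v * (v⁻¹ ^ (0 + 1) / (1 - x * q ^ (0 + 1))) = 1 / (1 - q * x) := by
    rw [zero_add, pow_one, pow_one, ← mul_div_assoc, mul_inv_cancel₀ hv0, mul_comm x]
  rw [e3, pow_zero, pow_zero]
  ring

/-- Write 1 - aq^ν = (1 - ax) - a(q^ν - x) and 1 - q^ν = (1 - qx) - (q^ν - qx). The parts without a
denominator are q-binomial series, and the remaining sums match by the functional equation of
`pochRatio`. -/
theorem unilateral_mul (hq0 : q ≠ 0) (hq : ‖q‖ < 1) (ha : ‖a‖ < 1) (hv0 : v ≠ 0)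
    (hvq : ‖v * q‖ < 1) {x : ℂ} (hx0 : x ≠ 0) (hx : ∀ ν : ℕ, q ^ ν ≠ x)
    (hx' : ∀ ν : ℕ, q ^ ν ≠ q * x) :
    (1 - a * x) * unilateral q a v x - v⁻¹ * (1 - q * x) * unilateral q a v (q * x) =
      (a - v⁻¹) * (qPochInf q q / qPochInf a q *
        (qPochInf (a * (v * q)) q / qPochInf (v * q) q)) := by
  set h := pochRatio a q with hh
  have hs := summable_unilateral hq ha hvq hx0
  have hs' := summable_unilateral hq ha hvq (mul_ne_zero hq0 hx0)
  have hK : HasSum (fun ν : ℕ => h (q ^ ν) * (v * q) ^ ν) (qPochInf q q / qPochInf a q *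
        (qPochInf (a * (v * q)) q / qPochInf (v * q) q)) := by
    rw [← tsum_qBinom_mul_pow a hq hvq]
    refine ((summable_norm_qBinom_mul_pow a hq hvq).of_norm.hasSum.mul_left _).congr_fun fun ν => ?_
    rw [hh, pochRatio_pow hq ha, mul_assoc]
  set K := qPochInf q q / qPochInf a q * (qPochInf (a * (v * q)) q / qPochInf (v * q) q)
  have e1 : HasSum (fun ν : ℕ => (1 - a * q ^ ν) * h (q ^ ν) * (v * q) ^ ν / (q ^ ν - x))
      ((1 - a * x) * unilateral q a v x - a * K) := by
    refine ((hs.hasSum.mul_left (1 - a * x)).sub (hK.mul_left a)).congr_fun fun ν => ?_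
    have := sub_ne_zero.2 (hx ν)
    field_simp
    ring
  have e2 : HasSum (fun ν : ℕ => v⁻¹ * ((1 - q ^ ν) * h (q ^ ν) * (v * q) ^ ν / (q ^ ν - q * x)))
      (v⁻¹ * ((1 - q * x) * unilateral q a v (q * x) - K)) := by
    refine (((hs'.hasSum.mul_left (1 - q * x)).sub hK).mul_left v⁻¹).congr_fun fun ν => ?_
    have := sub_ne_zero.2 (hx' ν)
    field_simp
    ring
  -- The term ν = 0 vanishes through the factor 1 - q^0, so the index can be shifted without loss.
  have e3 := (hasSum_nat_add_iff' 1).2 e2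
  rw [Finset.sum_range_one, pow_zero, sub_self, zero_mul, zero_mul, zero_div, mul_zero,
    sub_zero] at e3
  have e4 := e1.unique (e3.congr_fun fun ν => by
    have := pochRatio_mul (y := q ^ ν) hq (norm_mul_lt_one ha (norm_pow_le_one hq ν))
    rw [← hh, ← pow_succ'] at this
    rw [this, pow_succ' (v * q), pow_succ' q ν, ← mul_sub, mul_left_comm _ (v * q),
      mul_assoc v q, mul_div_assoc v, mul_div_mul_left _ _ hq0, ← mul_assoc v⁻¹,
      inv_mul_cancel₀ hv0, one_mul])
  linear_combination e4

theorem inv_mul_pow_ne_one (hq : ‖q‖ < 1) (hv : 1 < ‖v‖) (i : ℕ) : v⁻¹ * q * q ^ i ≠ 1 :=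
  mul_pow_ne_one (norm_mul_lt_one (norm_inv_lt_one hv) hq.le) hq i

theorem summable_norm_regularSeries (hq : ‖q‖ < 1) (hv : 1 < ‖v‖) {x : ℂ} (hx : ‖a * x‖ < 1) :
    Summable fun r : ℕ =>
      ‖qPoch (a⁻¹ * v⁻¹ * q) q r / qPoch (v⁻¹ * q) q r * (a * x) ^ r‖ := by
  obtain ⟨C, -, hC⟩ := exists_norm_qPoch_div_le (a⁻¹ * v⁻¹ * q) hq (inv_mul_pow_ne_one hq hv)
  refine Summable.of_nonneg_of_le (fun _ => norm_nonneg _) (fun n => ?_)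
    ((summable_geometric_of_lt_one (norm_nonneg _) hx).mul_left C)
  rw [norm_mul, norm_pow]
  gcongr
  exact hC n

/-- By the recurrence of the coefficients, all powers of x cancel except the constant term. -/
theorem regularSeries_mul (ha0 : a ≠ 0) (hq : ‖q‖ < 1) (hv : 1 < ‖v‖) {x : ℂ} (hx : ‖a * x‖ < 1) :
    (1 - a * x) * regularSeries q a v x - v⁻¹ * (1 - q * x) * regularSeries q a v (q * x) =
      1 - v⁻¹ := by
  have hqx : ‖a * (q * x)‖ < 1 := by
    rw [mul_left_comm, mul_comm]
    exact norm_mul_lt_one hx hq.le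
  have hs := (summable_norm_regularSeries hq hv hx).of_norm
  have hs' := (summable_norm_regularSeries hq hv hqx).of_norm
  set u : ℕ → ℂ := fun r => qPoch (a⁻¹ * v⁻¹ * q) q r / qPoch (v⁻¹ * q) q r with hu
  have hrec : ∀ r, u (r + 1) * (1 - v⁻¹ * q ^ (r + 1)) = u r * (1 - a⁻¹ * v⁻¹ * q ^ (r + 1)) := by
    intro r
    have h2 : 1 - v⁻¹ * q * q ^ r ≠ 0 := sub_ne_zero.2 (inv_mul_pow_ne_one hq hv r).symm
    simp only [hu]
    rw [qPoch_succ, qPoch_succ, pow_succ', mul_div_mul_comm, mul_assoc, ← mul_assoc v⁻¹,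
      div_mul_cancel₀ _ h2, mul_assoc (a⁻¹ * v⁻¹)]
  have e1 : HasSum (fun r => u r * (1 - v⁻¹ * q ^ r) * (a * x) ^ r)
      (regularSeries q a v x - v⁻¹ * regularSeries q a v (q * x)) := by
    refine (hs.hasSum.sub (hs'.hasSum.mul_left v⁻¹)).congr_fun fun r => ?_
    rw [mul_left_comm a q x, mul_pow q]
    ring
  have e2 : HasSum (fun r => u r * (1 - a⁻¹ * v⁻¹ * q ^ (r + 1)) * (a * x) ^ (r + 1))
      (a * x * regularSeries q a v x - v⁻¹ * (q * x) * regularSeries q a v (q * x)) := by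
    refine ((hs.hasSum.mul_left (a * x)).sub (hs'.hasSum.mul_left (v⁻¹ * (q * x)))).congr_fun
      fun r => ?_
    change u r * (1 - a⁻¹ * v⁻¹ * q ^ (r + 1)) * (a * x) ^ (r + 1) =
      a * x * (u r * (a * x) ^ r) - v⁻¹ * (q * x) * (u r * (a * (q * x)) ^ r)
    rw [mul_left_comm a q x, mul_pow q, pow_succ (a * x), pow_succ q]
    linear_combination -(u r * v⁻¹ * q ^ r * q * (a * x) ^ r * x) * inv_mul_cancel₀ ha0
  have e3 := (hasSum_nat_add_iff' 1).2 e1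
  have e4 := e2.unique (e3.congr_fun fun r => by rw [hrec])
  rw [Finset.sum_range_one] at e4
  simp only [hu, qPoch_zero, pow_zero, mul_one, div_one, one_mul] at e4
  linear_combination -e4

/-- The connection formula between the unilateral series at `x` and its expansion at `x = 0`. -/
theorem unilateral_eq (hq0 : q ≠ 0) (hq : ‖q‖ < 1) (ha0 : a ≠ 0) (ha : ‖a‖ < 1) (hv : 1 < ‖v‖)
    (hvq : ‖v * q‖ < 1) {x : ℂ} (hx0 : x ≠ 0) (hx1 : ‖x‖ < 1) (hx : ∀ ν : ℕ, q ^ ν ≠ x) :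
    unilateral q a v x = pochRatio a q x * bilateral q v x +
      qPochInf q q * qPochInf (a * v) q / (qPochInf a q * qPochInf v q) *
        regularSeries q a v x := by
  have hv0 : v ≠ 0 := norm_pos_iff.1 (one_pos.trans hv)
  have hvne : (1 : ℂ) - v ≠ 0 := by
    refine sub_ne_zero.2 fun h => ?_
    rw [← h, norm_one] at hv
    exact lt_irrefl _ hv
  set κ := qPochInf q q * qPochInf (a * v) q / (qPochInf a q * qPochInf v q) with hκ
  have hκK : κ * (1 - v⁻¹) = (a - v⁻¹) * (qPochInf q q / qPochInf a q *
        (qPochInf (a * (v * q)) q / qPochInf (v * q) q)) := by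
    have h1 := qPochInf_ne_zero_of_norm_lt hq ha
    have h2 := qPochInf_ne_zero_of_norm_lt hq hvq
    rw [hκ, qPochInf_eq_mul (a * v) hq, qPochInf_eq_mul v hq, mul_assoc a v q]
    field_simp
    ring
  -- The defect of the formula. The inhomogeneous terms cancel, so D/h is multiplied by v under x ↦
  -- qx. As |v| > 1, boundedness along xq^n forces D = 0.
  set D : ℂ → ℂ := fun x => unilateral q a v x - pochRatio a q x * bilateral q v x -
    κ * regularSeries q a v x with hD
  have hstep : ∀ x : ℂ, x ≠ 0 → ‖x‖ < 1 → (∀ ν : ℕ, q ^ ν ≠ x) →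
      D x / pochRatio a q x = v⁻¹ * (D (q * x) / pochRatio a q (q * x)) := by
    intro x hx0 hx1 hx
    have hx' : ∀ ν : ℕ, q ^ ν ≠ q * x := by
      intro ν hν
      cases ν with
      | zero =>
        rw [pow_zero] at hν
        have := norm_mul_lt_one hq hx1.le
        rw [← hν, norm_one] at this
        exact lt_irrefl _ this
      | succ ν =>
        rw [pow_succ'] at hν
        exact hx ν (mul_left_cancel₀ hq0 hν)
    have hax : ‖a * x‖ < 1 := norm_mul_lt_one ha hx1.le
    have e1 := unilateral_mul hq0 hq ha hv0 hvq hx0 hx hx'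
    have e2 := regularSeries_mul ha0 hq hv hax
    have e3 := bilateral_mul hq0 hq hv hvq hx0 hx1
    have e4 := pochRatio_mul hq hax
    have n1 := pochRatio_ne_zero hq ha hx1.le
    have n2 := pochRatio_ne_zero hq ha (norm_mul_lt_one hq hx1.le).le
    have n3 : 1 - a * x ≠ 0 := by
      refine sub_ne_zero.2 fun h => ?_
      rw [← h, norm_one] at hax
      exact lt_irrefl _ hax
    have e5 : (1 - a * x) * D x = v⁻¹ * (1 - q * x) * D (q * x) := by
      simp only [hD]
      rw [e3]
      have : v⁻¹ * v = 1 := inv_mul_cancel₀ hv0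
      linear_combination e1 - κ * e2 - hκK - bilateral q v x * e4 +
        (1 - q * x) * pochRatio a q (q * x) * bilateral q v x * this
    rw [← mul_div_assoc, div_eq_div_iff n1 n2]
    apply mul_left_cancel₀ n3
    linear_combination pochRatio a q (q * x) * e5 - v⁻¹ * D (q * x) * e4
  have hne : ∀ n : ℕ, (x * q ^ n ≠ 0) ∧ ‖x * q ^ n‖ < 1 ∧ ∀ ν : ℕ, q ^ ν ≠ x * q ^ n := by
    intro n
    refine ⟨mul_ne_zero hx0 (pow_ne_zero _ hq0), norm_mul_lt_one hx1 (norm_pow_le_one hq n), ?_⟩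
    intro ν hν
    rcases le_total n ν with h | h
    · obtain ⟨k, rfl⟩ := Nat.exists_eq_add_of_le h
      rw [add_comm, pow_add] at hν
      exact hx k (mul_right_cancel₀ (pow_ne_zero _ hq0) hν)
    · obtain ⟨k, rfl⟩ := Nat.exists_eq_add_of_le h
      rw [add_comm, pow_add, ← mul_assoc] at hν
      have h1 : (1 : ℂ) = x * q ^ k :=
        mul_right_cancel₀ (pow_ne_zero ν hq0) (by rw [one_mul]; exact hν)
      have := norm_mul_lt_one hx1 (norm_pow_le_one hq k)
      rw [← h1, norm_one] at this
      exact lt_irrefl _ this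
  have hit : ∀ n : ℕ, D x / pochRatio a q x =
      v⁻¹ ^ n * (D (x * q ^ n) / pochRatio a q (x * q ^ n)) := by
    intro n
    induction n with
    | zero => simp
    | succ n ih =>
      obtain ⟨h1, h2, h3⟩ := hne n
      rw [ih, hstep _ h1 h2 h3, pow_succ, mul_assoc, pow_succ, ← mul_assoc x, mul_comm q]
  obtain ⟨C, hC⟩ := exists_lipschitz_pochRatio hq ha
  -- The point xq^n comes close to poles. Subtracting the two series termwise leaves difference
  -- quotients of h, which the Lipschitz bound controls independently of n.
  have hbdd : ∃ M : ℝ, ∀ n : ℕ, ‖D (x * q ^ n)‖ ≤ M := by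
    refine ⟨C * ∑' ν : ℕ, ‖v * q‖ ^ ν + ((C + ‖pochRatio a q 0‖) *
      ∑' k : ℕ, ‖v⁻¹‖ ^ (k + 1) * (1 - ‖x‖)⁻¹) +
      ‖κ‖ * ∑' r : ℕ, ‖qPoch (a⁻¹ * v⁻¹ * q) q r / qPoch (v⁻¹ * q) q r * (a * x) ^ r‖, ?_⟩
    intro n
    obtain ⟨hy0, hy1, hy⟩ := hne n
    have hyx : ‖x * q ^ n‖ ≤ ‖x‖ := by
      rw [norm_mul]
      exact mul_le_of_le_one_right (norm_nonneg _) (norm_pow_le_one hq n)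
    set y := x * q ^ n
    have hC0 : 0 ≤ C := by
      have := (norm_nonneg _).trans (hC 0 1 (by simp) (by simp))
      simpa using this
    have e1 : unilateral q a v y - pochRatio a q y * ∑' ν : ℕ, (v * q) ^ ν / (q ^ ν - y) =
        ∑' ν : ℕ, (pochRatio a q (q ^ ν) - pochRatio a q y) * (v * q) ^ ν / (q ^ ν - y) := by
      rw [unilateral, ← tsum_mul_left, ← (summable_unilateral hq ha hvq hy0).tsum_sub
        ((summable_bilateral_nonneg hq hvq hy0).mul_left _)]
      refine tsum_congr fun ν => ?_
      ring
    have b1 : ‖∑' ν : ℕ, (pochRatio a q (q ^ ν) - pochRatio a q y) * (v * q) ^ ν / (q ^ ν - y)‖ ≤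
        C * ∑' ν : ℕ, ‖v * q‖ ^ ν := by
      rw [← tsum_mul_left]
      refine tsum_of_norm_bounded
        ((summable_geometric_of_lt_one (norm_nonneg _) hvq).mul_left C).hasSum fun ν => ?_
      have h1 := hC y (q ^ ν) hy1.le (norm_pow_le_one hq ν)
      have h2 : 0 < ‖q ^ ν - y‖ := norm_pos_iff.2 (sub_ne_zero.2 (hy ν))
      rw [norm_div, norm_mul, norm_pow, div_le_iff₀ h2]
      calc _ ≤ C * ‖q ^ ν - y‖ * ‖v * q‖ ^ ν := by gcongr
        _ = _ := by ring
    have b2 : ‖pochRatio a q y‖ ≤ C + ‖pochRatio a q 0‖ := by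
      have h1 := hC 0 y (by simp) hy1.le
      rw [sub_zero] at h1
      have h2 := norm_sub_norm_le (pochRatio a q y) (pochRatio a q 0)
      have h3 : C * ‖y‖ ≤ C := mul_le_of_le_one_right hC0 hy1.le
      linarith
    have b3 : ‖∑' k : ℕ, v⁻¹ ^ (k + 1) / (1 - y * q ^ (k + 1))‖ ≤
        ∑' k : ℕ, ‖v⁻¹‖ ^ (k + 1) * (1 - ‖x‖)⁻¹ := by
      refine tsum_of_norm_bounded (summable_geometric_succ hv _).hasSum fun k =>
        (norm_bilateral_neg_term_le hq hy1 k).trans ?_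
      gcongr
    have hay : ‖a * y‖ ≤ ‖a * x‖ := by
      rw [norm_mul a, norm_mul a]
      exact mul_le_mul_of_nonneg_left hyx (norm_nonneg _)
    have b4 : ‖regularSeries q a v y‖ ≤
        ∑' r : ℕ, ‖qPoch (a⁻¹ * v⁻¹ * q) q r / qPoch (v⁻¹ * q) q r * (a * x) ^ r‖ := by
      refine tsum_of_norm_bounded (summable_norm_regularSeries hq hv
        (norm_mul_lt_one ha hx1.le)).hasSum fun r => ?_
      rw [norm_mul _ ((a * y) ^ r), norm_mul _ ((a * x) ^ r), norm_pow, norm_pow]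
      exact mul_le_mul_of_nonneg_left (pow_le_pow_left₀ (norm_nonneg _) hay r) (norm_nonneg _)
    have e2 : D y = (unilateral q a v y - pochRatio a q y * ∑' ν : ℕ, (v * q) ^ ν / (q ^ ν - y)) -
        pochRatio a q y * (∑' k : ℕ, v⁻¹ ^ (k + 1) / (1 - y * q ^ (k + 1))) -
        κ * regularSeries q a v y := by
      simp only [hD, bilateral]
      ring
    rw [e2, e1]
    refine (norm_sub_le _ _).trans (add_le_add ((norm_sub_le _ _).trans (add_le_add b1 ?_)) ?_)
    · rw [norm_mul]
      exact mul_le_mul b2 b3 (norm_nonneg _) ((norm_nonneg _).trans b2)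
    · rw [norm_mul]
      gcongr
  obtain ⟨M, hM⟩ := hbdd
  have hlim : Tendsto (fun n : ℕ => pochRatio a q (x * q ^ n)) atTop (𝓝 (pochRatio a q 0)) := by
    refine (analyticAt_pochRatio hq ha (by simp)).continuousAt.tendsto.comp ?_
    simpa using (tendsto_pow_atTop_nhds_zero_of_norm_lt_one hq).const_mul x
  have hv1 : Tendsto (fun n : ℕ => v⁻¹ ^ n * D (x * q ^ n)) atTop (𝓝 0) := by
    refine squeeze_zero_norm (a := fun n => ‖v⁻¹‖ ^ n * M) (fun n => ?_) ?_
    · rw [norm_mul, norm_pow]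
      gcongr
      exact hM n
    · simpa using (tendsto_pow_atTop_nhds_zero_of_lt_one (norm_nonneg _)
        (norm_inv_lt_one hv)).mul_const M
  have h0 := hv1.div hlim (pochRatio_ne_zero hq ha (by simp))
  rw [zero_div] at h0
  have h1 : D x / pochRatio a q x = 0 := by
    refine tendsto_nhds_unique (tendsto_const_nhds.congr fun n => ?_) h0
    rw [hit n, Pi.div_apply, mul_div_assoc]
  have h2 : D x = 0 := by
    rcases div_eq_zero_iff.1 h1 with h | h
    · exact h
    · exact absurd h (pochRatio_ne_zero hq ha hx1.le)
  simp only [hD] at h2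
  linear_combination h2

end Connection

end PrudentPolygon

open Filter Topology

namespace PrudentPolygon

/-! ### The double sum `T` and the first formula -/

/-- The conditions on `q`, valid in a neighbourhood of `1/2`, under which the `q`-series identities
hold. -/
structure NearHalf (q : ℂ) : Prop where
  ne_zero : q ≠ 0
  norm_lt : ‖q‖ < 1
  num_ne_zero : 1 - q + q ^ 2 ≠ 0
  norm_a_lt : ‖aq q‖ < 1
  one_lt_norm_v : 1 < ‖vq q‖
  norm_vq_lt : ‖vq q * q‖ < 1
  norm_av_lt : ‖aq q * vq q‖ < 1
  norm_x_lt : ‖-(1 - 2 * q) / q ^ 2‖ < 1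

theorem one_sub_ne_zero {q : ℂ} (hq : ‖q‖ < 1) : 1 - q ≠ 0 := by
  refine sub_ne_zero.2 fun h => ?_
  rw [← h, norm_one] at hq
  exact lt_irrefl _ hq

theorem analyticAt_vq {q : ℂ} (hq : 1 - q ≠ 0) : AnalyticAt ℂ vq q := by
  unfold vq
  exact ((analyticAt_const.sub analyticAt_id).add (analyticAt_id.pow 2)).div
    (analyticAt_const.sub analyticAt_id) hq

theorem analyticAt_aq {q : ℂ} (hq : 1 - q + q ^ 2 ≠ 0) : AnalyticAt ℂ aq q := by
  unfold aq
  exact (analyticAt_id.pow 2).div ((analyticAt_const.sub analyticAt_id).add (analyticAt_id.pow 2)) hq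

theorem vq_half : vq (1 / 2) = 3 / 2 := by norm_num [vq]

theorem aq_half : aq (1 / 2) = 1 / 3 := by norm_num [aq]

/-- All conditions are open. At q = 1/2 the values are v = 3/2, a = 1/3, vq = 3/4, av = 1/2 and x =
0. -/
theorem eventually_nearHalf : ∀ᶠ q in 𝓝 (1 / 2 : ℂ), NearHalf q := by
  have hv : ContinuousAt vq (1 / 2) := (analyticAt_vq (by norm_num)).continuousAt
  have ha : ContinuousAt aq (1 / 2) := (analyticAt_aq (by norm_num)).continuousAt
  have hx : ContinuousAt (fun q : ℂ => -(1 - 2 * q) / q ^ 2) (1 / 2) :=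
    ContinuousAt.div (by fun_prop) (by fun_prop) (by norm_num)
  have h0 : ContinuousAt (fun q : ℂ => q) (1 / 2) := continuousAt_id
  have h1 : ContinuousAt (fun q : ℂ => 1 - q + q ^ 2) (1 / 2) := by fun_prop
  have hlt : ∀ f : ℂ → ℂ, ContinuousAt f (1 / 2) → ‖f (1 / 2)‖ < 1 →
      ∀ᶠ q in 𝓝 (1 / 2 : ℂ), ‖f q‖ < 1 := fun f hf h => hf.norm (Iio_mem_nhds h)
  have hgt : ∀ᶠ q in 𝓝 (1 / 2 : ℂ), 1 < ‖vq q‖ :=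
    hv.norm (Ioi_mem_nhds (by show 1 < ‖vq (1 / 2)‖; rw [vq_half]; norm_num))
  filter_upwards [h0.eventually_ne (y := 0) (by norm_num), hlt _ h0 (by norm_num),
    h1.eventually_ne (y := 0) (by norm_num), hlt _ ha (by rw [aq_half]; norm_num), hgt,
    hlt (fun q => vq q * q) (hv.mul h0) (by rw [vq_half]; norm_num),
    hlt (fun q => aq q * vq q) (ha.mul hv) (by rw [vq_half, aq_half]; norm_num),
    hlt _ hx (by norm_num)] with q c1 c2 c3 c4 c5 c6 c7 c8
  exact ⟨c1, c2, c3, c4, c5, c6, c7, c8⟩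

theorem qPoch_mul_zpow_neg {x q : ℂ} (hq : q ≠ 0) (hx : x ≠ 0) (j : ℕ) :
    qPoch (x * q ^ (-(j : ℤ))) q j =
      (∏ i ∈ Finset.range j, -(x * (q ^ (i + 1))⁻¹)) * qPoch (q / x) q j := by
  rw [qPoch, qPoch, ← Finset.prod_mul_distrib, ← Finset.prod_range_reflect]
  refine Finset.prod_congr rfl fun i hi => ?_
  have hi' := Finset.mem_range.1 hi
  obtain ⟨k, rfl⟩ := Nat.exists_eq_add_of_lt hi'
  rw [zpow_neg, zpow_natCast, show i + k + 1 - 1 - i = k by omega]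
  have h1 := pow_ne_zero k hq
  have h2 := pow_ne_zero i hq
  rw [show i + k + 1 = k + (i + 1) by ring, pow_add, pow_succ]
  field_simp
  ring

/-- Reverse the product and use 1 - aq^{-k} = -aq^{-k}(1 - q^k/a); in the quotient the powers of q
cancel and a^j remains. -/
theorem qPoch_zpow_neg_div {a q : ℂ} (hq : q ≠ 0) (ha : a ≠ 0) (j : ℕ) :
    qPoch (a * q ^ (-(j : ℤ))) q j / qPoch (q ^ (-(j : ℤ))) q j = a ^ j * qBinom (q / a) q j := by
  have h1 := qPoch_mul_zpow_neg hq one_ne_zero j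
  rw [one_mul, div_one] at h1
  rw [qPoch_mul_zpow_neg hq ha, h1, qBinom, mul_div_mul_comm, ← Finset.prod_div_distrib]
  congr 1
  rw [Finset.prod_congr rfl (g := fun _ => a), Finset.prod_const, Finset.card_range]
  intro i _
  have := pow_ne_zero (i + 1) hq
  field_simp

theorem Tterm_eq {q : ℂ} (hq : q ≠ 0) (ha : aq q ≠ 0) (j ν : ℕ) :
    Tterm q j ν = qBinom (q / aq q) q j * (aq q * q ^ ν) ^ j *
      ((vq q * q) ^ ν / (1 - 2 * q + q ^ (ν + 2))) := by
  rw [Tterm, qPoch_zpow_neg_div hq ha, mul_pow, mul_pow, ← pow_mul, add_mul, one_mul, pow_add,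
    mul_comm j ν]
  ring

namespace NearHalf

variable {q : ℂ}

theorem one_sub_ne (hn : NearHalf q) : 1 - q ≠ 0 := one_sub_ne_zero hn.norm_lt

theorem a_ne_zero (hn : NearHalf q) : aq q ≠ 0 := div_ne_zero (pow_ne_zero _ hn.ne_zero) hn.num_ne_zero

theorem pole_eq (hn : NearHalf q) (ν : ℕ) : 1 - 2 * q + q ^ (ν + 2) = q ^ 2 * (q ^ ν - -(1 - 2 * q) / q ^ 2) := by
  have := hn.ne_zero
  field_simp
  ring

theorem x_ne (hn : NearHalf q) (hp : ∀ ν : ℕ, 1 ≤ ν → 1 - 2 * q + q ^ (ν + 2) ≠ 0) (ν : ℕ) :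
    q ^ ν ≠ -(1 - 2 * q) / q ^ 2 := by
  intro h
  have h1 := hn.pole_eq ν
  rw [h, sub_self, mul_zero] at h1
  rcases Nat.eq_zero_or_pos ν with rfl | h0
  · have h2 : (1 - q) ^ 2 = 0 := by rw [← h1]; ring
    exact hn.one_sub_ne (pow_eq_zero_iff (two_ne_zero) |>.1 h2)
  · exact hp ν h0 h1

theorem norm_a_mul_pow_lt (hn : NearHalf q) (ν : ℕ) : ‖aq q * q ^ ν‖ < 1 :=
  norm_mul_lt_one hn.norm_a_lt (norm_pow_le_one hn.norm_lt ν)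

theorem summable_Tterm (hn : NearHalf q) (ht : 1 - 2 * q ≠ 0) :
    Summable fun x : ℕ × ℕ => Tterm q x.1 (x.2 + 1) := by
  obtain ⟨c, -, hc⟩ := exists_norm_inv_pole_le hn.norm_lt ht
  have h1 := summable_norm_qBinom_mul_pow (q / aq q) hn.norm_lt hn.norm_a_lt
  have h2 : Summable fun n : ℕ => ‖vq q * q‖ ^ (n + 1) * c :=
    ((summable_nat_add_iff 1).2
      (summable_geometric_of_lt_one (norm_nonneg _) hn.norm_vq_lt)).mul_right c
  refine Summable.of_norm_bounded (h1.mul_of_nonneg h2 (fun _ => norm_nonneg _) fun n => ?_) ?_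
  · have := (norm_nonneg _).trans (hc 0)
    positivity
  · rintro ⟨j, n⟩
    dsimp only
    rw [Tterm_eq hn.ne_zero hn.a_ne_zero, norm_mul, div_eq_mul_inv (_ ^ (n + 1)),
      norm_mul (_ ^ (n + 1)), norm_pow (vq q * q), norm_mul (qBinom _ _ _),
      norm_mul (qBinom _ _ _), norm_pow _ j, norm_pow _ j, norm_mul (aq q)]
    have h3 := hc (n + 1)
    have h4 : ‖aq q‖ * ‖q ^ (n + 1)‖ ≤ ‖aq q‖ :=
      mul_le_of_le_one_right (norm_nonneg _) (norm_pow_le_one hn.norm_lt _)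
    gcongr

/-- The double sum in terms of the unilateral series. -/
theorem T_eq_unilateral (hn : NearHalf q) (ht : 1 - 2 * q ≠ 0) :
    T q = (q ^ 2)⁻¹ * (unilateral q (aq q) (vq q) (-(1 - 2 * q) / q ^ 2) -
      qPochInf q q / qPochInf (aq q) q / (1 - -(1 - 2 * q) / q ^ 2)) := by
  have hx0 : -(1 - 2 * q) / q ^ 2 ≠ 0 := div_ne_zero (neg_ne_zero.2 ht) (pow_ne_zero _ hn.ne_zero)
  have hs := summable_unilateral hn.norm_lt hn.norm_a_lt hn.norm_vq_lt hx0
  have h1 : pochRatio (aq q) q 1 = qPochInf q q / qPochInf (aq q) q := by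
    rw [pochRatio, mul_one, mul_one]
  -- The sum over j is a q-binomial series with argument aq^ν and equals h(q^ν). As T starts at ν =
  -- 1, the term of index 0, h(1)/(1 - x), has to be subtracted.
  have h2 : ∀ n : ℕ, ∑' j, Tterm q j (n + 1) = (q ^ 2)⁻¹ * (pochRatio (aq q) q (q ^ (n + 1)) *
      (vq q * q) ^ (n + 1) / (q ^ (n + 1) - -(1 - 2 * q) / q ^ 2)) := by
    intro n
    rw [tsum_congr fun j => Tterm_eq hn.ne_zero hn.a_ne_zero j (n + 1), tsum_mul_right,
      tsum_qBinom_mul_pow _ hn.norm_lt (hn.norm_a_mul_pow_lt _), hn.pole_eq, pochRatio,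
      ← mul_assoc (q / aq q), div_mul_cancel₀ _ hn.a_ne_zero]
    generalize q ^ (n + 1) - -(1 - 2 * q) / q ^ 2 = y
    rw [div_eq_mul_inv _ (q ^ 2 * y), mul_inv, div_eq_mul_inv _ y]
    ring
  have h3 : T q = ∑' n : ℕ, ∑' j : ℕ, Tterm q j (n + 1) :=
    Summable.tsum_comm (f := fun n j : ℕ => Tterm q j (n + 1)) (hn.summable_Tterm ht).prod_symm
  rw [h3, tsum_congr h2, tsum_mul_left, unilateral,
    hs.tsum_eq_zero_add, pow_zero, pow_zero, h1, mul_one, add_sub_cancel_left]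

theorem unilateral_eq_poleSeries (hn : NearHalf q) :
    unilateral q (aq q) (vq q) (-(1 - 2 * q) / q ^ 2) =
      q ^ 2 * (qPochInf q q / qPochInf (aq q) q * poleSeries q (1 - 2 * q) (aq q) (vq q)) := by
  rw [unilateral, poleSeries, ← tsum_mul_left, ← tsum_mul_left]
  refine tsum_congr fun ν => ?_
  rw [pochRatio_pow hn.norm_lt hn.norm_a_lt, hn.pole_eq, ← mul_div_assoc, ← mul_div_assoc,
    mul_div_mul_left _ _ (pow_ne_zero 2 hn.ne_zero), mul_assoc]

theorem summable_Vterm (hn : NearHalf q) : Summable (Vterm q) := by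
  have h := summable_norm_regularSeries (a := aq q) hn.norm_lt hn.one_lt_norm_v
    (norm_mul_lt_one hn.norm_a_lt hn.norm_x_lt.le)
  refine h.of_norm.congr fun r => ?_
  rw [Vterm]
  congr 2
  rw [div_eq_mul_inv]
  ring

theorem _root_.PrudentPolygon.V_eq (q : ℂ) : V q = -((q ^ 2)⁻¹ * (qPochInf q q / qPochInf (aq q) q /
      (1 - -(1 - 2 * q) / q ^ 2))) + (q ^ 2)⁻¹ *
      (qPochInf q q * qPochInf (aq q * vq q) q / (qPochInf (aq q) q * qPochInf (vq q) q)) *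
        regularSeries q (aq q) (vq q) (-(1 - 2 * q) / q ^ 2) := by
  rw [V, regularSeries]
  congr 1
  · rw [neg_div, sub_neg_eq_add, div_eq_mul_inv (1 - 2 * q), mul_comm (1 - 2 * q)]
    ring
  · congr 1
    refine tsum_congr fun r => ?_
    rw [Vterm, div_eq_mul_inv (-(1 - 2 * q))]
    congr 2
    ring

theorem T_eq_bilateral (hn : NearHalf q) (ht : 1 - 2 * q ≠ 0)
    (hp : ∀ ν : ℕ, 1 ≤ ν → 1 - 2 * q + q ^ (ν + 2) ≠ 0) :
    T q = (q ^ 2)⁻¹ * (pochRatio (aq q) q (-(1 - 2 * q) / q ^ 2) *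
      bilateral q (vq q) (-(1 - 2 * q) / q ^ 2)) + V q := by
  have hx0 : -(1 - 2 * q) / q ^ 2 ≠ 0 := div_ne_zero (neg_ne_zero.2 ht) (pow_ne_zero _ hn.ne_zero)
  rw [hn.T_eq_unilateral ht, unilateral_eq hn.ne_zero hn.norm_lt hn.a_ne_zero hn.norm_a_lt
    hn.one_lt_norm_v hn.norm_vq_lt hx0 hn.norm_x_lt (hn.x_ne hp), V_eq]
  ring

theorem representation_eq (hn : NearHalf q) (ht : 1 - 2 * q ≠ 0) :
    Dq q - q ^ 2 * Aq q *
      (qPochInf (aq q) q * qPochInf (vq q) q / (qPochInf q q * qPochInf (aq q * vq q) q)) * T q =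
    Cq q - q ^ 2 * Aq q * (qPochInf (vq q) q / qPochInf (aq q * vq q) q) *
      poleSeries q (1 - 2 * q) (aq q) (vq q) := by
  have h1 := qPochInf_ne_zero_of_norm_lt hn.norm_lt hn.norm_a_lt
  have h2 := qPochInf_ne_zero_of_norm_lt hn.norm_lt hn.norm_lt
  have h3 := qPochInf_ne_zero_of_norm_lt hn.norm_lt hn.norm_av_lt
  have h4 := hn.ne_zero
  have h5 := hn.one_sub_ne
  have h6 : 1 - -(1 - 2 * q) / q ^ 2 = (1 - q) ^ 2 / q ^ 2 := by
    field_simp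
    ring
  rw [hn.T_eq_unilateral ht, hn.unilateral_eq_poleSeries, Dq, h6]
  field_simp
  ring

end NearHalf

theorem ofReal_ratioProd (q t w : ℝ) (m : ℕ) :
    ((ratioProd q t w m : ℝ) : ℂ) = ratioProd (q : ℂ) t w m := by
  simp [ratioProd]

theorem ofReal_pole_ne_zero {q : ℝ} (h0 : 0 < q) (h1 : q < 1 / 2) (ν : ℕ) :
    (1 : ℂ) - 2 * q + (q : ℂ) ^ ν ≠ 0 := by
  have : (0 : ℝ) < 1 - 2 * q + q ^ ν := by
    have := pow_pos h0 ν
    linarith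
  exact_mod_cast this.ne'

theorem ofReal_num_ne_zero (q : ℝ) : (1 : ℂ) - q + (q : ℂ) ^ 2 ≠ 0 := by
  have : (0 : ℝ) < 1 - q + q ^ 2 := by nlinarith [sq_nonneg (2 * q - 1)]
  exact_mod_cast this.ne'

theorem hasSum_PAcoeff_ratioProd {q : ℝ} (h0 : 0 < q) (h1 : q < 1 / 2) :
    (∀ n, (threeSidedPolygons n).Finite) ∧
    HasSum (fun n => (PAcoeff n : ℂ) * (q : ℂ) ^ n)
      (2 * (q / (1 - q) + q / (1 - 2 * q) + (1 - q) * q * ((1 - 2 * (q : ℂ))⁻¹ *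
        ((1 - q / (1 - q : ℂ))⁻¹ - (q : ℂ) ^ 2 *
          (qPochInf (q / (1 - q) * (1 - q + (q : ℂ) ^ 2) / q) q / qPochInf (q / (1 - q)) q) *
          poleSeries q (1 - 2 * q) ((q : ℂ) ^ 2 / (1 - q + (q : ℂ) ^ 2))
            (q / (1 - q) * (1 - q + (q : ℂ) ^ 2) / q))))) := by
  have ht : (1 : ℂ) - 2 * q ≠ 0 := by
    have : (0 : ℝ) < 1 - 2 * q := by linarith
    exact_mod_cast this.ne'
  have hz : ‖(q : ℂ) / (1 - q)‖ < 1 := by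
    have : (q : ℂ) / (1 - q) = ((q / (1 - q) : ℝ) : ℂ) := by push_cast; rfl
    rw [this, Complex.norm_real, Real.norm_of_nonneg (div_nonneg h0.le (by linarith)),
      div_lt_one (by linarith)]
    linarith
  have hzw : ‖(q : ℂ) / (1 - q) * (1 - q + (q : ℂ) ^ 2)‖ < 1 := by
    refine norm_mul_lt_one hz ?_
    have : (1 : ℂ) - q + (q : ℂ) ^ 2 = ((1 - q + q ^ 2 : ℝ) : ℂ) := by push_cast; rfl
    rw [this, Complex.norm_real, Real.norm_of_nonneg (by nlinarith)]
    nlinarith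
  have hB := (hasSum_ratioProd (t := 1 - 2 * (q : ℂ)) (Complex.ofReal_ne_zero.2 h0.ne')
    (ofReal_num_ne_zero q) (by rw [Complex.norm_real, Real.norm_of_nonneg h0.le]; linarith) hz hzw
    ht fun ν => ofReal_pole_ne_zero h0 h1 (ν + 2)).mul_left ((1 - (q : ℂ)) * q)
  set B := (1 - (q : ℂ)) * q * _
  have hcast : (fun m => (((1 - q) * q * ((q / (1 - q)) ^ m *
      ratioProd q (1 - 2 * q) (1 - q + q ^ 2) m) : ℝ) : ℂ)) = fun m => (1 - (q : ℂ)) * q *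
      ((q / (1 - q) : ℂ) ^ m * ratioProd (q : ℂ) (1 - 2 * q) (1 - q + (q : ℂ) ^ 2) m) := by
    funext m
    push_cast [ofReal_ratioProd]
    rfl
  rw [← hcast] at hB
  have hB' := (Complex.summable_ofReal.1 hB.summable).hasSum
  obtain ⟨h2, h3⟩ := hasSum_PAcoeff h0 h1 hB'
  refine ⟨h2, ?_⟩
  have h4 := Complex.hasSum_ofReal.2 hB'
  rw [← h4.unique hB]
  have h5 := Complex.hasSum_ofReal.2 h3
  push_cast at h5 ⊢
  exact h5

/-- The first formula for real `q`. -/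
theorem hasSum_PAcoeff_representation {q : ℝ} (h0 : 0 < q) (h1 : q < 1 / 2)
    (hn : NearHalf (q : ℂ)) :
    HasSum (fun n => (PAcoeff n : ℂ) * (q : ℂ) ^ n)
      (Dq q - (q : ℂ) ^ 2 * Aq q * (qPochInf (aq q) q * qPochInf (vq q) q /
        (qPochInf q q * qPochInf (aq q * vq q) q)) * T q) := by
  have ht : (1 : ℂ) - 2 * q ≠ 0 := by
    have : (0 : ℝ) < 1 - 2 * q := by linarith
    exact_mod_cast this.ne'
  rw [hn.representation_eq ht]
  convert (hasSum_PAcoeff_ratioProd h0 h1).2 using 1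
  have h2 := hn.ne_zero
  have h3 := hn.one_sub_ne
  have e1 : (q : ℂ) / (1 - q) * (1 - q + (q : ℂ) ^ 2) / q = vq q := by
    rw [vq]
    field_simp
  have e2 : (q : ℂ) ^ 2 / (1 - q + (q : ℂ) ^ 2) = aq q := rfl
  -- With z = q/(1 - q) one has zq = av, so removing one factor from (z; q)_∞ leaves (av; q)_∞. What
  -- remains is an identity of rational functions, and it determines C.
  have e3 : qPochInf ((q : ℂ) / (1 - q)) q = (1 - (q : ℂ) / (1 - q)) * qPochInf (aq q * vq q) q := by
    have h4 := hn.num_ne_zero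
    rw [qPochInf_eq_mul _ hn.norm_lt, aq, vq]
    congr 2
    field_simp
  have e4 : 1 - (q : ℂ) / (1 - q) = (1 - 2 * q) / (1 - q) := by
    field_simp
    ring
  have h4 := qPochInf_ne_zero_of_norm_lt hn.norm_lt hn.norm_av_lt
  rw [e1, e2, e3, e4, Cq, Aq]
  field_simp
  ring

end PrudentPolygon

open Filter Topology

namespace PrudentPolygon

/-! ### The Fourier series and Poisson summation -/

open MeasureTheory Real in
/-- The Mellin-type integral behind the Fourier coefficients. -/
theorem integral_exp_div_one_add_exp {c : ℂ} (h0 : 0 < c.re) (h1 : c.re < 1) :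
    ∫ y : ℝ, Complex.exp (c * y) / (1 + Complex.exp y) = Real.pi / Complex.sin (Real.pi * c) := by
  have h2 : 0 < (1 - c).re := by simpa using h1
  have e1 : Complex.betaIntegral c (1 - c) = Real.pi / Complex.sin (Real.pi * c) := by
    have := Complex.Gamma_mul_Gamma_eq_betaIntegral h0 h2
    rw [add_sub_cancel, Complex.Gamma_one, one_mul] at this
    rw [← this, Complex.Gamma_mul_Gamma_one_sub]
  -- The substitution x = e^y/(1 + e^y) turns the Beta integral B(c, 1 - c) into the claimed one.
  have e2 := integral_image_eq_integral_abs_deriv_smul (s := Set.univ) MeasurableSet.univ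
    (fun x _ => (hasDerivAt_sigmoid x).hasDerivWithinAt) sigmoid_injective.injOn
    (fun x : ℝ => (x : ℂ) ^ (c - 1) * (1 - (x : ℂ)) ^ (1 - c - 1))
  rw [Set.image_univ, range_sigmoid, Measure.restrict_univ] at e2
  rw [← e1, Complex.betaIntegral, intervalIntegral.integral_of_le zero_le_one,
    integral_Ioc_eq_integral_Ioo, e2]
  refine integral_congr_ae (Eventually.of_forall fun y => ?_)
  dsimp only
  have hs := sigmoid_pos y
  have hs' : 0 < 1 - sigmoid y := sub_pos.2 (sigmoid_lt_one y)
  have hE : sigmoid y = Real.exp y * (1 - sigmoid y) := by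
    rw [← sigmoid_neg, ← sigmoid_mul_rexp_neg, mul_comm, mul_assoc, ← Real.exp_add, neg_add_cancel,
      Real.exp_zero, mul_one]
  have hE' : (1 - sigmoid y) * (1 + Real.exp y) = 1 := by linear_combination -hE
  have hc : (1 + Complex.exp y) ≠ 0 := by
    have : (1 + Real.exp y) ≠ 0 := by positivity
    exact_mod_cast this
  rw [abs_of_pos (mul_pos hs hs'), div_eq_iff hc]
  have hne : ((1 - sigmoid y : ℝ) : ℂ) ≠ 0 := Complex.ofReal_ne_zero.2 hs'.ne'
  have hne' : ((sigmoid y : ℝ) : ℂ) ≠ 0 := Complex.ofReal_ne_zero.2 hs.ne'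
  have e3 : ((sigmoid y : ℝ) : ℂ) ^ c = Complex.exp (c * y) * ((1 - sigmoid y : ℝ) : ℂ) ^ c := by
    conv_lhs => rw [hE]
    rw [Complex.ofReal_mul, Complex.mul_cpow_ofReal_nonneg (Real.exp_pos _).le hs'.le,
      Complex.ofReal_exp, Complex.cpow_def_of_ne_zero (Complex.exp_ne_zero _),
      ← Complex.ofReal_exp, ← Complex.ofReal_log (Real.exp_pos _).le, Real.log_exp, mul_comm c]
  have e4 : ((1 - sigmoid y : ℝ) : ℂ) = 1 - (sigmoid y : ℂ) := by push_cast; rfl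
  rw [show 1 - c - 1 = -c by ring, Complex.cpow_sub _ _ hne', Complex.cpow_one, e3, ← e4,
    Complex.cpow_neg, Complex.real_smul, Complex.ofReal_mul]
  have hne2 : ((1 - sigmoid y : ℝ) : ℂ) ^ c ≠ 0 := by
    rw [Complex.cpow_def_of_ne_zero hne]
    exact Complex.exp_ne_zero _
  have hE2 : ((1 - sigmoid y : ℝ) : ℂ) * (1 + Complex.exp y) = 1 := by exact_mod_cast hE'
  field_simp
  linear_combination -hE2

/-- With y = Im z, |sin z| ≥ (e^{|y|} - e^{-|y|})/2, where e^{|y|} ≥ 2 and e^{-|y|} ≤ 1. -/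
theorem exp_le_four_mul_norm_sin {z : ℂ} (hz : 1 ≤ |z.im|) :
    Real.exp |z.im| ≤ 4 * ‖Complex.sin z‖ := by
  have h1 : ‖Complex.sin z‖ = ‖Complex.exp (-z * Complex.I) - Complex.exp (z * Complex.I)‖ / 2 := by
    rw [Complex.sin, norm_div, norm_mul, Complex.norm_I, mul_one]
    simp
  have n1 : ‖Complex.exp (-z * Complex.I)‖ = Real.exp z.im := by
    rw [Complex.norm_exp]; simp
  have n2 : ‖Complex.exp (z * Complex.I)‖ = Real.exp (-z.im) := by
    rw [Complex.norm_exp]; simp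
  have h2 := abs_norm_sub_norm_le (Complex.exp (-z * Complex.I)) (Complex.exp (z * Complex.I))
  rw [n1, n2] at h2
  have h3 : Real.exp |z.im| - Real.exp (-|z.im|) ≤ |Real.exp z.im - Real.exp (-z.im)| := by
    rcases abs_cases z.im with ⟨h, -⟩ | ⟨h, -⟩
    · rw [h]; exact le_abs_self _
    · rw [h, neg_neg]; exact (le_abs_self _).trans_eq (abs_sub_comm _ _)
  have h4 : 2 ≤ Real.exp |z.im| := by
    have := Real.add_one_le_exp |z.im|
    linarith
  have h5 : Real.exp (-|z.im|) ≤ 1 := Real.exp_le_one_iff.2 (by linarith)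
  rw [h1]
  linarith

/-- The imaginary part grows like 2π²R|k|, and the term πγ shifts it by at most π. -/
theorem abs_im_sin_arg {q : ℂ} (hR : 1 ≤ (1 / Complex.log (1 / q)).re)
    (hγ : |(gam q).im| ≤ 1) {k : ℤ} (hk : k ≠ 0) :
    2 * Real.pi ^ 2 * (1 / Complex.log (1 / q)).re * |(k : ℝ)| - Real.pi ≤
      |(Real.pi * gam q + 2 * Complex.I * k * Real.pi ^ 2 / Complex.log (1 / q)).im| ∧
    1 ≤ |(Real.pi * gam q + 2 * Complex.I * k * Real.pi ^ 2 / Complex.log (1 / q)).im| := by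
  set R := (1 / Complex.log (1 / q)).re with hRdef
  have hpi := Real.pi_gt_three
  set z : ℂ := Real.pi * gam q + 2 * Complex.I * k * Real.pi ^ 2 / Complex.log (1 / q) with hz
  have hk1 : (1 : ℝ) ≤ |(k : ℝ)| := by
    have := Int.one_le_abs hk
    exact_mod_cast this
  have hzim : z.im = Real.pi * (gam q).im + 2 * Real.pi ^ 2 * R * k := by
    have : z = Real.pi * gam q +
        Complex.I * ((2 * k * Real.pi ^ 2 : ℝ) * (1 / Complex.log (1 / q))) := by
      rw [hz]; push_cast; ring
    rw [this, Complex.add_im, Complex.im_ofReal_mul, Complex.I_mul_im, Complex.re_ofReal_mul]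
    ring
  have hzabs : 2 * Real.pi ^ 2 * R * |(k : ℝ)| - Real.pi ≤ |z.im| := by
    have h1 : |2 * Real.pi ^ 2 * R * k| = 2 * Real.pi ^ 2 * R * |(k : ℝ)| := by
      rw [abs_mul, abs_of_nonneg (by positivity)]
    have h2 : |Real.pi * (gam q).im| ≤ Real.pi := by
      rw [abs_mul, abs_of_pos Real.pi_pos]
      exact mul_le_of_le_one_right Real.pi_pos.le hγ
    have h3 := abs_sub_abs_le_abs_sub (2 * Real.pi ^ 2 * R * k) (-(Real.pi * (gam q).im))
    rw [abs_neg, h1, sub_neg_eq_add, add_comm (2 * Real.pi ^ 2 * R * (k : ℝ)), ← hzim] at h3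
    linarith
  refine ⟨hzabs, ?_⟩
  have h1 : Real.pi ^ 2 ≤ Real.pi ^ 2 * (R * |(k : ℝ)|) :=
    le_mul_of_one_le_right (by positivity) (one_le_mul_of_one_le_of_one_le hR hk1)
  nlinarith

/-- Geometric decay of the terms of the Fourier series. -/
theorem norm_fourierTerm_le {q u : ℂ} (hR : 1 ≤ (1 / Complex.log (1 / q)).re)
    (hγ : |(gam q).im| ≤ 1)
    (hu : |u.im| ≤ Real.pi * (1 / Complex.log (1 / q)).re - 1 / 2) {k : ℤ} (hk : k ≠ 0) :
    ‖fourierTerm q u k‖ ≤ 4 * Real.pi * Real.exp Real.pi * Real.exp (-Real.pi) ^ k.natAbs := by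
  obtain ⟨hzabs, hz1⟩ := abs_im_sin_arg hR hγ hk
  set R := (1 / Complex.log (1 / q)).re
  set z : ℂ := Real.pi * gam q + 2 * Complex.I * k * Real.pi ^ 2 / Complex.log (1 / q) with hz
  have hsin := exp_le_four_mul_norm_sin hz1
  have hexp : ‖Complex.exp (-2 * Complex.I * k * Real.pi * u)‖ ≤
      Real.exp (2 * Real.pi * |(k : ℝ)| * |u.im|) := by
    have : -2 * Complex.I * k * Real.pi * u = Complex.I * ((-2 * k * Real.pi : ℝ) * u) := by
      push_cast; ring
    rw [Complex.norm_exp, this, Complex.I_mul_re, Complex.im_ofReal_mul]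
    refine Real.exp_le_exp.2 ?_
    have h1 := le_abs_self (k * u.im)
    rw [abs_mul] at h1
    nlinarith [mul_le_mul_of_nonneg_left h1 Real.two_pi_pos.le]
  have hp : ‖pcoeff q k‖ ≤ 4 * Real.pi * Real.exp (-|z.im|) := by
    rw [pcoeff, ← hz, norm_div, Complex.norm_real, Real.norm_of_nonneg Real.pi_pos.le, Real.exp_neg,
      ← div_eq_mul_inv]
    have h0 := Real.exp_pos |z.im|
    rw [div_le_div_iff₀ (by linarith) h0]
    nlinarith [Real.pi_pos]
  rw [fourierTerm, norm_mul]
  calc _ ≤ 4 * Real.pi * Real.exp (-|z.im|) * Real.exp (2 * Real.pi * |(k : ℝ)| * |u.im|) := by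
        gcongr
    _ = 4 * Real.pi * Real.exp (-|z.im| + 2 * Real.pi * |(k : ℝ)| * |u.im|) := by
        rw [Real.exp_add, mul_assoc]
    _ ≤ 4 * Real.pi * Real.exp (Real.pi + k.natAbs * -Real.pi) := by
        have h1 : ((k.natAbs : ℕ) : ℝ) = |(k : ℝ)| := by rw [Nat.cast_natAbs, Int.cast_abs]
        -- The margin 1/2 in the hypothesis on Im u is what survives: -(2π²R|k| - π) + 2π|k|(πR -
        -- 1/2) = π - π|k|.
        have h2 : 2 * Real.pi * |(k : ℝ)| * |u.im| ≤
            2 * Real.pi * |(k : ℝ)| * (Real.pi * R - 1 / 2) := by gcongr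
        refine mul_le_mul_of_nonneg_left (Real.exp_le_exp.2 ?_) (by positivity)
        rw [h1]
        linarith
    _ = _ := by rw [Real.exp_add, Real.exp_nat_mul]; ring

theorem norm_exp_div_one_add_exp_le {g : ℝ} (h0 : 0 < g) (h1 : g < 1) (y : ℝ) :
    ‖Complex.exp (g * y) / (1 + Complex.exp y)‖ ≤ Real.exp (-(min g (1 - g)) * |y|) := by
  have e1 : Complex.exp (g * y) / (1 + Complex.exp y) =
      ((Real.exp (g * y) / (1 + Real.exp y) : ℝ) : ℂ) := by push_cast; rfl
  rw [e1, Complex.norm_real, Real.norm_of_nonneg (by positivity), div_le_iff₀ (by positivity),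
    mul_add, mul_one, ← Real.exp_add]
  rcases abs_cases y with ⟨h, hy⟩ | ⟨h, hy⟩
  · have : Real.exp (g * y) ≤ Real.exp (-(min g (1 - g)) * |y| + y) := by
      refine Real.exp_le_exp.2 ?_
      rw [h]
      nlinarith [min_le_right g (1 - g)]
    linarith [Real.exp_pos (-(min g (1 - g)) * |y|)]
  · have : Real.exp (g * y) ≤ Real.exp (-(min g (1 - g)) * |y|) := by
      refine Real.exp_le_exp.2 ?_
      rw [h]
      nlinarith [min_le_left g (1 - g)]
    linarith [Real.exp_pos (-(min g (1 - g)) * |y| + y)]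

open FourierTransform in
/-- Poisson summation for `e^{g L x} / (1 + e^{L x})`. -/
theorem tsum_exp_div_one_add_exp {g L : ℝ} (h0 : 0 < g) (h1 : g < 1) (hL : 0 < L)
    (hS : Summable fun k : ℤ =>
      (Real.pi / Complex.sin (Real.pi * g + 2 * Complex.I * k * Real.pi ^ 2 / L) : ℂ)) (u : ℝ) :
    ∑' n : ℤ, Complex.exp (g * (L * (u + n) : ℝ)) / (1 + Complex.exp ((L * (u + n) : ℝ))) =
      (L : ℂ)⁻¹ * ∑' k : ℤ, Real.pi /
        Complex.sin (Real.pi * g + 2 * Complex.I * k * Real.pi ^ 2 / L) *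
          Complex.exp (-2 * Complex.I * k * Real.pi * u) := by
  set f : ℝ → ℂ := fun x => Complex.exp (g * (L * x : ℝ)) / (1 + Complex.exp ((L * x : ℝ))) with hf
  have hden : ∀ y : ℝ, 1 + Complex.exp y ≠ 0 := fun y => by
    have : (1 + Real.exp y) ≠ 0 := by positivity
    exact_mod_cast this
  have hc : Continuous f := Continuous.div (by fun_prop) (by fun_prop) fun x => hden _
  have hO : f =O[cocompact ℝ] fun x : ℝ => |x| ^ (-2 : ℝ) := by
    set d := min g (1 - g) * L
    have hd : 0 < d := mul_pos (lt_min h0 (by linarith)) hL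
    have h2 : f =O[cocompact ℝ] fun x : ℝ => Real.exp (-d * |x|) := by
      refine Asymptotics.IsBigO.of_bound 1 (Eventually.of_forall fun x => ?_)
      rw [one_mul, Real.norm_of_nonneg (Real.exp_pos _).le]
      refine (norm_exp_div_one_add_exp_le h0 h1 (L * x)).trans (Real.exp_le_exp.2 ?_)
      rw [abs_mul, abs_of_pos hL]
      linarith
    exact h2.trans ((isLittleO_exp_neg_mul_rpow_atTop hd (-2)).isBigO.comp_tendsto
      (tendsto_norm_cocompact_atTop (E := ℝ)))
  have hF : ∀ n : ℤ, 𝓕 f n = (L : ℂ)⁻¹ * (Real.pi /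
      Complex.sin (Real.pi * g + 2 * Complex.I * (-n : ℤ) * Real.pi ^ 2 / L)) := by
    intro n
    have hLc : (L : ℂ) ≠ 0 := Complex.ofReal_ne_zero.2 hL.ne'
    -- After the scaling y = Lx, the frequency n shifts the exponent g by -2πin/L. The sign is
    -- undone at the end by k ↦ -k.
    set c : ℂ := g - 2 * Real.pi * Complex.I * n / L with hcdef
    have hre : c.re = g := by
      have : c = g - (2 * Real.pi * n / L : ℝ) * Complex.I := by rw [hcdef]; push_cast; ring
      rw [this, Complex.sub_re, Complex.re_ofReal_mul, Complex.I_re, mul_zero, sub_zero,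
        Complex.ofReal_re]
    set G : ℝ → ℂ := fun y => Complex.exp (c * y) / (1 + Complex.exp y) with hG
    have e1 : 𝓕 f n = ∫ x : ℝ, G (L * x) := by
      rw [Real.fourier_real_eq_integral_exp_smul]
      congr 1
      funext x
      rw [hf, hG, smul_eq_mul]
      dsimp only
      rw [← mul_div_assoc, ← Complex.exp_add]
      congr 2
      rw [hcdef]
      push_cast
      field_simp
      ring
    rw [e1, MeasureTheory.Measure.integral_comp_mul_left G L, hG,
      integral_exp_div_one_add_exp (by rw [hre]; exact h0) (by rw [hre]; exact h1),
      abs_of_pos (inv_pos.2 hL), Complex.real_smul, Complex.ofReal_inv]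
    congr 3
    rw [hcdef]
    push_cast
    ring
  have hS' := ((Equiv.neg ℤ).summable_iff.2 hS).mul_left (L : ℂ)⁻¹
  have hP := Real.tsum_eq_tsum_fourier_of_rpow_decay_of_summable hc one_lt_two hO
    (hS'.congr fun n => (hF n).symm) u
  simp only [hf] at hP
  rw [hP, ← tsum_mul_left, ← (Equiv.neg ℤ).tsum_eq]
  refine tsum_congr fun k => ?_
  rw [Equiv.neg_apply, hF, neg_neg, fourier_coe_apply, mul_assoc]
  congr 3
  push_cast
  ring

end PrudentPolygon

/-! ### The bilateral series as a Fourier series for real `q` -/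

open Filter Topology

namespace PrudentPolygon

theorem summable_pow_natAbs {ρ : ℝ} (h0 : 0 ≤ ρ) (h1 : ρ < 1) :
    Summable fun k : ℤ => ρ ^ k.natAbs := by
  have h := summable_geometric_of_lt_one h0 h1
  refine Summable.of_nat_of_neg ?_ ?_ <;> simpa using h

theorem exp_neg_pi_lt_one : Real.exp (-Real.pi) < 1 :=
  Real.exp_lt_one_iff.2 (neg_lt_zero.2 Real.pi_pos)

theorem summable_fourierTerm {q u : ℂ} (hR : 1 ≤ (1 / Complex.log (1 / q)).re)
    (hγ : |(gam q).im| ≤ 1)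
    (hu : |u.im| ≤ Real.pi * (1 / Complex.log (1 / q)).re - 1 / 2) :
    Summable (fourierTerm q u) := by
  refine Summable.of_norm_bounded_eventually ((summable_pow_natAbs (Real.exp_pos _).le
    exp_neg_pi_lt_one).mul_left (4 * Real.pi * Real.exp Real.pi)) ?_
  filter_upwards [(Set.finite_singleton (0 : ℤ)).compl_mem_cofinite] with k hk
  exact norm_fourierTerm_le hR hγ hu hk

/-- The bilateral series as a Fourier series, for real `q`. -/
theorem bilateral_eq_PiSeries {q : ℝ} (h0 : 0 < q) (h1 : q < 1 / 2) (hn : NearHalf (q : ℂ))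
    (hR : 1 ≤ (1 / Complex.log (1 / (q : ℂ))).re) :
    ((q : ℂ) ^ 2)⁻¹ * bilateral q (vq q) (-(1 - 2 * q) / (q : ℂ) ^ 2) =
      (1 - 2 * (q : ℂ)) ^ (-gam q) *
        PiSeries q (Complex.log (1 - 2 * q) / Complex.log (1 / (q : ℂ))) *
          (vq q * (q : ℂ) ^ (3 * gam q - 2) / Complex.log (1 / (q : ℂ))) := by
  set L : ℝ := Real.log (1 / q) with hL
  set v : ℝ := (1 - q + q ^ 2) / (1 - q) with hv
  set g : ℝ := Real.log v / L with hg
  set t : ℝ := 1 - 2 * q with ht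
  set u : ℝ := Real.log t / L with hu
  have ht0 : 0 < t := by rw [ht]; linarith
  have hv0 : 0 < v := div_pos (by nlinarith) (by linarith)
  have hL0 : 0 < L := Real.log_pos (by rw [lt_div_iff₀ h0]; linarith)
  have cL : Complex.log (1 / (q : ℂ)) = L := by
    rw [hL, Complex.ofReal_log (by positivity)]; push_cast; rfl
  have cv : vq q = v := by rw [hv, vq]; push_cast; rfl
  have cg : gam q = g := by
    rw [gam, cL, cv, ← Complex.ofReal_log hv0.le, ← Complex.ofReal_div]
  have ct : (1 : ℂ) - 2 * q = t := by rw [ht]; push_cast; rfl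
  have clt : Complex.log (t : ℂ) = Real.log t := (Complex.ofReal_log ht0.le).symm
  have hv1 : 1 < v := by
    have := hn.one_lt_norm_v
    rwa [cv, Complex.norm_real, Real.norm_of_nonneg hv0.le] at this
  have hvq : v * q < 1 := by
    have := hn.norm_vq_lt
    rwa [cv, ← Complex.ofReal_mul, Complex.norm_real, Real.norm_of_nonneg (by positivity)] at this
  have eq1 : Real.exp (-L) = q := by
    rw [hL, one_div, Real.log_inv, neg_neg, Real.exp_log h0]
  have ev : Real.exp (g * L) = v := by
    rw [hg, div_mul_cancel₀ _ hL0.ne', Real.exp_log hv0]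
  have et : Real.exp (L * u) = t := by
    rw [hu, mul_div_cancel₀ _ hL0.ne', Real.exp_log ht0]
  -- The strip 0 < g < 1 needed for the integral is the condition 1 < v < 1/q.
  have hg0 : 0 < g := div_pos (Real.log_pos hv1) hL0
  have hg1 : g < 1 := by
    have : Real.exp (g * L + -L) < Real.exp 0 := by
      rw [Real.exp_add, ev, eq1, Real.exp_zero]; exact hvq
    have := Real.exp_lt_exp.1 this
    nlinarith
  have hS : Summable fun k : ℤ =>
      (Real.pi / Complex.sin (Real.pi * g + 2 * Complex.I * k * Real.pi ^ 2 / L) : ℂ) := by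
    refine (summable_fourierTerm (u := 0) hR ?_ ?_).congr fun k => ?_
    · rw [cg, Complex.ofReal_im]; norm_num
    · rw [Complex.zero_im, abs_zero]; nlinarith [Real.pi_gt_three]
    · rw [fourierTerm, pcoeff, cL, cg, mul_zero, Complex.exp_zero, mul_one]
  -- The argument is u + 2 because -x = tq⁻² = e^{L(u+2)}. As Π has period one, the integer shift is
  -- invisible there.
  have hP := tsum_exp_div_one_add_exp hg0 hg1 hL0 hS (u + 2)
  have hPi : PiSeries q (Complex.log (1 - 2 * q) / Complex.log (1 / (q : ℂ))) =
      ∑' k : ℤ, Real.pi / Complex.sin (Real.pi * g + 2 * Complex.I * k * Real.pi ^ 2 / L) *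
          Complex.exp (-2 * Complex.I * k * Real.pi * ((u + 2 : ℝ) : ℂ)) := by
    rw [PiSeries]
    refine tsum_congr fun k => ?_
    rw [fourierTerm, pcoeff, cL, cg, ct, clt]
    congr 1
    refine Complex.exp_eq_exp_iff_exists_int.2 ⟨2 * k, ?_⟩
    rw [hu]
    push_cast
    ring
  rw [← hPi] at hP
  set M : ℂ := Complex.exp (g * (L * (u + 2))) with hM
  have hq0 : (q : ℂ) ≠ 0 := hn.ne_zero
  have hvc0 : (v : ℂ) ≠ 0 := Complex.ofReal_ne_zero.2 hv0.ne'
  set x : ℂ := -(1 - 2 * q) / (q : ℂ) ^ 2 with hx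
  have eqc : Complex.exp (-(L : ℂ)) = q := by exact_mod_cast congrArg Complex.ofReal eq1
  have eqc' : Complex.exp L = (q : ℂ)⁻¹ := by rw [← eqc, Complex.exp_neg, inv_inv]
  have evc : Complex.exp (g * L) = v := by exact_mod_cast congrArg Complex.ofReal ev
  have etc' : Complex.exp (L * u) = t := by exact_mod_cast congrArg Complex.ofReal et
  have hterm : ∀ n : ℤ, Complex.exp (g * (L * (((u + 2 : ℝ)) + n) : ℝ)) /
      (1 + Complex.exp ((L * ((u + 2 : ℝ) + n) : ℝ))) =
      M * ((v : ℂ) ^ n / (1 - x * ((q : ℂ) ^ n)⁻¹)) := by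
    intro n
    rw [← mul_div_assoc]
    congr 1
    · rw [hM, ← evc, ← Complex.exp_int_mul, ← Complex.exp_add]
      congr 1
      push_cast
      ring
    · have : ((L * ((u + 2 : ℝ) + n) : ℝ) : ℂ) = L * u + (2 : ℕ) * L + n * L := by
        push_cast; ring
      rw [this, Complex.exp_add, Complex.exp_add, etc', Complex.exp_int_mul, Complex.exp_nat_mul, eqc',
        hx, ct, inv_zpow]
      ring
  have hb : bilateral q v x = ∑' n : ℤ, (v : ℂ) ^ n / (1 - x * ((q : ℂ) ^ n)⁻¹) := by
    have hx0 : x ≠ 0 := by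
      rw [hx, ct]
      exact div_ne_zero (neg_ne_zero.2 (Complex.ofReal_ne_zero.2 ht0.ne')) (pow_ne_zero _ hq0)
    have e1 : ∀ ν : ℕ, ((v : ℂ) * q) ^ ν / ((q : ℂ) ^ ν - x) =
        (v : ℂ) ^ (ν : ℤ) / (1 - x * ((q : ℂ) ^ (ν : ℤ))⁻¹) := by
      intro ν
      have := pow_ne_zero ν hq0
      rw [zpow_natCast, zpow_natCast, mul_pow, ← mul_div_mul_right _ (1 - x * ((q : ℂ) ^ ν)⁻¹) this,
        sub_mul, one_mul, mul_assoc x, inv_mul_cancel₀ this, mul_one]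
    have e2 : ∀ k : ℕ, (v : ℂ)⁻¹ ^ (k + 1) / (1 - x * (q : ℂ) ^ (k + 1)) =
        (v : ℂ) ^ (-((k : ℤ) + 1)) / (1 - x * ((q : ℂ) ^ (-((k : ℤ) + 1)))⁻¹) := by
      intro k
      rw [zpow_neg, zpow_neg, inv_inv, inv_pow]
      norm_cast
    have s1 := summable_bilateral_nonneg hn.norm_lt hn.norm_vq_lt hx0
    have s2 := summable_bilateral_neg hn.norm_lt hn.one_lt_norm_v hn.norm_x_lt
    rw [cv] at s1 s2
    rw [bilateral, tsum_of_nat_of_neg_add_one (s1.congr e1) (s2.congr e2), tsum_congr e1,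
      tsum_congr e2]
  rw [tsum_congr hterm, tsum_mul_left, ← hb] at hP
  have hM0 : M ≠ 0 := Complex.exp_ne_zero _
  have e3 : bilateral q v x = M⁻¹ * ((L : ℂ)⁻¹ *
      PiSeries q (Complex.log (1 - 2 * q) / Complex.log (1 / (q : ℂ)))) := by
    rw [← hP, inv_mul_cancel_left₀ hM0]
  rw [cv, e3, cg, cL]
  -- Here M = t^γ v², and q^γ = v⁻¹ gives vq^{3γ} = v⁻².
  have e4 : ((q : ℂ) ^ 2)⁻¹ * M⁻¹ = (1 - 2 * (q : ℂ)) ^ (-(g : ℂ)) * (v * (q : ℂ) ^ (3 * (g : ℂ) - 2)) := by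
    have e5 : ((q : ℂ) ^ 2)⁻¹ = Complex.exp ((2 : ℕ) * L) := by
      rw [Complex.exp_nat_mul, eqc', inv_pow]
    have e6 : Complex.log (q : ℂ) = -L := by
      rw [hL, one_div, Real.log_inv, Complex.ofReal_neg, neg_neg, Complex.ofReal_log h0.le]
    have e7 : Complex.log (t : ℂ) = L * u := by
      rw [clt, hu, Complex.ofReal_div, mul_div_cancel₀ _ (Complex.ofReal_ne_zero.2 hL0.ne')]
    rw [ct, Complex.cpow_def_of_ne_zero (Complex.ofReal_ne_zero.2 ht0.ne'),
      Complex.cpow_def_of_ne_zero hq0, e5, e6, e7, ← evc, hM, ← Complex.exp_neg, ← Complex.exp_add,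
      ← Complex.exp_add, ← Complex.exp_add]
    congr 1
    push_cast
    ring
  rw [← mul_assoc, e4]
  ring

theorem U_eq {q : ℂ} (hq : q ≠ 0) :
    U q = vq q * q ^ (3 * gam q - 2) / Complex.log (1 / q) *
      pochRatio (aq q) q (-(1 - 2 * q) / q ^ 2) := by
  rw [U, pochRatio]
  congr 3
  · field_simp
  · ring

/-- The second formula for real `q`. -/
theorem T_eq_of_real {q : ℝ} (h0 : 0 < q) (h1 : q < 1 / 2) (hn : NearHalf (q : ℂ))
    (hR : 1 ≤ (1 / Complex.log (1 / (q : ℂ))).re) :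
    T q = (1 - 2 * (q : ℂ)) ^ (-gam q) *
      PiSeries q (Complex.log (1 - 2 * q) / Complex.log (1 / (q : ℂ))) * U q + V q := by
  have ht : (1 : ℂ) - 2 * q ≠ 0 := by
    have : (0 : ℝ) < 1 - 2 * q := by linarith
    exact_mod_cast this.ne'
  have h2 := bilateral_eq_PiSeries h0 h1 hn hR
  rw [hn.T_eq_bilateral ht fun ν _ => ofReal_pole_ne_zero h0 h1 (ν + 2), U_eq hn.ne_zero]
  linear_combination pochRatio (aq q) q (-(1 - 2 * q) / (q : ℂ) ^ 2) * h2

end PrudentPolygon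

open Filter Topology

namespace PrudentPolygon

/-! ### Uniform bounds and analyticity at `1/2` -/

/-- With s = (3/4)^i each factor is at most (1 + 2s)/(1 - 3s/4) ≤ 1 + 11s, with equality at s = 1;
and 44 = 11/(1 - 3/4). The bound is uniform in all parameters, as the Weierstrass tests require. -/
theorem norm_qPoch_div_le {x b q : ℂ} (hx : ‖x‖ ≤ 2) (hb : ‖b‖ ≤ 3 / 4) (hq : ‖q‖ ≤ 3 / 4) (n : ℕ) :
    ‖qPoch x q n / qPoch b q n‖ ≤ Real.exp 44 := by
  rw [qPoch, qPoch, ← Finset.prod_div_distrib, norm_prod]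
  have hfac : ∀ i : ℕ, ‖(1 - x * q ^ i) / (1 - b * q ^ i)‖ ≤ 1 + 11 * (3 / 4 : ℝ) ^ i := by
    intro i
    have h1 : ‖q ^ i‖ ≤ (3 / 4 : ℝ) ^ i := by
      rw [norm_pow]; gcongr
    have h2 : (3 / 4 : ℝ) ^ i ≤ 1 := pow_le_one₀ (by norm_num) (by norm_num)
    set s := (3 / 4 : ℝ) ^ i
    have hs : 0 ≤ s := by positivity
    have h3 : ‖1 - x * q ^ i‖ ≤ 1 + 2 * s := by
      refine (norm_sub_le _ _).trans ?_
      rw [norm_one, norm_mul]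
      gcongr
    have h4 : 1 - 3 / 4 * s ≤ ‖1 - b * q ^ i‖ := by
      have h5 := norm_sub_norm_le 1 (b * q ^ i)
      rw [norm_one, norm_mul] at h5
      have h6 : ‖b‖ * ‖q ^ i‖ ≤ 3 / 4 * s := by gcongr
      linarith
    rw [norm_div, div_le_iff₀ (by linarith)]
    nlinarith [mul_le_mul_of_nonneg_left h4 (show 0 ≤ 1 + 11 * s by positivity)]
  calc _ ≤ ∏ i ∈ Finset.range n, (1 + 11 * (3 / 4 : ℝ) ^ i) :=
        Finset.prod_le_prod (fun _ _ => norm_nonneg _) fun i _ => hfac i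
    _ ≤ Real.exp (∑ i ∈ Finset.range n, 11 * (3 / 4 : ℝ) ^ i) :=
        Real.prod_one_add_le_exp_sum _ fun i => by positivity
    _ ≤ Real.exp 44 := by
        refine Real.exp_le_exp.2 ?_
        rw [← Finset.mul_sum]
        have := (summable_geometric_of_lt_one (r := (3 / 4 : ℝ)) (by norm_num)
          (by norm_num)).sum_le_tsum (Finset.range n) fun i _ => by positivity
        rw [tsum_geometric_of_lt_one (by norm_num) (by norm_num)] at this
        norm_num at this
        linarith

theorem analyticAt_qPoch {X Q : ℂ → ℂ} {z₀ : ℂ} (hX : AnalyticAt ℂ X z₀) (hQ : AnalyticAt ℂ Q z₀)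
    (n : ℕ) : AnalyticAt ℂ (fun z => qPoch (X z) (Q z) n) z₀ := by
  simp only [qPoch]
  exact Finset.analyticAt_fun_prod _ fun i _ => analyticAt_const.sub (hX.mul (hQ.pow i))

theorem half_mem_slitPlane : (1 / 2 : ℂ) ∈ Complex.slitPlane := by
  simp [Complex.slitPlane]

theorem analyticAt_log_inv {q : ℂ} (hq : q ∈ Complex.slitPlane) :
    AnalyticAt ℂ (fun q : ℂ => Complex.log (1 / q)) q := by
  refine (analyticAt_const.div analyticAt_id (Complex.slitPlane_ne_zero hq)).clog ?_
  rw [Pi.div_apply, one_div]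
  rw [Complex.mem_slitPlane_iff_arg] at hq ⊢
  refine ⟨fun h => ?_, inv_ne_zero hq.2⟩
  have h1 := Complex.neg_pi_lt_arg q
  rw [id, Complex.arg_inv, if_neg hq.1] at h
  linarith

theorem analyticAt_gam {q : ℂ} (hq1 : 1 - q ≠ 0) (hv : vq q ∈ Complex.slitPlane)
    (hq : q ∈ Complex.slitPlane) (hL : Complex.log (1 / q) ≠ 0) : AnalyticAt ℂ gam q := by
  unfold gam
  exact ((analyticAt_vq hq1).clog hv).div (analyticAt_log_inv hq) hL

theorem log_inv_half : Complex.log (1 / (1 / 2)) = (Real.log 2 : ℂ) := by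
  rw [one_div_one_div, Complex.ofReal_log (by norm_num)]
  norm_num

theorem log_inv_half_ne_zero : Complex.log (1 / (1 / 2)) ≠ 0 := by
  rw [log_inv_half]
  exact Complex.ofReal_ne_zero.2 (Real.log_pos (by norm_num)).ne'

theorem vq_half_mem_slitPlane : vq (1 / 2) ∈ Complex.slitPlane := by
  rw [vq_half]
  left
  norm_num

theorem analyticAt_gam_half : AnalyticAt ℂ gam (1 / 2) :=
  analyticAt_gam (by norm_num) vq_half_mem_slitPlane half_mem_slitPlane log_inv_half_ne_zero

theorem analyticAt_U_half : AnalyticAt ℂ U (1 / 2) := by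
  have hv : AnalyticAt ℂ vq (1 / 2) := analyticAt_vq (by norm_num)
  have ha : AnalyticAt ℂ aq (1 / 2) := analyticAt_aq (by norm_num)
  have hid : AnalyticAt ℂ (fun q : ℂ => q) (1 / 2) := analyticAt_id
  have ht : AnalyticAt ℂ (fun q : ℂ => 1 - 2 * q) (1 / 2) := by fun_prop
  have hpow : AnalyticAt ℂ (fun q : ℂ => q ^ (3 * gam q - 2)) (1 / 2) :=
    hid.cpow ((analyticAt_const.mul analyticAt_gam_half).sub analyticAt_const) half_mem_slitPlane
  have hP1 := analyticAt_qPochInf (((hid.inv (by norm_num)).neg).mul ht) hid (by norm_num)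
  have hP2 := analyticAt_qPochInf ((ha.neg.mul ((hid.pow 2).inv (by norm_num))).mul ht) hid
    (by norm_num)
  refine ((hv.mul hpow).div (analyticAt_log_inv half_mem_slitPlane) log_inv_half_ne_zero).mul
    (hP1.div hP2 ?_)
  refine qPochInf_ne_zero_of_norm_lt (by norm_num) ?_
  norm_num

theorem analyticAt_V_half : AnalyticAt ℂ V (1 / 2) := by
  have hv : AnalyticAt ℂ vq (1 / 2) := analyticAt_vq (by norm_num)
  have ha : AnalyticAt ℂ aq (1 / 2) := analyticAt_aq (by norm_num)
  have hid : AnalyticAt ℂ (fun q : ℂ => q) (1 / 2) := analyticAt_id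
  have ht : AnalyticAt ℂ (fun q : ℂ => 1 - 2 * q) (1 / 2) := by fun_prop
  have hq : ‖(1 / 2 : ℂ)‖ < 1 := by norm_num
  have hv0 : vq (1 / 2) ≠ 0 := by rw [vq_half]; norm_num
  have ha0 : aq (1 / 2) ≠ 0 := by rw [aq_half]; norm_num
  have hX : AnalyticAt ℂ (fun q => (aq q)⁻¹ * (vq q)⁻¹ * q) (1 / 2) :=
    ((ha.inv ha0).mul (hv.inv hv0)).mul hid
  have hB : AnalyticAt ℂ (fun q => (vq q)⁻¹ * q) (1 / 2) := (hv.inv hv0).mul hid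
  have hY : AnalyticAt ℂ (fun q => -aq q * (q ^ 2)⁻¹ * (1 - 2 * q)) (1 / 2) :=
    (ha.neg.mul ((hid.pow 2).inv (by norm_num))).mul ht
  have hseries : AnalyticAt ℂ (fun q => ∑' r : ℕ, Vterm q r) (1 / 2) := by
    have hev : ∀ {f : ℂ → ℂ} {c : ℝ}, AnalyticAt ℂ f (1 / 2) → ‖f (1 / 2)‖ < c →
        ∀ᶠ q in 𝓝 (1 / 2 : ℂ), ‖f q‖ < c ∧ AnalyticAt ℂ f q := fun hf hc =>
      Eventually.and (hf.continuousAt.norm (Iio_mem_nhds hc)) hf.eventually_analyticAt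
    -- At 1/2 the two parameters are 1 and 1/3 and the argument of the power is 0, so near 1/2 the
    -- terms are bounded by e^{44}2^{-r}.
    obtain ⟨ε, hε, hball⟩ := Metric.eventually_nhds_iff_ball.1 (((hev (c := 2) hX (by
      rw [vq_half, aq_half]; norm_num)).and (hev (c := 3 / 4) hB (by
      rw [vq_half]; norm_num))).and ((hev (c := 1 / 2) hY (by norm_num)).and
      (hev (c := 3 / 4) hid (by norm_num))))
    have hd : DifferentiableOn ℂ (fun q => ∑' r : ℕ, Vterm q r) (Metric.ball (1 / 2) ε) := by
      refine Complex.differentiableOn_tsum_of_summable_norm (u := fun r => Real.exp 44 * (1 / 2 : ℝ) ^ r)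
        (summable_geometric_two.mul_left _) (fun r q hq => ?_) Metric.isOpen_ball fun r q hq => ?_
      · obtain ⟨⟨⟨-, c1⟩, c2', c2⟩, ⟨-, c3⟩, c4', c4⟩ := hball q hq
        refine AnalyticAt.differentiableWithinAt ?_
        exact ((analyticAt_qPoch c1 c4 r).div (analyticAt_qPoch c2 c4 r) (qPoch_ne_zero
          (mul_pow_ne_one (c2'.trans (by norm_num)) (c4'.trans (by norm_num))) r)).mul (c3.pow r)
      · obtain ⟨⟨⟨c1, -⟩, c2, -⟩, ⟨c3, -⟩, c4, -⟩ := hball q hq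
        rw [Vterm, norm_mul, norm_pow]
        exact mul_le_mul (norm_qPoch_div_le c1.le c2.le c4.le r)
          (pow_le_pow_left₀ (norm_nonneg _) c3.le r) (by positivity) (by positivity)
    exact hd.analyticAt (Metric.ball_mem_nhds _ hε)
  have hPq := analyticAt_qPochInf hid hid hq
  have hPa := analyticAt_qPochInf ha hid hq
  have hPv := analyticAt_qPochInf hv hid hq
  have hPav := analyticAt_qPochInf (ha.mul hv) hid hq
  have na : qPochInf (aq (1 / 2)) (1 / 2) ≠ 0 :=
    qPochInf_ne_zero_of_norm_lt hq (by rw [aq_half]; norm_num)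
  -- Since v = 3/2 lies outside the unit disc, the first factor is split off; the rest starts at vq
  -- = 3/4.
  have nv : qPochInf (vq (1 / 2)) (1 / 2) ≠ 0 := by
    rw [qPochInf_eq_mul _ hq, vq_half]
    refine mul_ne_zero (by norm_num) (qPochInf_ne_zero_of_norm_lt hq (by norm_num))
  have hI : AnalyticAt ℂ (fun q : ℂ => (q ^ 2)⁻¹) (1 / 2) := (hid.pow 2).inv (by norm_num)
  exact (((hPq.div hPa na).mul (hI.div (analyticAt_const.add (hI.mul ht)) (by norm_num))).neg).add
    ((hI.mul ((hPq.mul hPav).div (hPa.mul hPv) (mul_ne_zero na nv))).mul hseries)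

end PrudentPolygon

open Filter Topology

namespace PrudentPolygon

/-! ### The sector -/

/-- In the variable t = 1 - 2q = 2r e^{i(θ-π)} the sector is symmetric about the positive axis, and
θ - π is the principal argument. -/
theorem mem_sector_iff {r₀ : ℝ} {q : ℂ} : q ∈ sector (Real.pi / 4) r₀ ↔
    1 - 2 * q ≠ 0 ∧ ‖1 - 2 * q‖ < 2 * r₀ ∧ |(1 - 2 * q).arg| < 3 * Real.pi / 4 := by
  constructor
  · rintro ⟨r, θ, h0, h1, h2, h3, rfl⟩
    have e : (1 : ℂ) - 2 * (1 / 2 + r * Complex.exp (θ * Complex.I)) =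
        (2 * r : ℝ) * Complex.exp ((θ - Real.pi : ℝ) * Complex.I) := by
      push_cast
      rw [sub_mul, Complex.exp_sub, Complex.exp_pi_mul_I]
      ring
    have hr : 0 < 2 * r := by linarith
    rw [e]
    refine ⟨mul_ne_zero (Complex.ofReal_ne_zero.2 hr.ne') (Complex.exp_ne_zero _), ?_, ?_⟩
    · rw [norm_mul, Complex.norm_exp_ofReal_mul_I, mul_one, Complex.norm_real,
        Real.norm_of_nonneg hr.le]
      linarith
    · rw [Complex.arg_real_mul _ hr, Complex.arg_exp_mul_I,
        (toIocMod_eq_self Real.two_pi_pos).2 ⟨by linarith, by linarith⟩, abs_lt]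
      constructor <;> linarith
  · rintro ⟨h0, h1, h2⟩
    rw [abs_lt] at h2
    refine ⟨‖1 - 2 * q‖ / 2, (1 - 2 * q).arg + Real.pi, by positivity, by linarith, by linarith,
      by linarith, ?_⟩
    have := Complex.norm_mul_exp_arg_mul_I (1 - 2 * q)
    push_cast
    rw [add_mul, Complex.exp_add, Complex.exp_pi_mul_I]
    linear_combination (1 / 2 : ℂ) * this

theorem isPreconnected_sector (r₀ : ℝ) : IsPreconnected (sector (Real.pi / 4) r₀) := by
  have h : sector (Real.pi / 4) r₀ = (fun p : ℝ × ℝ => (1 / 2 + p.1 * Complex.exp (p.2 * Complex.I) : ℂ)) ''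
      (Set.Ioo 0 r₀ ×ˢ Set.Ioo (Real.pi / 4) (2 * Real.pi - Real.pi / 4)) := by
    ext z
    constructor
    · rintro ⟨r, θ, h0, h1, h2, h3, rfl⟩
      exact ⟨(r, θ), ⟨⟨h0, h1⟩, h2, h3⟩, rfl⟩
    · rintro ⟨⟨r, θ⟩, ⟨⟨h0, h1⟩, h2, h3⟩, rfl⟩
      exact ⟨r, θ, h0, h1, h2, h3, rfl⟩
  rw [h]
  refine (isPreconnected_Ioo.prod isPreconnected_Ioo).image _ (Continuous.continuousOn ?_)
  fun_prop

theorem mem_slitPlane_of_abs_arg_lt {t : ℂ} (h0 : t ≠ 0) (h : |t.arg| < 3 * Real.pi / 4) :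
    t ∈ Complex.slitPlane := by
  rw [Complex.mem_slitPlane_iff_arg]
  refine ⟨fun h1 => ?_, h0⟩
  rw [h1, abs_of_pos Real.pi_pos] at h
  linarith [Real.pi_pos]

theorem isOpen_sector (r₀ : ℝ) : IsOpen (sector (Real.pi / 4) r₀) := by
  rw [isOpen_iff_mem_nhds]
  intro q hq
  obtain ⟨h0, h1, h2⟩ := mem_sector_iff.1 hq
  have ht : ContinuousAt (fun q : ℂ => 1 - 2 * q) q := by fun_prop
  have harg : ContinuousAt (fun q : ℂ => |(1 - 2 * q).arg|) q :=
    (ContinuousAt.comp (f := fun q : ℂ => 1 - 2 * q) (g := Complex.arg)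
      (Complex.continuousAt_arg (mem_slitPlane_of_abs_arg_lt h0 h2)) ht).abs
  have e1 : ∀ᶠ z in 𝓝 q, ‖1 - 2 * z‖ < 2 * r₀ := ht.norm (Iio_mem_nhds h1)
  have e2 : ∀ᶠ z in 𝓝 q, |(1 - 2 * z).arg| < 3 * Real.pi / 4 := harg (Iio_mem_nhds h2)
  filter_upwards [ht.eventually_ne h0, e1, e2] with z c0 c1 c2
  exact mem_sector_iff.2 ⟨c0, c1, c2⟩

theorem re_ge_of_abs_arg_lt {t : ℂ} (h : |t.arg| < 3 * Real.pi / 4) :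
    -(3 / 4) * ‖t‖ ≤ t.re := by
  have h1 : Real.cos (3 * Real.pi / 4) ≤ Real.cos |t.arg| :=
    Real.cos_le_cos_of_nonneg_of_le_pi (abs_nonneg _) (by linarith [Real.pi_pos]) h.le
  have h2 : Real.cos (3 * Real.pi / 4) = -(Real.sqrt 2 / 2) := by
    rw [show 3 * Real.pi / 4 = Real.pi - Real.pi / 4 by ring, Real.cos_pi_sub, Real.cos_pi_div_four]
  have h3 : Real.sqrt 2 ≤ 3 / 2 := Real.sqrt_le_iff.2 ⟨by norm_num, by norm_num⟩
  rw [Real.cos_abs, h2] at h1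
  rw [← Complex.norm_mul_cos_arg t, mul_comm]
  exact mul_le_mul_of_nonneg_left (by linarith) (norm_nonneg _)

theorem norm_one_sub_pow_sub_one_le (t : ℂ) (n : ℕ) :
    ‖(1 - t) ^ n - 1‖ ≤ (1 + ‖t‖) ^ n - 1 := by
  induction n with
  | zero => simp
  | succ n ih =>
    have e : (1 - t) ^ (n + 1) - 1 = (1 - t) * ((1 - t) ^ n - 1) - t := by ring
    have h1 : ‖1 - t‖ ≤ 1 + ‖t‖ := (norm_sub_le _ _).trans_eq (by rw [norm_one])
    rw [e]
    calc _ ≤ ‖1 - t‖ * ‖(1 - t) ^ n - 1‖ + ‖t‖ := (norm_sub_le _ _).trans_eq (by rw [norm_mul])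
      _ ≤ (1 + ‖t‖) * ((1 + ‖t‖) ^ n - 1) + ‖t‖ := by gcongr
      _ = _ := by ring

/-- After squaring, this is positivity of a quadratic form in |t| and s. The part s/5 is kept to
absorb the error in q^n ≈ 2^{-n}. -/
theorem add_le_norm_add_of_re_ge {t : ℂ} (h : -(3 / 4) * ‖t‖ ≤ t.re) {s : ℝ} (hs : 0 ≤ s) :
    3 / 10 * ‖t‖ + 1 / 5 * s ≤ ‖t + s‖ := by
  have h1 : ‖t + s‖ ^ 2 = ‖t‖ ^ 2 + 2 * s * t.re + s ^ 2 := by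
    rw [← Complex.normSq_eq_norm_sq, ← Complex.normSq_eq_norm_sq, Complex.normSq_apply,
      Complex.normSq_apply]
    simp
    ring
  refine abs_le_of_sq_le_sq' ?_ (norm_nonneg _) |>.2
  rw [h1]
  nlinarith [sq_nonneg (‖t‖ - s), sq_nonneg (3 * s - 2 * ‖t‖), norm_nonneg t,
    mul_le_mul_of_nonneg_left h hs]

/-- A uniform lower bound for the denominators in the sector. -/
theorem exists_pole_bound : ∃ δ : ℝ, 0 < δ ∧ ∀ q : ℂ, ‖1 - 2 * q‖ < δ →
    -(3 / 4) * ‖1 - 2 * q‖ ≤ (1 - 2 * q).re →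
      ∀ n : ℕ, 3 / 10 * ‖1 - 2 * q‖ ≤ ‖1 - 2 * q + q ^ n‖ := by
  have hlim := tendsto_pow_const_mul_const_pow_of_abs_lt_one 2 (r := (3 / 4 : ℝ))
    (by rw [abs_of_pos] <;> norm_num)
  obtain ⟨C', hC'⟩ := hlim.bddAbove_range
  set C := max C' 1
  have hC : ∀ n : ℕ, (n : ℝ) ^ 2 * (3 / 4 : ℝ) ^ n ≤ C := fun n =>
    (hC' ⟨n, rfl⟩).trans (le_max_left _ _)
  have hC1 : 1 ≤ C := le_max_right _ _
  refine ⟨1 / (200 * C), by positivity, fun q hδ hre n => ?_⟩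
  have hqt : q = (1 - (1 - 2 * q)) / 2 := by ring
  rw [lt_div_iff₀ (by positivity)] at hδ
  generalize 1 - 2 * q = t at *
  have ht0 := norm_nonneg t
  -- If n|t| ≤ 1/10, then q^n = 2^{-n}(1 - t)^n is 2^{-n} up to a relative error 1/5. Otherwise
  -- |q^n| ≤ (3/4)^n ≤ C/n² ≤ 100C|t|² ≤ |t|/2, which is why δ = 1/(200C).
  rcases le_or_gt (n * ‖t‖) (1 / 10) with hn | hn
  · have h1 : q ^ n = ((1 / 2 : ℝ) ^ n : ℝ) + ((1 / 2 : ℝ) ^ n : ℝ) * ((1 - t) ^ n - 1) := by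
      rw [hqt, div_eq_inv_mul, mul_pow]
      push_cast
      ring
    set s : ℝ := (1 / 2) ^ n
    have hs : 0 ≤ s := by positivity
    have h2 : (1 + ‖t‖) ^ n ≤ 6 / 5 := by
      calc (1 + ‖t‖) ^ n ≤ Real.exp ‖t‖ ^ n := by
            gcongr
            linarith [Real.add_one_le_exp ‖t‖]
        _ = Real.exp (n * ‖t‖) := (Real.exp_nat_mul _ _).symm
        _ ≤ 1 / (1 - n * ‖t‖) :=
            Real.exp_bound_div_one_sub_of_interval (by positivity) (by linarith)
        _ ≤ 6 / 5 := by
            rw [div_le_div_iff₀ (by linarith) (by norm_num)]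
            linarith
    have h3 : ‖(s : ℂ) * ((1 - t) ^ n - 1)‖ ≤ 1 / 5 * s := by
      rw [norm_mul, Complex.norm_real, Real.norm_of_nonneg hs, mul_comm]
      gcongr
      linarith [norm_one_sub_pow_sub_one_le t n]
    have h4 := add_le_norm_add_of_re_ge hre hs
    have h5 := norm_sub_norm_le (t + s) (-((s : ℂ) * ((1 - t) ^ n - 1)))
    rw [sub_neg_eq_add, norm_neg] at h5
    rw [h1, ← add_assoc]
    linarith
  · have hn0 : (0 : ℝ) < n := by
      rcases Nat.eq_zero_or_pos n with rfl | h
      · norm_num at hn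
      · exact_mod_cast h
    have hq : ‖q‖ ≤ 3 / 4 := by
      rw [hqt, norm_div]
      have := norm_sub_le (1 : ℂ) t
      rw [norm_one] at this
      rw [show ‖(2 : ℂ)‖ = 2 by norm_num]
      nlinarith
    have h1 : ‖q ^ n‖ ≤ (3 / 4 : ℝ) ^ n := by rw [norm_pow]; gcongr
    have h2 : (3 / 4 : ℝ) ^ n ≤ ‖t‖ / 2 := by
      have h3 := hC n
      have h4 : (0 : ℝ) < (3 / 4 : ℝ) ^ n := by positivity
      have h5 : 1 / 100 ≤ (n * ‖t‖) ^ 2 := by nlinarith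
      have h6 : (3 / 4 : ℝ) ^ n * (1 / 100) ≤ C * ‖t‖ ^ 2 := by
        calc _ ≤ (3 / 4 : ℝ) ^ n * (n * ‖t‖) ^ 2 := by gcongr
          _ = (n : ℝ) ^ 2 * (3 / 4 : ℝ) ^ n * ‖t‖ ^ 2 := by ring
          _ ≤ _ := by gcongr
      nlinarith
    have h7 := norm_sub_norm_le t (-q ^ n)
    rw [sub_neg_eq_add, norm_neg] at h7
    linarith

end PrudentPolygon

/-! ### Convergence and analyticity of the series in a small sector -/

open Filter Topology

namespace PrudentPolygon

/-- The conditions on `q` that hold, and make every series converge, in a small sector at `1/2`. -/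
structure SectorPoint (q : ℂ) : Prop extends NearHalf q where
  norm_le : ‖q‖ ≤ 3 / 4
  norm_vq_le : ‖vq q * q‖ ≤ 7 / 8
  slit : 1 - 2 * q ∈ Complex.slitPlane
  q_slit : q ∈ Complex.slitPlane
  v_slit : vq q ∈ Complex.slitPlane
  pole : ∀ n : ℕ, 3 / 10 * ‖1 - 2 * q‖ ≤ ‖1 - 2 * q + q ^ n‖
  one_le_re : 1 ≤ (1 / Complex.log (1 / q)).re
  abs_im_gam : |(gam q).im| ≤ 1
  abs_im_u : |(Complex.log (1 - 2 * q) / Complex.log (1 / q)).im| ≤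
    Real.pi * (1 / Complex.log (1 / q)).re - 1 / 2
  sin_ne_zero : Complex.sin (Real.pi * gam q) ≠ 0
  norm_pcoeff_zero : ‖pcoeff q 0‖ ≤ ‖pcoeff (1 / 2) 0‖ + 1
  analyticAt_U : AnalyticAt ℂ U q
  analyticAt_V : AnalyticAt ℂ V q

theorem gam_half : gam (1 / 2) = (Real.log (3 / 2) / Real.log 2 : ℝ) := by
  rw [gam, log_inv_half, vq_half, Complex.ofReal_div, Complex.ofReal_log (x := 3 / 2) (by norm_num)]
  norm_num

theorem sin_gam_half : Complex.sin (Real.pi * gam (1 / 2)) ≠ 0 := by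
  have h2 : 0 < Real.log 2 := Real.log_pos (by norm_num)
  have h3 : 0 < Real.log (3 / 2) := Real.log_pos (by norm_num)
  have h4 : Real.log (3 / 2) < Real.log 2 := Real.log_lt_log (by norm_num) (by norm_num)
  have h5 : Real.log (3 / 2) / Real.log 2 < 1 := (div_lt_one h2).2 h4
  have h6 : 0 < Real.log (3 / 2) / Real.log 2 := div_pos h3 h2
  rw [gam_half, ← Complex.ofReal_mul, ← Complex.ofReal_sin]
  exact Complex.ofReal_ne_zero.2 (Real.sin_pos_of_pos_of_lt_pi (mul_pos Real.pi_pos h6)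
    (mul_lt_of_lt_one_right Real.pi_pos h5)).ne'

theorem pcoeff_zero (q : ℂ) : pcoeff q 0 = Real.pi / Complex.sin (Real.pi * gam q) := by
  rw [pcoeff]
  simp

theorem analyticAt_inv_log_half : AnalyticAt ℂ (fun q : ℂ => 1 / Complex.log (1 / q)) (1 / 2) :=
  analyticAt_const.div (analyticAt_log_inv half_mem_slitPlane) log_inv_half_ne_zero

theorem inv_log_half : 1 / Complex.log (1 / (1 / 2)) = (1 / Real.log 2 : ℝ) := by
  rw [log_inv_half]
  push_cast
  rfl

/-- The logarithm of |t| diverges at 1/2, but 1/log(1/q) is analytic and real there, so its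
imaginary part is O(|t|), and |t| log|t| → 0. -/
theorem eventually_abs_log_mul_im_le :
    ∀ᶠ q in 𝓝 (1 / 2 : ℂ), |Real.log ‖1 - 2 * q‖ * (1 / Complex.log (1 / q)).im| ≤ 1 / 4 := by
  obtain ⟨C, hC⟩ := analyticAt_inv_log_half.differentiableAt.isBigO_sub.bound
  have hcont : ContinuousAt (fun q : ℂ => |C| * |‖1 - 2 * q‖ * Real.log ‖1 - 2 * q‖|) (1 / 2) := by
    have h1 : Continuous fun q : ℂ => ‖1 - 2 * q‖ := by fun_prop
    exact (continuous_const.mul (Real.continuous_mul_log.comp h1).abs).continuousAt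
  have h2 : ∀ᶠ q in 𝓝 (1 / 2 : ℂ), |C| * |‖1 - 2 * q‖ * Real.log ‖1 - 2 * q‖| < 1 / 4 :=
    hcont (Iio_mem_nhds (by norm_num))
  filter_upwards [hC, h2] with q c1 c2
  have h3 : |(1 / Complex.log (1 / q)).im| ≤ |C| * ‖1 - 2 * q‖ := by
    have h4 := Complex.abs_im_le_norm (1 / Complex.log (1 / q) - 1 / Complex.log (1 / (1 / 2)))
    rw [Complex.sub_im, inv_log_half, Complex.ofReal_im, sub_zero, ← inv_log_half] at h4
    have h5 : ‖1 - 2 * q‖ = 2 * ‖q - 1 / 2‖ := by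
      rw [show 1 - 2 * q = -2 * (q - 1 / 2) by ring, norm_mul]
      norm_num
    have h6 : C * ‖q - 1 / 2‖ ≤ |C| * ‖q - 1 / 2‖ := by
      gcongr
      exact le_abs_self C
    have h7 : 0 ≤ |C| * ‖q - 1 / 2‖ := by positivity
    rw [h5]
    linarith
  rw [abs_mul]
  calc _ ≤ |Real.log ‖1 - 2 * q‖| * (|C| * ‖1 - 2 * q‖) := by gcongr
    _ = |C| * |‖1 - 2 * q‖ * Real.log ‖1 - 2 * q‖| := by
      rw [abs_mul, abs_norm]
      ring
    _ ≤ _ := c2.le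

theorem exists_sectorPoint :
    ∃ r₀ : ℝ, 0 < r₀ ∧ r₀ < 1 / 2 ∧ ∀ q ∈ sector (Real.pi / 4) r₀, SectorPoint q := by
  obtain ⟨δ, hδ, hpole⟩ := exists_pole_bound
  have hv : ContinuousAt vq (1 / 2) := (analyticAt_vq (by norm_num)).continuousAt
  have hid : ContinuousAt (fun q : ℂ => q) (1 / 2) := continuousAt_id
  have ht : ContinuousAt (fun q : ℂ => 1 - 2 * q) (1 / 2) := by fun_prop
  have hg := analyticAt_gam_half.continuousAt
  have hs : ContinuousAt (fun q => Complex.sin (Real.pi * gam q)) (1 / 2) :=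
    Complex.continuous_sin.continuousAt.comp (continuousAt_const.mul hg)
  have hp : ContinuousAt (fun q => pcoeff q 0) (1 / 2) := by
    simp only [pcoeff_zero]
    exact continuousAt_const.div hs sin_gam_half
  have hR := Complex.continuous_re.continuousAt.comp analyticAt_inv_log_half.continuousAt
  have hI := (Complex.continuous_im.continuousAt.comp hg).abs
  have hlt : ∀ (f : ℂ → ℂ) (c : ℝ), ContinuousAt f (1 / 2) → ‖f (1 / 2)‖ < c →
      ∀ᶠ q in 𝓝 (1 / 2 : ℂ), ‖f q‖ < c := fun f c hf h => hf.norm (Iio_mem_nhds h)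
  have e1 : ∀ᶠ q in 𝓝 (1 / 2 : ℂ), 1 < (1 / Complex.log (1 / q)).re := by
    refine hR (Ioi_mem_nhds ?_)
    rw [Function.comp_apply, inv_log_half, Complex.ofReal_re, lt_div_iff₀ (Real.log_pos (by norm_num)),
      one_mul]
    linarith [Real.log_two_lt_d9]
  have e2 : ∀ᶠ q in 𝓝 (1 / 2 : ℂ), |(gam q).im| < 1 := by
    refine hI (Iio_mem_nhds ?_)
    change |(gam (1 / 2)).im| < 1
    rw [gam_half, Complex.ofReal_im]
    norm_num
  have e3 : ∀ᶠ q in 𝓝 (1 / 2 : ℂ), q ∈ Complex.slitPlane :=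
    Complex.isOpen_slitPlane.mem_nhds half_mem_slitPlane
  have e4 : ∀ᶠ q in 𝓝 (1 / 2 : ℂ), vq q ∈ Complex.slitPlane :=
    hv (Complex.isOpen_slitPlane.mem_nhds vq_half_mem_slitPlane)
  have hev : ∀ᶠ q in 𝓝 (1 / 2 : ℂ), q ≠ 1 / 2 → |(1 - 2 * q).arg| < 3 * Real.pi / 4 →
      SectorPoint q := by
    filter_upwards [eventually_nearHalf, e1, e2, e3, e4, eventually_abs_log_mul_im_le,
      hlt _ (3 / 4) hid (by norm_num), hlt (fun q => vq q * q) (7 / 8) (hv.mul hid)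
        (by rw [vq_half]; norm_num), hlt _ δ ht (by norm_num; exact hδ),
      hs.eventually_ne sin_gam_half, hlt _ (‖pcoeff (1 / 2) 0‖ + 1) hp (lt_add_one _),
      analyticAt_U_half.eventually_analyticAt, analyticAt_V_half.eventually_analyticAt]
      with q hn c1 c2 c3 c4 c5 c6 c7 c8 c9 c10 c11 c12 hne harg
    have ht0 : 1 - 2 * q ≠ 0 := fun h => hne (by linear_combination (-1 / 2 : ℂ) * h)
    refine ⟨hn, c6.le, c7.le, mem_slitPlane_of_abs_arg_lt ht0 harg, c3, c4,
      hpole q c8 (re_ge_of_abs_arg_lt harg), c1.le, c2.le, ?_, c9, c10.le, c11, c12⟩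
    rw [div_eq_mul_one_div, Complex.mul_im, Complex.log_re, Complex.log_im]
    set R := (1 / Complex.log (1 / q)).re
    have h1 := abs_add_le (Real.log ‖1 - 2 * q‖ * (1 / Complex.log (1 / q)).im)
      ((1 - 2 * q).arg * R)
    have h2 : |(1 - 2 * q).arg * R| ≤ 3 * Real.pi / 4 * R := by
      rw [abs_mul, abs_of_pos (one_pos.trans c1)]
      gcongr
    -- Here (3π/4)R + 1/4 ≤ πR - 1/2 because R > 1 and π > 3; this is where the opening |arg t| <
    -- 3π/4 is affordable.
    nlinarith [Real.pi_gt_three]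
  obtain ⟨ε, hε, hball⟩ := Metric.eventually_nhds_iff_ball.1 hev
  refine ⟨min ε (1 / 4), by positivity, (min_le_right _ _).trans_lt (by norm_num), fun q hq => ?_⟩
  obtain ⟨h0, h1, h2⟩ := mem_sector_iff.1 hq
  have h3 : ‖1 - 2 * q‖ = 2 * ‖q - 1 / 2‖ := by
    rw [show 1 - 2 * q = -2 * (q - 1 / 2) by ring, norm_mul]
    norm_num
  refine hball q ?_ (fun h => h0 (by rw [h]; norm_num)) h2
  rw [mem_ball_iff_norm]
  have := min_le_left ε (1 / 4)
  linarith

namespace SectorPoint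

variable {q : ℂ}

theorem t_ne_zero (h : SectorPoint q) : 1 - 2 * q ≠ 0 := Complex.slitPlane_ne_zero h.slit

theorem log_ne_zero (h : SectorPoint q) : Complex.log (1 / q) ≠ 0 := by
  intro h0
  have := h.one_le_re
  rw [h0, div_zero, Complex.zero_re] at this
  linarith

theorem pole_ne_zero (h : SectorPoint q) (n : ℕ) : 1 - 2 * q + q ^ n ≠ 0 := by
  have h1 := norm_pos_iff.2 h.t_ne_zero
  exact norm_pos_iff.1 (lt_of_lt_of_le (by positivity) (h.pole n))

theorem norm_fourierTerm_le (h : SectorPoint q) (k : ℤ) :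
    ‖fourierTerm q (Complex.log (1 - 2 * q) / Complex.log (1 / q)) k‖ ≤
      max (4 * Real.pi * Real.exp Real.pi) (‖pcoeff (1 / 2) 0‖ + 1) *
        Real.exp (-Real.pi) ^ k.natAbs := by
  rcases eq_or_ne k 0 with rfl | hk
  · rw [fourierTerm, Int.cast_zero, mul_zero, zero_mul, zero_mul, Complex.exp_zero, mul_one,
      Int.natAbs_zero, pow_zero, mul_one]
    exact h.norm_pcoeff_zero.trans (le_max_right _ _)
  · refine (PrudentPolygon.norm_fourierTerm_le h.one_le_re h.abs_im_gam h.abs_im_u hk).trans ?_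
    gcongr
    exact le_max_left _ _

theorem seriesConverge (h : SectorPoint q) : SeriesConverge q :=
  ⟨fun ν _ => h.pole_ne_zero (ν + 2), h.summable_Tterm h.t_ne_zero,
    ⟨_, _, (Real.exp_pos _).le, exp_neg_pi_lt_one, h.norm_fourierTerm_le⟩, h.summable_Vterm⟩

theorem analyticAt_gam (h : SectorPoint q) : AnalyticAt ℂ gam q :=
  PrudentPolygon.analyticAt_gam h.one_sub_ne h.v_slit h.q_slit h.log_ne_zero

theorem sin_arg_ne_zero (h : SectorPoint q) (k : ℤ) : Complex.sin
    (Real.pi * gam q + 2 * Complex.I * k * Real.pi ^ 2 / Complex.log (1 / q)) ≠ 0 := by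
  rcases eq_or_ne k 0 with rfl | hk
  · simpa using h.sin_ne_zero
  · intro h0
    have h1 := exp_le_four_mul_norm_sin (abs_im_sin_arg h.one_le_re h.abs_im_gam hk).2
    rw [h0, norm_zero, mul_zero] at h1
    exact absurd h1 (not_le.2 (Real.exp_pos _))

theorem analyticAt_fourierTerm (h : SectorPoint q) (k : ℤ) : AnalyticAt ℂ
    (fun q => fourierTerm q (Complex.log (1 - 2 * q) / Complex.log (1 / q)) k) q := by
  have hL := analyticAt_log_inv h.q_slit
  have ht : AnalyticAt ℂ (fun q : ℂ => 1 - 2 * q) q := by fun_prop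
  have hz : AnalyticAt ℂ (fun q : ℂ => Real.pi * gam q +
      2 * Complex.I * k * Real.pi ^ 2 / Complex.log (1 / q)) q :=
    (analyticAt_const.mul h.analyticAt_gam).add (analyticAt_const.div hL h.log_ne_zero)
  exact (analyticAt_const.div (Complex.differentiable_sin.analyticAt _ |>.comp hz) (h.sin_arg_ne_zero k)).mul
    ((analyticAt_const.mul ((ht.clog h.slit).div hL h.log_ne_zero)).cexp)

theorem analyticAt_poleSeries_term (h : SectorPoint q) (ν : ℕ) : AnalyticAt ℂ
    (fun q => (1 - 2 * q) * (qBinom (aq q) q ν * (vq q * q) ^ ν / (1 - 2 * q + q ^ (ν + 2)))) q := by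
  have ht : AnalyticAt ℂ (fun q : ℂ => 1 - 2 * q) q := by fun_prop
  have hid : AnalyticAt ℂ (fun q : ℂ => q) q := analyticAt_id
  have ha := analyticAt_aq h.num_ne_zero
  have hv := analyticAt_vq h.one_sub_ne
  exact ht.mul ((((analyticAt_qPoch ha hid ν).div (analyticAt_qPoch hid hid ν)
    (qPoch_ne_zero (mul_pow_ne_one h.norm_lt h.norm_lt) ν)).mul ((hv.mul hid).pow ν)).div
      (ht.add (hid.pow (ν + 2))) (h.pole_ne_zero _))

/-- The factor 1 - 2q compensates the pole bound, which degenerates at the vertex, and makes the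
majorant uniform on the whole sector. -/
theorem norm_poleSeries_term_le (h : SectorPoint q) (ν : ℕ) :
    ‖(1 - 2 * q) * (qBinom (aq q) q ν * (vq q * q) ^ ν / (1 - 2 * q + q ^ (ν + 2)))‖ ≤
      10 / 3 * Real.exp 44 * (7 / 8) ^ ν := by
  have h1 : ‖qBinom (aq q) q ν‖ ≤ Real.exp 44 :=
    norm_qPoch_div_le (h.norm_a_lt.le.trans (by norm_num)) h.norm_le h.norm_le ν
  have h2 : ‖(vq q * q) ^ ν‖ ≤ (7 / 8) ^ ν := by
    rw [norm_pow]
    exact pow_le_pow_left₀ (norm_nonneg _) h.norm_vq_le ν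
  have h3 := norm_pos_iff.2 (h.pole_ne_zero (ν + 2))
  have h4 := h.pole (ν + 2)
  rw [norm_mul, norm_div, norm_mul, ← mul_div_assoc, div_le_iff₀ h3]
  calc _ ≤ (10 / 3 * ‖1 - 2 * q + q ^ (ν + 2)‖) * (Real.exp 44 * (7 / 8) ^ ν) := by
        gcongr
        linarith
    _ = _ := by ring

end SectorPoint

end PrudentPolygon

open Filter Topology

namespace PrudentPolygon

/-! ### Analytic continuation -/

theorem frequently_of_eventually_real {p : ℂ → Prop} {x : ℝ} (h : ∀ᶠ y : ℝ in 𝓝 x, p y) :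
    ∃ᶠ z in 𝓝[≠] (x : ℂ), p z := by
  have ht : Tendsto (fun y : ℝ => (y : ℂ)) (𝓝[≠] x) (𝓝[≠] (x : ℂ)) :=
    Complex.continuous_ofReal.continuousAt.continuousWithinAt.tendsto_nhdsWithin
      fun y hy h => hy (Complex.ofReal_injective h)
  exact ht.frequently (h.filter_mono nhdsWithin_le_nhds).frequently

theorem ofReal_mem_sector {r₀ x : ℝ} (h0 : 1 / 2 - r₀ < x) (h1 : x < 1 / 2) :
    (x : ℂ) ∈ sector (Real.pi / 4) r₀ := by
  have ht : (0 : ℝ) < 1 - 2 * x := by linarith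
  have e : (1 : ℂ) - 2 * x = ((1 - 2 * x : ℝ) : ℂ) := by push_cast; rfl
  rw [mem_sector_iff, e]
  refine ⟨Complex.ofReal_ne_zero.2 ht.ne', ?_, ?_⟩
  · rw [Complex.norm_real, Real.norm_of_nonneg ht.le]
    linarith
  · rw [Complex.arg_ofReal_of_nonneg ht.le, abs_zero]
    positivity

/-- The right-hand side of the first formula. -/
noncomputable def representation (q : ℂ) : ℂ :=
  Dq q - q ^ 2 * Aq q *
    (qPochInf (aq q) q * qPochInf (vq q) q / (qPochInf q q * qPochInf (aq q * vq q) q)) * T q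

section Sector

variable {r₀ : ℝ}

theorem analyticOnNhd_poleSeries (hS : ∀ q ∈ sector (Real.pi / 4) r₀, SectorPoint q) :
    AnalyticOnNhd ℂ (fun q => poleSeries q (1 - 2 * q) (aq q) (vq q)) (sector (Real.pi / 4) r₀) := by
  have hd : DifferentiableOn ℂ (fun q => ∑' ν : ℕ, (1 - 2 * q) * (qBinom (aq q) q ν *
      (vq q * q) ^ ν / (1 - 2 * q + q ^ (ν + 2)))) (sector (Real.pi / 4) r₀) :=
    Complex.differentiableOn_tsum_of_summable_norm
      ((summable_geometric_of_lt_one (r := (7 / 8 : ℝ)) (by norm_num) (by norm_num)).mul_left _)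
      (fun ν q hq => ((hS q hq).analyticAt_poleSeries_term ν).differentiableWithinAt)
      (isOpen_sector r₀) fun ν q hq => (hS q hq).norm_poleSeries_term_le ν
  have ht : AnalyticOnNhd ℂ (fun q : ℂ => 1 - 2 * q) (sector (Real.pi / 4) r₀) :=
    fun q _ => by fun_prop
  refine AnalyticOnNhd.congr (isOpen_sector r₀) ((hd.analyticOnNhd (isOpen_sector r₀)).div ht
    fun q hq => (hS q hq).t_ne_zero) fun q hq => ?_
  rw [tsum_mul_left, mul_div_cancel_left₀ _ (hS q hq).t_ne_zero, poleSeries]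

/-- Analyticity is read off the pole series, a single series with a uniform majorant, rather than
off the double sum. -/
theorem analyticOnNhd_T (hS : ∀ q ∈ sector (Real.pi / 4) r₀, SectorPoint q) :
    AnalyticOnNhd ℂ T (sector (Real.pi / 4) r₀) := by
  have hd : AnalyticOnNhd ℂ (fun q => (q ^ 2)⁻¹ * (q ^ 2 * (qPochInf q q / qPochInf (aq q) q *
      poleSeries q (1 - 2 * q) (aq q) (vq q)) -
      qPochInf q q / qPochInf (aq q) q / (1 - -(1 - 2 * q) / q ^ 2))) (sector (Real.pi / 4) r₀) := by
    intro q hq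
    have h := hS q hq
    have hid : AnalyticAt ℂ (fun q : ℂ => q) q := analyticAt_id
    have ht : AnalyticAt ℂ (fun q : ℂ => 1 - 2 * q) q := by fun_prop
    have h2 : q ^ 2 ≠ 0 := pow_ne_zero 2 h.ne_zero
    have hP := (analyticAt_qPochInf hid hid h.norm_lt).div
      (analyticAt_qPochInf (analyticAt_aq h.num_ne_zero) hid h.norm_lt)
      (qPochInf_ne_zero_of_norm_lt h.norm_lt h.norm_a_lt)
    have hx := h.x_ne (fun ν _ => h.pole_ne_zero (ν + 2)) 0
    rw [pow_zero] at hx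
    exact ((hid.pow 2).inv h2).mul (((hid.pow 2).mul (hP.mul (analyticOnNhd_poleSeries hS q hq))).sub
      (hP.div (analyticAt_const.sub (ht.neg.div (hid.pow 2) h2)) (sub_ne_zero.2 hx)))
  refine hd.congr (isOpen_sector r₀) fun q hq => ?_
  rw [(hS q hq).T_eq_unilateral (hS q hq).t_ne_zero, (hS q hq).unilateral_eq_poleSeries]

theorem analyticOnNhd_representation (hS : ∀ q ∈ sector (Real.pi / 4) r₀, SectorPoint q) :
    AnalyticOnNhd ℂ representation (sector (Real.pi / 4) r₀) := by
  have hd : AnalyticOnNhd ℂ (fun q => Cq q - q ^ 2 * Aq q *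
      (qPochInf (vq q) q / qPochInf (aq q * vq q) q) * poleSeries q (1 - 2 * q) (aq q) (vq q))
      (sector (Real.pi / 4) r₀) := by
    intro q hq
    have h := hS q hq
    have hid : AnalyticAt ℂ (fun q : ℂ => q) q := analyticAt_id
    have ht : AnalyticAt ℂ (fun q : ℂ => 1 - 2 * q) q := by fun_prop
    have h1 : AnalyticAt ℂ (fun q : ℂ => 1 - q) q := by fun_prop
    have ha := analyticAt_aq h.num_ne_zero
    have hv := analyticAt_vq h.one_sub_ne
    have hA : AnalyticAt ℂ Aq q := by
      unfold Aq
      exact AnalyticAt.div (by fun_prop) (ht.pow 2) (pow_ne_zero 2 h.t_ne_zero)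
    have hC : AnalyticAt ℂ Cq q := by
      unfold Cq
      exact AnalyticAt.div (by fun_prop) (h1.mul (ht.pow 2))
        (mul_ne_zero h.one_sub_ne (pow_ne_zero 2 h.t_ne_zero))
    have hP := (analyticAt_qPochInf hv hid h.norm_lt).div
      (analyticAt_qPochInf (ha.mul hv) hid h.norm_lt)
      (qPochInf_ne_zero_of_norm_lt h.norm_lt h.norm_av_lt)
    exact hC.sub ((((hid.pow 2).mul hA).mul hP).mul (analyticOnNhd_poleSeries hS q hq))
  refine hd.congr (isOpen_sector r₀) fun q hq => ?_
  rw [representation, (hS q hq).representation_eq (hS q hq).t_ne_zero]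

theorem analyticOnNhd_PiSeries (hS : ∀ q ∈ sector (Real.pi / 4) r₀, SectorPoint q) :
    AnalyticOnNhd ℂ (fun q => PiSeries q (Complex.log (1 - 2 * q) / Complex.log (1 / q)))
      (sector (Real.pi / 4) r₀) :=
  (Complex.differentiableOn_tsum_of_summable_norm
    ((summable_pow_natAbs (Real.exp_pos _).le exp_neg_pi_lt_one).mul_left _)
    (fun k q hq => ((hS q hq).analyticAt_fourierTerm k).differentiableWithinAt)
    (isOpen_sector r₀) fun k q hq => (hS q hq).norm_fourierTerm_le k).analyticOnNhd
    (isOpen_sector r₀)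

theorem T_eq_on_sector (h0 : 0 < r₀) (h1 : r₀ < 1 / 2)
    (hS : ∀ q ∈ sector (Real.pi / 4) r₀, SectorPoint q) :
    Set.EqOn T (fun q => (1 - 2 * q) ^ (-gam q) *
      PiSeries q (Complex.log (1 - 2 * q) / Complex.log (1 / q)) * U q + V q)
      (sector (Real.pi / 4) r₀) := by
  refine (analyticOnNhd_T hS).eqOn_of_preconnected_of_frequently_eq (z₀ := ((1 / 2 - r₀ / 2 : ℝ) : ℂ))
    (fun q hq => ?_) (isPreconnected_sector r₀) (ofReal_mem_sector (by linarith) (by linarith))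
    (frequently_of_eventually_real ?_)
  · have h := hS q hq
    have ht : AnalyticAt ℂ (fun q : ℂ => 1 - 2 * q) q := by fun_prop
    exact (((ht.cpow h.analyticAt_gam.neg h.slit).mul (analyticOnNhd_PiSeries hS q hq)).mul
      h.analyticAt_U).add h.analyticAt_V
  · filter_upwards [Ioo_mem_nhds (show 1 / 2 - r₀ < 1 / 2 - r₀ / 2 by linarith)
      (show 1 / 2 - r₀ / 2 < 1 / 2 by linarith)] with x hx
    have h := hS x (ofReal_mem_sector hx.1 hx.2)
    exact T_eq_of_real (by linarith [hx.1]) hx.2 h.toNearHalf h.one_le_re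

end Sector

theorem summable_PAcoeff {r : ℝ} (h0 : 0 ≤ r) (h1 : r < 1 / 2) :
    Summable fun n => (PAcoeff n : ℝ) * r ^ n := by
  -- The coefficients are nonnegative, so a larger s suffices; it also covers r = 0, where the real
  -- formula is not available.
  obtain ⟨s, hs0, hs1⟩ := exists_between h1
  have h2 := (hasSum_PAcoeff_ratioProd (h0.trans_lt hs0) hs1).2.summable
  have h3 : Summable fun n => (PAcoeff n : ℝ) * s ^ n := by
    refine Complex.summable_ofReal.1 (h2.congr fun n => ?_)
    push_cast
    rfl
  refine Summable.of_nonneg_of_le (fun n => by positivity) (fun n => ?_) h3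
  gcongr

theorem summable_PAcoeff_complex {q : ℂ} (hq : ‖q‖ < 1 / 2) :
    Summable fun n => (PAcoeff n : ℂ) * q ^ n := by
  refine Summable.of_norm ((summable_PAcoeff (norm_nonneg q) hq).congr fun n => ?_)
  rw [norm_mul, norm_pow, Complex.norm_natCast]

theorem analyticOnNhd_tsum_PAcoeff :
    AnalyticOnNhd ℂ (fun q : ℂ => ∑' n, (PAcoeff n : ℂ) * q ^ n) (Metric.ball 0 (1 / 2)) := by
  intro q hq
  rw [mem_ball_zero_iff] at hq
  obtain ⟨r, hr, hr1⟩ := exists_between hq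
  have hd : DifferentiableOn ℂ (fun q : ℂ => ∑' n, (PAcoeff n : ℂ) * q ^ n) (Metric.ball 0 r) := by
    refine Complex.differentiableOn_tsum_of_summable_norm
      (summable_PAcoeff ((norm_nonneg q).trans hr.le) hr1) (fun n => by fun_prop) Metric.isOpen_ball
      fun n z hz => ?_
    rw [mem_ball_zero_iff] at hz
    rw [norm_mul, norm_pow, Complex.norm_natCast]
    gcongr
  exact hd.analyticAt (Metric.isOpen_ball.mem_nhds (mem_ball_zero_iff.2 hr))

/-- In the disc Re t > 0, so the angular condition holds automatically. The overlap is an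
intersection of two balls, hence convex, and the identity theorem applies to it. -/
theorem ball_inter_sector (r₀ : ℝ) : Metric.ball (0 : ℂ) (1 / 2) ∩ sector (Real.pi / 4) r₀ =
    Metric.ball 0 (1 / 2) ∩ Metric.ball (1 / 2) r₀ := by
  ext q
  refine and_congr_right fun hq => ?_
  rw [mem_ball_zero_iff] at hq
  have h3 : ‖1 - 2 * q‖ = 2 * ‖q - 1 / 2‖ := by
    rw [show 1 - 2 * q = -2 * (q - 1 / 2) by ring, norm_mul]
    norm_num
  have hre : 0 < (1 - 2 * q).re := by
    have := (Complex.re_le_norm q).trans_lt hq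
    simp
    linarith
  rw [mem_sector_iff, mem_ball_iff_norm, h3]
  constructor
  · rintro ⟨-, h, -⟩
    linarith
  · intro h
    refine ⟨fun h0 => ?_, by linarith, ?_⟩
    · rw [h0, Complex.zero_re] at hre
      exact lt_irrefl _ hre
    · have := Complex.abs_arg_lt_pi_div_two_iff.2 (Or.inl hre)
      linarith [Real.pi_pos]

theorem tsum_PAcoeff_eq_representation {r₀ : ℝ} (h0 : 0 < r₀) (h1 : r₀ < 1 / 2)
    (hS : ∀ q ∈ sector (Real.pi / 4) r₀, SectorPoint q) :
    Set.EqOn (fun q : ℂ => ∑' n, (PAcoeff n : ℂ) * q ^ n) representation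
      (Metric.ball 0 (1 / 2) ∩ sector (Real.pi / 4) r₀) := by
  have hconn : IsPreconnected (Metric.ball (0 : ℂ) (1 / 2) ∩ sector (Real.pi / 4) r₀) := by
    rw [ball_inter_sector]
    exact ((convex_ball _ _).inter (convex_ball _ _)).isPreconnected
  refine (analyticOnNhd_tsum_PAcoeff.mono Set.inter_subset_left).eqOn_of_preconnected_of_frequently_eq
    ((analyticOnNhd_representation hS).mono Set.inter_subset_right) hconn
    (z₀ := ((1 / 2 - r₀ / 2 : ℝ) : ℂ))
    ⟨?_, ofReal_mem_sector (by linarith) (by linarith)⟩ (frequently_of_eventually_real ?_)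
  · rw [mem_ball_zero_iff, Complex.norm_real, Real.norm_of_nonneg (by linarith)]
    linarith
  · filter_upwards [Ioo_mem_nhds (show 1 / 2 - r₀ < 1 / 2 - r₀ / 2 by linarith)
      (show 1 / 2 - r₀ / 2 < 1 / 2 by linarith)] with x hx
    have h := hS x (ofReal_mem_sector hx.1 hx.2)
    exact (hasSum_PAcoeff_representation (by linarith [hx.1]) hx.2 h.toNearHalf).tsum_eq

end PrudentPolygon

theorem proposition3p1 :
    (∀ n : ℕ, (PrudentPolygon.threeSidedPolygons n).Finite) ∧
    AnalyticAt ℂ PrudentPolygon.U (1 / 2) ∧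
    AnalyticAt ℂ PrudentPolygon.V (1 / 2) ∧
    -- real `q` slightly below `1/2`, where the power series of the generating function converges
    (∃ ε : ℝ, 0 < ε ∧ ∀ q : ℝ, 1 / 2 - ε < q → q < 1 / 2 →
      ∃ P : ℂ, HasSum (fun n : ℕ => (PrudentPolygon.PAcoeff n : ℂ) * (q : ℂ) ^ n) P ∧
        PrudentPolygon.ExactRepresentation (q : ℂ) P) ∧
    -- complex `q` in a sector, for the analytic continuation `F` of the generating function
    (∃ θ₀ r₀ : ℝ, 0 < θ₀ ∧ θ₀ < Real.pi / 2 ∧ 0 < r₀ ∧ ∃ F : ℂ → ℂ,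
      AnalyticOnNhd ℂ F (Metric.ball 0 (1 / 2) ∪ PrudentPolygon.sector θ₀ r₀) ∧
      (∀ q ∈ Metric.ball (0 : ℂ) (1 / 2),
        HasSum (fun n : ℕ => (PrudentPolygon.PAcoeff n : ℂ) * q ^ n) (F q)) ∧
      ∀ q ∈ PrudentPolygon.sector θ₀ r₀, PrudentPolygon.ExactRepresentation q (F q)) := by
  obtain ⟨r₀, h0, h1, hS⟩ := PrudentPolygon.exists_sectorPoint
  have hball : ∀ q ∈ Metric.ball (0 : ℂ) (1 / 2),
      HasSum (fun n : ℕ => (PrudentPolygon.PAcoeff n : ℂ) * q ^ n)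
        (∑' n : ℕ, (PrudentPolygon.PAcoeff n : ℂ) * q ^ n) := fun q hq =>
    (PrudentPolygon.summable_PAcoeff_complex (mem_ball_zero_iff.1 hq)).hasSum
  have hrep : ∀ q ∈ PrudentPolygon.sector (Real.pi / 4) r₀,
      PrudentPolygon.ExactRepresentation q (PrudentPolygon.representation q) := fun q hq =>
    ⟨(hS q hq).seriesConverge, rfl, PrudentPolygon.T_eq_on_sector h0 h1 hS hq⟩
  have heq := PrudentPolygon.tsum_PAcoeff_eq_representation h0 h1 hS
  -- Finiteness does not depend on q; any point of (0, 1/2) serves.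
  refine ⟨(PrudentPolygon.hasSum_PAcoeff_ratioProd (q := 1 / 4) (by norm_num) (by norm_num)).1,
    PrudentPolygon.analyticAt_U_half, PrudentPolygon.analyticAt_V_half,
    ⟨r₀, h0, fun q hq hq' => ?_⟩, Real.pi / 4, r₀, by positivity, by linarith [Real.pi_pos], h0, ?_⟩
  · have hs := PrudentPolygon.ofReal_mem_sector hq hq'
    have hb : (q : ℂ) ∈ Metric.ball (0 : ℂ) (1 / 2) := by
      rw [mem_ball_zero_iff, Complex.norm_real, Real.norm_of_nonneg (by linarith)]
      exact hq'
    refine ⟨_, hball q hb, ?_⟩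
    have := heq ⟨hb, hs⟩
    dsimp only at this
    rw [this]
    exact hrep q hs
  · classical
    -- The power series and the right-hand side of (1) agree on the overlap, so the glued function
    -- coincides with an analytic one on each of the two open sets.
    have hF : Set.EqOn (fun q : ℂ => if q ∈ Metric.ball (0 : ℂ) (1 / 2) then
        ∑' n : ℕ, (PrudentPolygon.PAcoeff n : ℂ) * q ^ n else PrudentPolygon.representation q)
        PrudentPolygon.representation (PrudentPolygon.sector (Real.pi / 4) r₀) := by
      intro q hq
      dsimp only
      split_ifs with hb
      · exact heq ⟨hb, hq⟩
      · rfl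
    refine ⟨fun q => if q ∈ Metric.ball (0 : ℂ) (1 / 2) then
      ∑' n : ℕ, (PrudentPolygon.PAcoeff n : ℂ) * q ^ n else PrudentPolygon.representation q,
      ?_, fun q hq => ?_, fun q hq => ?_⟩
    · rintro q (hq | hq)
      · refine AnalyticOnNhd.congr Metric.isOpen_ball PrudentPolygon.analyticOnNhd_tsum_PAcoeff
          (fun z hz => ?_) q hq
        exact (if_pos hz).symm
      · exact AnalyticOnNhd.congr (PrudentPolygon.isOpen_sector r₀)
          (PrudentPolygon.analyticOnNhd_representation hS) hF.symm q hq
    · dsimp only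
      rw [if_pos hq]
      exact hball q hq
    · have := hF hq
      dsimp only at this ⊢
      rw [this]
      exact hrep q hq
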